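/- Let $q\ge 2$ be a prime power, and let $F$ be the field with $q^2$ elements. Let $\mathcal H_q$ be the classical Hermitian unital of order $q$: its points are the points of $PG(2,q^2)$ with $X^{q+1}+Y^{q+1}+Z^{q+1}=0$, and its blocks are the lines of $PG(2,q^2)$ that contain at least two of these points. Definitions. A $2$-$(n,k,1)$ design $\mathbf D=(\mathcal P,\mathcal B,I)$ is a finite simple incidence structure with $n$ points, $k$ points on each block, and exactly one block through any two distinct points. For a block $b$, let $C(b)$ be the set of blocks meeting $b$ in exactly one point. A proper block coloring of $C(b)$ is a map $\chi:C(b)\to b$ such that different blocks of $C(b)$ with a common point outside $b$ have different images; it is equivalent to the trivial coloring $b'\mapsto b'\cap b$ if the two have the same color classes. The $(\chi,b)$-paramodification $\mathbf D^*_{\chi,b}=(\mathcal P,\mathcal B,I^*)$ is obtained from $\mathbf D$ by making $P\in b$ incident with $b'\in C(b)$ if and only if $P=\chi(b')$, and leaving all other incidences unchanged. A switching of $\mathbf D$ with respect to distinct points $R,Q$ replaces $I$ by an incidence relation $I'\subseteq\mathcal P\times\mathcal B$ such that $(\mathcal P,\mathcal B,I')$ is a $2$-$(n,k,1)$ design with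 the same parameters and the two incidence matrices differ only in the rows of $R$ and $Q$; leaving the matrix unchanged and interchanging the two whole rows do not count as switchings. A Pasch configuration consists of six distinct points $P_1,\dots,P_6$ and four distinct blocks containing $\{P_1,P_3,P_4\}$, $\{P_1,P_5,P_6\}$, $\{P_2,P_3,P_5\}$, $\{P_2,P_4,P_6\}$, respectively. Grüning's unital of order $q$: regard $F^2$ as an affine plane, put $N(x,y)=x^{q+1}+y^{q+1}$, and derive its projective closure with respect to the set of isotropic directions ($N=0$) on the line at infinity. This gives the Hall plane: the affine lines with isotropic direction are replaced by the translates of the Baer subplanes $W\subset F^2$ through the origin, i.e. the $\mathbb F_q$-subspaces with $q^2$ elements whose directions are exactly the isotropic ones, and the points at infinity of isotropic direction are replaced by these $W$. The points of Grüning's unital are the affine points with $N(x,y)=-1$ and the $W$'s at infinity; its blocks are the lines of the Hall plane that contain at least two of these points. The construction of Grundhöfer, Stroppel and Van Maldeghem: let $G$ be a group of order $q^3-q$, $T\le G$ a subgroup of order $q$ any two distinct conjugates $T^h=h^{-1}Th$ of which intersect trivially, $S\le G$ a subgroup of order $q+1$, and $\mathcal D$ a set of $q-2$ subsets $D$ of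 $G$, each of size $q+1$, containing $1$, and such that $(x,y)\mapsto xy^{-1}$ is injective on the pairs $x\ne y$ in $D$; assume that $S\setminus\{1\}$, the sets $T^h\setminus\{1\}$ and the sets $D^*=\{xy^{-1}: x,y\in D,\ x\neq y\}$ $(D\in\mathcal D)$ partition $G\setminus\{1\}$. The points of $\mathbb U_{\mathcal D}$ and $\mathbb U_{\mathcal D}^\flat$ are the elements of $G$ and the conjugates of $T$; the blocks are the sets $Sg$, $T^hg$, $Dg$ ($g,h\in G$, $D\in\mathcal D$) and one further block $[\infty]$. An element of $G$ lies on the sets that contain it and not on $[\infty]$. A conjugate $C$ of $T$ lies on $[\infty]$ and, in $\mathbb U_{\mathcal D}$, on the cosets $gC$, while in $\mathbb U_{\mathcal D}^\flat$ it lies on the cosets $Cg$. Proposition. $\mathcal H_q$ is a $2$-$(q^3+1,q+1,1)$ design which contains no Pasch configuration and admits no switching. But $\mathcal H_q$ has non-trivial paramodifications: there are a block $b$ and a proper block coloring $\chi$ of $C(b)$, not equivalent to the trivial one, such that 1. if $q>2$, then the $(\chi,b)$-paramodification of $\mathcal H_q$ is not isomorphic to $\mathcal H_q$; 2. the $(\chi,b)$-paramodification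 of $\mathcal H_q$ is isomorphic to Grüning's unital of order $q$; 3. there are $T$, $S$ and $\mathcal D$ as above in $G=SU(2,q)$ such that $\mathbb U_{\mathcal D}$ is isomorphic to $\mathcal H_q$, and $\mathbb U_{\mathcal D}^\flat$ is isomorphic to the $(\chi,b)$-paramodification of $\mathcal H_q$. -/

import Mathlib

open scoped LinearAlgebra.Projectivization

/-! ### Incidence structures and Steiner 2-designs -/

/-- An incidence structure with point set `P` and block set `B`. -/
structure IncStr (P B : Type*) where
  /-- the incidence relation -/
  inc : P → B → Prop

namespace IncStr

variable {P B P' B' : Type*}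

/-- A `2`-`(n, k, 1)` design: a finite simple incidence structure with `n` points, `k` points on
every block, and exactly one block through any two distinct points. -/
structure IsSteiner (D : IncStr P B) (n k : ℕ) : Prop where
  finite_points : Finite P
  finite_blocks : Finite B
  card_points : Nat.card P = n
  simple : ∀ b b' : B, (∀ p, D.inc p b ↔ D.inc p b') → b = b'
  card_block : ∀ b : B, {p | D.inc p b}.ncard = k
  existsUnique_block : ∀ p p' : P, p ≠ p' → ∃! b : B, D.inc p b ∧ D.inc p' b

/-- Two incidence structures are isomorphic. -/
def Isomorphic (D : IncStr P B) (D' : IncStr P' B') : Prop :=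
  ∃ (e : P ≃ P') (f : B ≃ B'), ∀ p b, D.inc p b ↔ D'.inc (e p) (f b)

/-- The substructure induced by a set `X` of points: its blocks are the blocks of `D` that meet `X`
in at least two points. -/
def induced (D : IncStr P B) (X : Set P) :
    IncStr X {b : B // ∃ p ∈ X, ∃ p' ∈ X, p ≠ p' ∧ D.inc p b ∧ D.inc p' b} where
  inc p b := D.inc p.1 b.1

/-! ### Paramodifications -/

/-- The set `C(b)` of the blocks that meet `b` in exactly one point. -/
def meetOnce (D : IncStr P B) (b : B) : Set B :=
  {b' | ∃! p, D.inc p b ∧ D.inc p b'}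

/-- Maps from `C(b)` to the points of `b`. -/
abbrev ColoringMap (D : IncStr P B) (b : B) : Type _ :=
  D.meetOnce b → {p : P // D.inc p b}

/-- `χ : C(b) → b` is a proper block coloring of the subsystem `D_b`, which has the points off `b`
and the blocks in `C(b)`. -/
def IsProperColoring (D : IncStr P B) (b : B) (χ : D.ColoringMap b) : Prop :=
  ∀ c c' : D.meetOnce b, c ≠ c' →
    (∃ p, ¬ D.inc p b ∧ D.inc p c.1 ∧ D.inc p c'.1) → χ c ≠ χ c'

/-- The trivial block coloring `b' ↦ b' ∩ b`. -/
noncomputable def trivialColoring (D : IncStr P B) (b : B) : D.ColoringMap b :=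
  fun c => ⟨c.2.choose, c.2.choose_spec.1.1⟩

/-- Two block colorings of `C(b)` are equivalent if they have the same color classes. -/
def EquivColoring (D : IncStr P B) (b : B) (χ ψ : D.ColoringMap b) : Prop :=
  ∀ c c' : D.meetOnce b, χ c = χ c' ↔ ψ c = ψ c'

/-- The `(χ, b)`-paramodification of `D`. -/
def paramodification (D : IncStr P B) (b : B) (χ : D.ColoringMap b) : IncStr P B where
  inc p b' :=
    (¬ (D.inc p b ∧ b' ∈ D.meetOnce b) ∧ D.inc p b') ∨
    (D.inc p b ∧ ∃ h : b' ∈ D.meetOnce b, p = (χ ⟨b', h⟩ : P))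

/-! ### Switchings and Pasch configurations -/

/-- The `2`-`(n, k, 1)` design `D'`, on the points and blocks of `D`, arises from the
`2`-`(n, k, 1)` design `D` by a switching with respect to the points `R` and `Q`: the incidence
matrices differ only in the rows of `R` and `Q`. Two modifications are excluded as trivial: leaving
the matrix unchanged, and interchanging the two whole rows (a mere renaming of `R` and `Q`). -/
structure IsSwitching (D D' : IncStr P B) (n k : ℕ) (R Q : P) : Prop where
  isSteiner : D'.IsSteiner n k
  ne : R ≠ Q
  other_rows : ∀ p, p ≠ R → p ≠ Q → ∀ b, D'.inc p b ↔ D.inc p b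
  not_unchanged : ¬ ∀ b, (D'.inc R b ↔ D.inc R b) ∧ (D'.inc Q b ↔ D.inc Q b)
  not_interchanged : ¬ ∀ b, (D'.inc R b ↔ D.inc Q b) ∧ (D'.inc Q b ↔ D.inc R b)

/-- `D` contains no Pasch configuration (complete quadrilateral): there are no six distinct points
`p₁, …, p₆` and four distinct blocks on which the triples `p₁p₃p₄`, `p₁p₅p₆`, `p₂p₃p₅`, `p₂p₄p₆`
lie. -/
def AntiPasch (D : IncStr P B) : Prop :=
  ¬ ∃ (p : Fin 6 → P) (b : Fin 4 → B), Function.Injective p ∧ Function.Injective b ∧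
    (D.inc (p 0) (b 0) ∧ D.inc (p 2) (b 0) ∧ D.inc (p 3) (b 0)) ∧
    (D.inc (p 0) (b 1) ∧ D.inc (p 4) (b 1) ∧ D.inc (p 5) (b 1)) ∧
    (D.inc (p 1) (b 2) ∧ D.inc (p 2) (b 2) ∧ D.inc (p 4) (b 2)) ∧
    (D.inc (p 1) (b 3) ∧ D.inc (p 3) (b 3) ∧ D.inc (p 5) (b 3))

end IncStr

/-! ### The classical Hermitian unital -/

section Unitals

variable (F : Type*) [Field F] (q : ℕ)

/-- The Hermitian norm `∑ vᵢ ^ (q + 1)`; for a field with `q ^ 2` elements this is `h v v` for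
the Hermitian form `h u v = ∑ uᵢ * vᵢ ^ q`. -/
def hermNorm {m : ℕ} (v : Fin m → F) : F := ∑ i, v i ^ (q + 1)

/-- The projective plane over `F`: its points and lines are the one- and two-dimensional subspaces
of `F ^ 3`. -/
def projPlane :
    IncStr (ℙ F (Fin 3 → F)) {L : Submodule F (Fin 3 → F) // Module.finrank F L = 2} where
  inc p L := p.submodule ≤ L.1

/-- The absolute points of the Hermitian polarity. -/
def hermPoints : Set (ℙ F (Fin 3 → F)) := {p | hermNorm F q p.rep = 0}

/-- The classical Hermitian unital of order `q`, for a field `F` with `q ^ 2` elements. -/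
def hermitianUnital := (projPlane F).induced (hermPoints F q)

/-! ### Grüning's unital in the Hall plane -/

/-- Let `F` have `q ^ 2` elements. The line at infinity of the affine plane `F ^ 2` carries the
derivation set of the isotropic directions, a Baer subline. `W` is a Baer subplane through the origin
with this derivation set as its points at infinity: a subspace over the subfield
`{a | a ^ q = a}` of order `q`, with `q ^ 2` elements, whose directions are the isotropic ones. -/
structure IsBaerDirection (W : AddSubgroup (Fin 2 → F)) : Prop where
  smul_mem : ∀ a : F, a ^ q = a → ∀ w ∈ W, a • w ∈ W
  card_eq : Nat.card W = q ^ 2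
  directions : ∀ v : Fin 2 → F, v ≠ 0 → ((∃ c : F, c ≠ 0 ∧ c • v ∈ W) ↔ hermNorm F q v = 0)

/-- The spread of the Hall plane: the lines through the origin of `F ^ 2` with non-isotropic
direction, and the Baer subplanes that replace the lines with isotropic direction. -/
def hallSpread : Set (AddSubgroup (Fin 2 → F)) :=
  {W | (∃ v : Fin 2 → F, hermNorm F q v ≠ 0 ∧ W = (Submodule.span F {v}).toAddSubgroup) ∨
    IsBaerDirection F q W}

/-- The affine lines of the Hall plane are the translates of the members of the spread. -/
def hallLines : Set (Set (Fin 2 → F)) :=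
  {X | ∃ W ∈ hallSpread F q, ∃ v : Fin 2 → F, X = {x | x - v ∈ W}}

/-- The (projective) Hall plane of order `q ^ 2`, obtained from the projective plane over a field `F`
with `q ^ 2` elements by derivation. The points at infinity are the members of the spread; `none` is
the line at infinity. -/
def hallPlane : IncStr ((Fin 2 → F) ⊕ hallSpread F q) (Option (hallLines F q)) where
  inc p b := match p, b with
    | Sum.inl x, some X => x ∈ X.1
    | Sum.inl _, none => False
    | Sum.inr W, some X => ∃ v : Fin 2 → F, X.1 = {x | x - v ∈ W.1}
    | Sum.inr _, none => True

/-- The points of Grüning's unital: the affine points `(x, y)` of the Hermitian unital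
`X ^ (q + 1) + Y ^ (q + 1) + Z ^ (q + 1) = 0`, together with the derived points at infinity. -/
def grueningPoints : Set ((Fin 2 → F) ⊕ hallSpread F q) :=
  {p | (∃ x, p = Sum.inl x ∧ hermNorm F q x = -1) ∨
    (∃ W, p = Sum.inr W ∧ IsBaerDirection F q W.1)}

/-- Grüning's unital of order `q`, for a field `F` with `q ^ 2` elements. -/
def grueningUnital := (hallPlane F q).induced (grueningPoints F q)

/-- The special unitary group `SU(2, q)`, for a field `F` with `q ^ 2` elements. -/
def SU2 : Subgroup (Matrix.SpecialLinearGroup (Fin 2) F) where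
  carrier := {A | ∀ v : Fin 2 → F, hermNorm F q (A.1.mulVec v) = hermNorm F q v}
  one_mem' := by intro v; simp
  mul_mem' := by
    intro A A' hA hA' v
    have h := hA (A'.1.mulVec v)
    rw [Matrix.mulVec_mulVec, hA' v] at h
    simpa using h
  inv_mem' := by
    intro A hA v
    have h := hA (A⁻¹.1.mulVec v)
    have e : A.1 * A⁻¹.1 = 1 := by
      rw [Matrix.SpecialLinearGroup.coe_inv, Matrix.mul_adjugate, A.2, one_smul]
    rw [Matrix.mulVec_mulVec, e, Matrix.one_mulVec] at h
    exact h.symm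

end Unitals

/-! ### The construction of Grundhöfer, Stroppel and Van Maldeghem -/

section GSV

variable {G : Type*} [Group G]

/-- The conjugate `T ^ h = h⁻¹ T h`. -/
def conjSubgroup (T : Subgroup G) (h : G) : Subgroup G :=
  T.map (MulAut.conj h⁻¹).toMonoidHom

/-- The conjugacy class of `T`. -/
def conjClass (T : Subgroup G) : Set (Subgroup G) := {C | ∃ h, C = conjSubgroup T h}

/-- The right translate `X g`. -/
def rightTranslate (X : Set G) (g : G) : Set G := (fun x => x * g) '' X

/-- The left translate `g X`. -/
def leftTranslate (g : G) (X : Set G) : Set G := (fun x => g * x) '' X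

/-- The set `D* = {x y⁻¹ | x, y ∈ D, x ≠ y}`. -/
def quotientSet (D : Set G) : Set G := {g | ∃ x ∈ D, ∃ y ∈ D, x ≠ y ∧ g = x * y⁻¹}

/-- The members of the system that has to partition `G \ {1}`. -/
def partitionSystem (T S : Subgroup G) (𝒟 : Set (Set G)) : Set (Set G) :=
  {X | X = (S : Set G) \ {1} ∨ (∃ C ∈ conjClass T, X = (C : Set G) \ {1}) ∨
    ∃ D ∈ 𝒟, X = quotientSet D}

/-- The hypotheses on `G`, `T`, `S` and `𝒟` under which the construction gives unitals of
order `q`. -/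
structure IsGSVSystem (q : ℕ) (T S : Subgroup G) (𝒟 : Set (Set G)) : Prop where
  card_group : Nat.card G = q ^ 3 - q
  card_T : Nat.card T = q
  trivial_intersection : ∀ C ∈ conjClass T, ∀ C' ∈ conjClass T, C ≠ C' → C ⊓ C' = ⊥
  card_S : Nat.card S = q + 1
  one_mem : ∀ D ∈ 𝒟, (1 : G) ∈ D
  card_mem : ∀ D ∈ 𝒟, D.ncard = q + 1
  card_system : 𝒟.ncard = q - 2
  injective_quotient : ∀ D ∈ 𝒟, ∀ x ∈ D, ∀ y ∈ D, ∀ x' ∈ D, ∀ y' ∈ D, x ≠ y → x' ≠ y' →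
    x * y⁻¹ = x' * y'⁻¹ → x = x' ∧ y = y'
  pairwiseDisjoint : (partitionSystem T S 𝒟).PairwiseDisjoint id
  sUnion_eq : ⋃₀ partitionSystem T S 𝒟 = {1}ᶜ

/-- The affine blocks: the right cosets of `S` and of the conjugates of `T`, and the right translates
of the members of `𝒟`. -/
def gsvBlocks (T S : Subgroup G) (𝒟 : Set (Set G)) : Set (Set G) :=
  {X | (∃ g, X = rightTranslate (S : Set G) g) ∨
    (∃ C ∈ conjClass T, ∃ g, X = rightTranslate (C : Set G) g) ∨
    ∃ D ∈ 𝒟, ∃ g, X = rightTranslate D g}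

/-- The unital `𝕌_𝒟`: a conjugate `C` of `T` is incident with the cosets `g C`, and `none` is the block
at infinity. -/
def gsvUnital (T S : Subgroup G) (𝒟 : Set (Set G)) :
    IncStr (G ⊕ conjClass T) (Option (gsvBlocks T S 𝒟)) where
  inc p b := match p, b with
    | Sum.inl g, some X => g ∈ X.1
    | Sum.inl _, none => False
    | Sum.inr C, some X => ∃ g, X.1 = leftTranslate g (C.1 : Set G)
    | Sum.inr _, none => True

/-- The unital `𝕌_𝒟^♭`: a conjugate `C` of `T` is incident with the cosets `C g`, and `none` is the
block at infinity. -/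
def gsvUnitalFlat (T S : Subgroup G) (𝒟 : Set (Set G)) :
    IncStr (G ⊕ conjClass T) (Option (gsvBlocks T S 𝒟)) where
  inc p b := match p, b with
    | Sum.inl g, some X => g ∈ X.1
    | Sum.inl _, none => False
    | Sum.inr C, some X => ∃ g, X.1 = rightTranslate (C.1 : Set G) g
    | Sum.inr _, none => True

end GSV

/-!
Let `σ` be the involution of `F`, and let `r • u = r 0 * u 0 + r 1 * u 1`. The affine part of the
Hermitian unital is, up to a scalar of norm `-1`, the set of the vectors `r` of Hermitian norm `1` in
`F ^ 2`, and the first rows identify it with the group `SU(2, q)`. Its intersections with the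
lines `r • u = 0` and `r • u = 1` have `q + 1` elements if `u` is not isotropic (tangents apart), and
`q` elements if `u` is isotropic. In the second case, a point at infinity has to be attached, and the
points at infinity are the `q + 1` elements `m` of norm `-1`. There are two ways to do this: by
`u 1 = m * u 0` or by `u 1 = m * σ (u 0)`, that is, by `u 1 = m * τ (u 0)` where `τ` is the
identity or `σ`. Both give designs (`isSteiner_unitalModel`), since `x ↦ r 0 * x + r 1 * m * τ x` is
an additive bijection of `F` whenever `r` has norm `1`. They differ only in the way in which the points
of the block at infinity are attached, so that each is a paramodification of the other
(`IncStr.exists_paramodification_isomorphic`). The proof identifies the structures in question with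
these two.

* For `τ = id` this is the Hermitian unital (`isomorphic_hermitianUnital`).
* For `τ = σ` this is Grüning's unital (`isomorphic_grueningUnital`): the Baer subplanes are the
  sets `{v | v 1 = c * σ (v 0)}` with `c` of norm `-1` (`IsBaerDirection.exists_eq`), because the
  second coordinate of such a subplane is an additive function of the first which preserves norms up
  to a constant, hence also traces; its value at `x` is `x` or `σ x` up to a constant, and an additive
  group is not a union of two proper subgroups. The case of `x` is excluded as it gives an
  `F`-subspace, with a single direction.
* In `SU(2, q)`, let `T` be the stabilizer of an isotropic vector `(1, m)`. The conjugates of `T`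
  correspond to the isotropic directions, and the left and the right cosets of these are just the
  isotropic lines, which are attached by the first or the second rule (`exists_leftTranslate_iff`,
  `exists_rightTranslate_iff`). The remaining lines are the right translates of the diagonal
  subgroup `S` and of the sets `D = {g | g (1, y) ∈ {1} × F}`, one for each norm of `y` other
  than `0` and `-1`. For an element `g ≠ 1` there is at most one `t` with `g (1, t) ∈ {1} × F`, and
  the norm of `t`, together with `t` itself if this norm is `-1`, tells in which member of the
  partition `g` lies (`isGSVSystem`).

That the Hermitian unital contains no Pasch configuration (`antiPasch_hermitianUnital`) follows from
the condition of Menelaus and a Gram determinant. The second structure contains one if `2 < q`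
(`not_antiPasch_unitalModel_conj`), so that the two are not isomorphic.

Switchings are excluded by counting (`IncStr.IsSteiner.not_isSwitching`). If a block `b` through `R`
and a block through `Q` meet off `R` and `Q`, then both are switched or none is. Without Pasch
configurations, at least `q * (q - 1)` further blocks through `R` are tied to `b` in this way by way of
a block through `Q`. As there are only `q ^ 2 - 1` blocks through `R` that do not contain `Q`, all of
them are switched or none is.
-/

/-! ### Isomorphisms of incidence structures -/

namespace IncStr

section Iso

variable {P B P' B' P'' B'' : Type*}

theorem Isomorphic.symm {D : IncStr P B} {D' : IncStr P' B'} (h : D.Isomorphic D') :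
    D'.Isomorphic D := by
  obtain ⟨e, f, h⟩ := h
  exact ⟨e.symm, f.symm, fun p b => by simp [h]⟩

theorem Isomorphic.trans {D : IncStr P B} {D' : IncStr P' B'} {D'' : IncStr P'' B''}
    (h : D.Isomorphic D') (h' : D'.Isomorphic D'') : D.Isomorphic D'' := by
  obtain ⟨e, f, h⟩ := h
  obtain ⟨e', f', h'⟩ := h'
  exact ⟨e.trans e', f.trans f', fun p b => by simp [h, h']⟩

theorem AntiPasch.of_isomorphic {D : IncStr P B} {D' : IncStr P' B'} (hD : D.AntiPasch)
    (h : D'.Isomorphic D) : D'.AntiPasch := by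
  obtain ⟨e, f, h⟩ := h
  rintro ⟨p, b, hp, hb, H⟩
  refine hD ⟨e ∘ p, f ∘ b, e.injective.comp hp, f.injective.comp hb, ?_⟩
  simpa only [Function.comp_apply, ← h] using H

theorem not_antiPasch_of_nodup (D : IncStr P B) {p₁ p₂ p₃ p₄ p₅ p₆ : P} {b₁ b₂ b₃ b₄ : B}
    (hp : [p₁, p₂, p₃, p₄, p₅, p₆].Nodup) (hb : [b₁, b₂, b₃, b₄].Nodup)
    (h₁ : D.inc p₁ b₁ ∧ D.inc p₃ b₁ ∧ D.inc p₄ b₁) (h₂ : D.inc p₁ b₂ ∧ D.inc p₅ b₂ ∧ D.inc p₆ b₂)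
    (h₃ : D.inc p₂ b₃ ∧ D.inc p₃ b₃ ∧ D.inc p₅ b₃)
    (h₄ : D.inc p₂ b₄ ∧ D.inc p₄ b₄ ∧ D.inc p₆ b₄) : ¬ D.AntiPasch := by
  refine not_not_intro ⟨![p₁, p₂, p₃, p₄, p₅, p₆], ![b₁, b₂, b₃, b₄], ?_, ?_, h₁, h₂, h₃, h₄⟩
  · rw [← List.nodup_ofFn]
    simpa [List.ofFn_succ] using hp
  · rw [← List.nodup_ofFn]
    simpa [List.ofFn_succ] using hb

theorem IsSteiner.of_isomorphic {D : IncStr P B} {D' : IncStr P' B'} {n k : ℕ}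
    (hD : D.IsSteiner n k) (h : D'.Isomorphic D) : D'.IsSteiner n k := by
  obtain ⟨e, f, h⟩ := h
  have := hD.finite_points
  have := hD.finite_blocks
  refine ⟨Finite.of_equiv _ e.symm, Finite.of_equiv _ f.symm, ?_, ?_, ?_, ?_⟩
  · rw [← hD.card_points, Nat.card_congr e]
  · intro b b' hb
    apply f.injective
    apply hD.simple
    intro p
    obtain ⟨p, rfl⟩ := e.surjective p
    rw [← h, ← h, hb]
  · intro b
    rw [← hD.card_block (f b), ← Set.ncard_image_of_injective _ e.injective]
    congr 1
    ext p
    obtain ⟨p, rfl⟩ := e.surjective p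
    simp [h]
  · intro p p' hp
    have := hD.existsUnique_block (e p) (e p') (e.injective.ne hp)
    rw [← f.existsUnique_congr_right] at this
    simpa only [← h] using this

theorem IsSteiner.exists_ne_of_block {D : IncStr P B} {n k : ℕ} (hD : D.IsSteiner n k)
    (hk : 2 ≤ k) (b : B) : ∃ p p', p ≠ p' ∧ D.inc p b ∧ D.inc p' b := by
  have := hD.finite_points
  have h : 1 < {p | D.inc p b}.ncard := by rw [hD.card_block]; omega
  rw [Set.one_lt_ncard] at h
  obtain ⟨p, hp, p', hp', hne⟩ := h
  exact ⟨p, p', hne, hp, hp'⟩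

theorem IsSteiner.block_eq {D : IncStr P B} {n k : ℕ} (hD : D.IsSteiner n k) {p p' : P} {b b' : B}
    (hp : p ≠ p') (h1 : D.inc p b) (h2 : D.inc p' b) (h3 : D.inc p b') (h4 : D.inc p' b') :
    b = b' :=
  (hD.existsUnique_block p p' hp).unique ⟨h1, h2⟩ ⟨h3, h4⟩

/-- Two simple structures are isomorphic as soon as a bijection of the points carries the point sets
of the blocks onto each other. -/
theorem isomorphic_of_simple {D : IncStr P B} {D' : IncStr P' B'}
    (hD : ∀ b b' : B, (∀ p, D.inc p b ↔ D.inc p b') → b = b')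
    (hD' : ∀ b b' : B', (∀ p, D'.inc p b ↔ D'.inc p b') → b = b') (e : P ≃ P')
    (h : ∀ b, ∃ b', ∀ p, D.inc p b ↔ D'.inc (e p) b')
    (h' : ∀ b', ∃ b, ∀ p, D.inc p b ↔ D'.inc (e p) b') : D.Isomorphic D' := by
  choose f hf using h
  refine ⟨e, Equiv.ofBijective f ⟨?_, ?_⟩, fun p b => hf b p⟩
  · intro b b' hb
    exact hD _ _ fun p => by rw [hf, hf, hb]
  · intro b'
    obtain ⟨b, hb⟩ := h' b'
    refine ⟨b, hD' _ _ fun p => ?_⟩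
    obtain ⟨p, rfl⟩ := e.surjective p
    rw [← hf, hb]

/-- A design whose blocks are cut out on the set `X` by blocks of a partial linear space is
isomorphic to the structure induced on `X`. -/
theorem IsSteiner.isomorphic_induced {D : IncStr P B} {n k : ℕ} (hD : D.IsSteiner n k) (hk : 2 ≤ k)
    (E : IncStr P' B') (X : Set P')
    (hE : ∀ p ∈ X, ∀ p' ∈ X, p ≠ p' → ∀ b b', E.inc p b → E.inc p' b → E.inc p b' → E.inc p' b' →
      b = b')
    (e : P ≃ X) (h : ∀ b, ∃ b', ∀ p, D.inc p b ↔ E.inc (e p) b') :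
    D.Isomorphic (E.induced X) := by
  have hE' : ∀ b b' : {b : B' // ∃ p ∈ X, ∃ p' ∈ X, p ≠ p' ∧ E.inc p b ∧ E.inc p' b},
      (∀ p, (E.induced X).inc p b ↔ (E.induced X).inc p b') → b = b' := by
    rintro ⟨b, p, hp, p', hp', hne, h1, h2⟩ b' hb
    exact Subtype.ext (hE p hp p' hp' hne _ _ h1 h2 ((hb ⟨p, hp⟩).1 h1) ((hb ⟨p', hp'⟩).1 h2))
  refine isomorphic_of_simple hD.simple hE' e ?_ ?_
  · intro b
    obtain ⟨b', hb'⟩ := h b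
    obtain ⟨p, p', hne, h1, h2⟩ := hD.exists_ne_of_block hk b
    exact ⟨⟨b', e p, (e p).2, e p', (e p').2, fun h => hne (e.injective (Subtype.ext h)),
      (hb' p).1 h1, (hb' p').1 h2⟩, hb'⟩
  · rintro ⟨b', p, hp, p', hp', hne, h1, h2⟩
    obtain ⟨x, hx⟩ := e.surjective ⟨p, hp⟩
    obtain ⟨y, hy⟩ := e.surjective ⟨p', hp'⟩
    have hxy : x ≠ y := by
      rintro rfl
      exact hne (congrArg Subtype.val (hx.symm.trans hy))
    obtain ⟨b, ⟨hb1, hb2⟩, -⟩ := hD.existsUnique_block x y hxy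
    obtain ⟨b'', hb''⟩ := h b
    have h3 := (hb'' x).1 hb1
    have h4 := (hb'' y).1 hb2
    rw [hx] at h3
    rw [hy] at h4
    obtain rfl := hE p hp p' hp' hne _ _ h1 h2 h3 h4
    exact ⟨b, hb''⟩

end Iso

/-! ### Paramodifications that merely reattach the points of a block -/

section Paramodification

variable {P B P' B' : Type*}

/-- If `D'` differs from `D` only in the way in which the points of `b` are attached to the blocks
of `C(b)`, and in `D'` each of these blocks still has exactly one point on `b`, then `D'` is the
paramodification for the coloring by these points. -/
theorem exists_paramodification_eq (D D' : IncStr P B) (b : B)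
    (hD' : ∀ p p', p ≠ p' → ∀ c c', D'.inc p c → D'.inc p' c → D'.inc p c' → D'.inc p' c' → c = c')
    (hoff : ∀ p, ¬ D.inc p b → ∀ c, D'.inc p c ↔ D.inc p c)
    (hmeet : ∀ c, (∃! p, D.inc p b ∧ D.inc p c) → ∃! p, D.inc p b ∧ D'.inc p c)
    (hrest : ∀ c, ¬ (∃! p, D.inc p b ∧ D.inc p c) → ∀ p, D'.inc p c ↔ D.inc p c)
    (hne : ∃ c c' p, (∃! p, D.inc p b ∧ D.inc p c) ∧ (∃! p, D.inc p b ∧ D.inc p c') ∧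
      D.inc p b ∧ D.inc p c ∧ D.inc p c' ∧ ¬ ∃ p, D.inc p b ∧ D'.inc p c ∧ D'.inc p c') :
    ∃ χ, D.IsProperColoring b χ ∧ ¬ D.EquivColoring b χ (D.trivialColoring b) ∧
      D.paramodification b χ = D' := by
  have key : ∀ c : D.meetOnce b, ∃ p : {p : P // D.inc p b}, D'.inc p.1 c.1 ∧
      ∀ p', D.inc p' b → D'.inc p' c.1 → p' = p := by
    intro c
    obtain ⟨p, ⟨h1, h2⟩, h3⟩ := hmeet c.1 c.2
    exact ⟨⟨p, h1⟩, h2, fun p' h h' => h3 p' ⟨h, h'⟩⟩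
  choose χ hχ hχ' using key
  refine ⟨χ, ?_, ?_, ?_⟩
  · rintro c c' hcc ⟨p, hp, h1, h2⟩ heq
    have hpne : p ≠ χ c := by
      rintro rfl
      exact hp (χ c).2
    exact hcc (Subtype.ext (hD' p (χ c) hpne _ _ ((hoff p hp _).2 h1) (hχ c)
      ((hoff p hp _).2 h2) (by rw [heq]; exact hχ c')))
  · intro hequiv
    obtain ⟨c, c', p, hc, hc', hpb, hpc, hpc', hno⟩ := hne
    have h1 : (D.trivialColoring b ⟨c, hc⟩ : P) = p := by
      have := hc.choose_spec.2 p ⟨hpb, hpc⟩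
      exact this.symm
    have h2 : (D.trivialColoring b ⟨c', hc'⟩ : P) = p := by
      have := hc'.choose_spec.2 p ⟨hpb, hpc'⟩
      exact this.symm
    have h3 := (hequiv ⟨c, hc⟩ ⟨c', hc'⟩).2 (Subtype.ext (h1.trans h2.symm))
    exact hno ⟨χ ⟨c, hc⟩, (χ ⟨c, hc⟩).2, hχ _, by rw [h3]; exact hχ _⟩
  · have : ∀ p c, (D.paramodification b χ).inc p c ↔ D'.inc p c := by
      intro p c
      change ((¬ (D.inc p b ∧ c ∈ D.meetOnce b) ∧ D.inc p c) ∨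
        (D.inc p b ∧ ∃ h : c ∈ D.meetOnce b, p = (χ ⟨c, h⟩ : P))) ↔ _
      by_cases hp : D.inc p b
      · by_cases hc : c ∈ D.meetOnce b
        · have : p = (χ ⟨c, hc⟩ : P) ↔ D'.inc p c :=
            ⟨fun h => by rw [h]; exact hχ ⟨c, hc⟩, fun h => hχ' ⟨c, hc⟩ p hp h⟩
          simp [hp, hc, this]
        · simp [hp, hc, hrest c hc p]
      · simp [hp, hoff p hp c]
    cases h : D.paramodification b χ
    cases D'
    congr
    ext p c
    have h' := this p c
    rw [h] at h'
    exact h'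

/-- The previous construction, along an isomorphism of `D` with `D₀`. -/
theorem exists_paramodification_isomorphic {D : IncStr P B} (D₀ D₁ : IncStr P' B')
    (hiso : D.Isomorphic D₀) (b : B')
    (hD₁ : ∀ p p', p ≠ p' → ∀ c c', D₁.inc p c → D₁.inc p' c → D₁.inc p c' → D₁.inc p' c' → c = c')
    (hoff : ∀ p, ¬ D₀.inc p b → ∀ c, D₁.inc p c ↔ D₀.inc p c)
    (hmeet : ∀ c, (∃! p, D₀.inc p b ∧ D₀.inc p c) → ∃! p, D₀.inc p b ∧ D₁.inc p c)
    (hrest : ∀ c, ¬ (∃! p, D₀.inc p b ∧ D₀.inc p c) → ∀ p, D₁.inc p c ↔ D₀.inc p c)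
    (hne : ∃ c c' p, (∃! p, D₀.inc p b ∧ D₀.inc p c) ∧ (∃! p, D₀.inc p b ∧ D₀.inc p c') ∧
      D₀.inc p b ∧ D₀.inc p c ∧ D₀.inc p c' ∧ ¬ ∃ p, D₀.inc p b ∧ D₁.inc p c ∧ D₁.inc p c') :
    ∃ b χ, D.IsProperColoring b χ ∧ ¬ D.EquivColoring b χ (D.trivialColoring b) ∧
      (D.paramodification b χ).Isomorphic D₁ := by
  obtain ⟨e, f, h⟩ := hiso
  obtain ⟨b, rfl⟩ := f.surjective b
  have hex : ∀ (D' : IncStr P' B') (c : B), (∃! p, D₀.inc p (f b) ∧ D'.inc p (f c)) ↔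
      ∃! p, D.inc p b ∧ D'.inc (e p) (f c) := by
    intro D' c
    rw [← e.existsUnique_congr_right]
    simp only [h]
  have hex' : ∀ c, (∃! p, D.inc p b ∧ D.inc p c) ↔ ∃! p, D₀.inc p (f b) ∧ D₀.inc p (f c) := by
    intro c
    rw [hex]
    simp only [h]
  obtain ⟨χ, h1, h2, h3⟩ := exists_paramodification_eq D ⟨fun p c => D₁.inc (e p) (f c)⟩ b
    (fun p p' hp c c' a1 a2 a3 a4 => f.injective (hD₁ _ _ (e.injective.ne hp) _ _ a1 a2 a3 a4))
    (fun p hp c => by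
      rw [h] at hp ⊢
      exact hoff _ hp _)
    (fun c hc => (hex D₁ c).1 (hmeet _ ((hex' c).1 hc)))
    (fun c hc p => by
      rw [hex'] at hc
      rw [h]
      exact hrest _ hc _)
    (by
      obtain ⟨c, c', p, H⟩ := hne
      obtain ⟨c, rfl⟩ := f.surjective c
      obtain ⟨c', rfl⟩ := f.surjective c'
      obtain ⟨p, rfl⟩ := e.surjective p
      obtain ⟨a1, a2, a3, a4, a5, a6⟩ := H
      rw [← h] at a3 a4 a5
      refine ⟨c, c', p, (hex' c).2 a1, (hex' c').2 a2, a3, a4, a5, ?_⟩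
      simp only [h]
      rintro ⟨p, hp⟩
      exact a6 ⟨e p, hp⟩)
  exact ⟨b, χ, h1, h2, by rw [h3]; exact ⟨e, f, fun _ _ => Iff.rfl⟩⟩

end Paramodification

end IncStr

/-! ### Switchings of designs without Pasch configurations -/

namespace IncStr

section Switching

variable {P B : Type*}

/-- The blocks through `R` but not through `Q`. -/
def blocksThrough (D : IncStr P B) (R Q : P) : Set B := {b | D.inc R b ∧ ¬ D.inc Q b}

/-- The blocks through `R` but not `Q` which are different from `b` and have, together with `b`, a
common transversal through `Q` with intersection points different from `R` and `Q`. -/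
def secondNeighbours (D : IncStr P B) (R Q : P) (b : B) : Set B :=
  {c | c ∈ D.blocksThrough R Q ∧ c ≠ b ∧ ∃ d ∈ D.blocksThrough Q R,
    (∃ X, D.inc X b ∧ D.inc X d) ∧ ∃ Y, D.inc Y c ∧ D.inc Y d}

theorem IsSteiner.card_blocksThrough {D : IncStr P B} {q : ℕ} (hq : 2 ≤ q)
    (hD : D.IsSteiner (q ^ 3 + 1) (q + 1)) {R Q : P} (hne : R ≠ Q) :
    (D.blocksThrough R Q).ncard + 1 = q ^ 2 := by
  classical
  have := hD.finite_points
  have := hD.finite_blocks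
  have := Fintype.ofFinite P
  have := Fintype.ofFinite B
  have hex : ∀ p, ∃ b, p ≠ R → D.inc R b ∧ D.inc p b := by
    intro p
    by_cases hp : p = R
    · obtain ⟨b, -⟩ := (hD.existsUnique_block R Q hne).exists
      exact ⟨b, fun h => absurd hp h⟩
    · obtain ⟨b, hb⟩ := (hD.existsUnique_block R p (Ne.symm hp)).exists
      exact ⟨b, fun _ => hb⟩
  choose f hf using hex
  have hcount := Finset.card_eq_sum_card_fiberwise (f := f)
    (s := Finset.univ.erase R) (t := Finset.univ.filter fun b => D.inc R b) (by
      intro p hp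
      simp only [Finset.coe_erase, Finset.coe_univ, Set.mem_sdiff, Set.mem_univ,
        Set.mem_singleton_iff, true_and] at hp
      simpa using (hf p hp).1)
  have hfib : ∀ b ∈ Finset.univ.filter (fun b => D.inc R b),
      ((Finset.univ.erase R).filter fun p => f p = b).card = q := by
    intro b hb
    simp only [Finset.mem_filter, Finset.mem_univ, true_and] at hb
    have h1 : (Finset.univ.erase R).filter (fun p => f p = b) =
        (Finset.univ.filter fun p => D.inc p b).erase R := by
      ext p
      simp only [Finset.mem_filter, Finset.mem_erase, Finset.mem_univ, and_true, true_and]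
      refine and_congr_right fun hp => ⟨fun h => h ▸ (hf p hp).2, fun h => ?_⟩
      exact hD.block_eq hp (hf p hp).2 (hf p hp).1 h hb
    have h2 := hD.card_block b
    rw [Set.ncard_eq_toFinset_card'] at h2
    rw [h1, Finset.card_erase_of_mem (by simpa using hb)]
    simp only [Set.toFinset_ofPred] at h2
    omega
  rw [Finset.sum_congr rfl hfib, Finset.sum_const, Finset.card_erase_of_mem (Finset.mem_univ _),
    Finset.card_univ, ← Nat.card_eq_fintype_card, hD.card_points, smul_eq_mul] at hcount
  have h3 : (Finset.univ.filter fun b => D.inc R b).card = q ^ 2 := by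
    apply Nat.eq_of_mul_eq_mul_right (show 0 < q by omega)
    rw [← hcount]
    simp [pow_succ]
  obtain ⟨b₀, ⟨hR, hQ⟩, hb₀⟩ := hD.existsUnique_block R Q hne
  have h4 : D.blocksThrough R Q = ((Finset.univ.filter fun b => D.inc R b).erase b₀ : Finset B) := by
    ext b
    simp only [blocksThrough, Set.mem_ofPred_eq, Finset.coe_erase, Finset.coe_filter,
      Finset.mem_univ, true_and, Set.mem_sdiff, Set.mem_singleton_iff]
    refine and_congr_right fun hb => ⟨?_, fun h h' => h (hb₀ b ⟨hb, h'⟩)⟩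
    rintro h rfl
    exact h hQ
  rw [h4, Set.ncard_coe_finset, Finset.card_erase_of_mem (by simpa using hR), h3]
  have : 0 < q ^ 2 := by positivity
  omega

/-- Without Pasch configurations, the blocks through `R` that are reached from `b` by way of a point
of `b` and a further point of the block joining that point to `Q` are pairwise different. -/
theorem IsSteiner.card_secondNeighbours {D : IncStr P B} {q n : ℕ}
    (hD : D.IsSteiner n (q + 1)) (hA : D.AntiPasch) {R Q : P} {b : B}
    (hb : b ∈ D.blocksThrough R Q) : q * (q - 1) ≤ (D.secondNeighbours R Q b).ncard := by
  classical
  have := hD.finite_points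
  have := hD.finite_blocks
  have := Fintype.ofFinite P
  have := Fintype.ofFinite B
  obtain ⟨hbR, hbQ⟩ := hb
  have hne : R ≠ Q := by
    rintro rfl
    exact hbQ hbR
  have hex : ∀ Z p, ∃ c, p ≠ Z → D.inc Z c ∧ D.inc p c := by
    intro Z p
    by_cases hp : p = Z
    · exact ⟨b, fun h => absurd hp h⟩
    · obtain ⟨b, hb⟩ := (hD.existsUnique_block Z p (Ne.symm hp)).exists
      exact ⟨b, fun _ => hb⟩
  choose f hf using hex
  set pts : B → Finset P := fun c => Finset.univ.filter fun p => D.inc p c with hpts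
  have hcard : ∀ c, (pts c).card = q + 1 := by
    intro c
    have h2 := hD.card_block c
    rw [Set.ncard_eq_toFinset_card'] at h2
    simpa only [Set.toFinset_ofPred] using h2
  have mem_pts : ∀ p c, p ∈ pts c ↔ D.inc p c := by simp [hpts]
  set s : Finset (Σ _ : P, P) :=
    ((pts b).erase R).sigma fun X => ((pts (f Q X)).erase Q).erase X with hs
  have hXQ : ∀ X, D.inc X b → X ≠ Q := by
    rintro X hX rfl
    exact hbQ hX
  have hscard : s.card = q * (q - 1) := by
    rw [hs, Finset.card_sigma, Finset.sum_congr rfl (g := fun _ => q - 1), Finset.sum_const,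
      Finset.card_erase_of_mem ((mem_pts _ _).2 hbR), hcard, smul_eq_mul]
    · simp
    · intro X hX
      simp only [Finset.mem_erase, mem_pts] at hX
      have hX' := hf Q X (hXQ X hX.2)
      rw [Finset.card_erase_of_mem, Finset.card_erase_of_mem, hcard]
      · simp
      · exact (mem_pts _ _).2 hX'.1
      · exact Finset.mem_erase.2 ⟨hXQ X hX.2, (mem_pts _ _).2 hX'.2⟩
  have mem_s : ∀ X Y, (⟨X, Y⟩ : Σ _ : P, P) ∈ s →
      X ≠ R ∧ D.inc X b ∧ Y ≠ X ∧ Y ≠ Q ∧ Y ≠ R ∧ D.inc Y (f Q X) ∧ ¬ D.inc R (f Q X) ∧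
        ¬ D.inc Y b ∧ ¬ D.inc Q (f R Y) ∧ D.inc Q (f Q X) ∧ D.inc X (f Q X) ∧
        D.inc R (f R Y) ∧ D.inc Y (f R Y) := by
    intro X Y h
    simp only [hs, Finset.mem_sigma, Finset.mem_erase, mem_pts] at h
    obtain ⟨⟨h1, h2⟩, h3, h4, h5⟩ := h
    obtain ⟨h6, h7⟩ := hf Q X (hXQ X h2)
    have h8 : ¬ D.inc R (f Q X) := fun h => hbQ (hD.block_eq h1 h7 h h2 hbR ▸ h6)
    have h9 : Y ≠ R := by
      rintro rfl
      exact h8 h5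
    obtain ⟨h10, h11⟩ := hf R Y h9
    refine ⟨h1, h2, h3, h4, h9, h5, h8, ?_, ?_, h6, h7, h10, h11⟩
    · intro h
      exact hbQ (hD.block_eq h3 h5 h7 h h2 ▸ h6)
    · intro h
      exact h8 (hD.block_eq h4 h11 h h5 h6 ▸ h10)
  rw [← hscard, Set.ncard_eq_toFinset_card']
  refine Finset.card_le_card_of_injOn (fun p => f R p.2) ?_ ?_
  · rintro ⟨X, Y⟩ h
    obtain ⟨h1, h2, h3, h4, h5, h6, h7, h8, h9, h10, h11, h12, h13⟩ := mem_s X Y h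
    simp only [Set.coe_toFinset]
    refine ⟨⟨h12, h9⟩, ?_, f Q X, ⟨h10, h7⟩, ⟨X, h2, h11⟩, ⟨Y, h13, h6⟩⟩
    intro hc
    exact h8 (hc ▸ h13)
  · rintro ⟨X, Y⟩ h ⟨X', Y'⟩ h' heq
    obtain ⟨h1, h2, h3, h4, h5, h6, h7, h8, h9, h10, h11, h12, h13⟩ := mem_s X Y h
    obtain ⟨k1, k2, k3, k4, k5, k6, k7, k8, k9, k10, k11, k12, k13⟩ := mem_s X' Y' h'
    simp only at heq
    rw [← heq] at k9 k12 k13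
    by_cases hX : X = X'
    · subst hX
      by_cases hY : Y = Y'
      · rw [hY]
      · exact absurd (hD.block_eq hY h13 k13 h6 k6 ▸ h12) h7
    · exfalso
      have hd : f Q X ≠ f Q X' := by
        intro h
        rw [← h] at k11
        exact hbQ (hD.block_eq hX h11 k11 h2 k2 ▸ h10)
      have hY : Y ≠ Y' := by
        rintro rfl
        exact hd (hD.block_eq h4 h6 h10 k6 k10)
      have hXQ' := hXQ X h2
      have hXQ'' := hXQ X' k2
      have hb1 : b ≠ f R Y := by
        intro h
        exact h8 (h ▸ h13)
      have hXY' : X ≠ Y' := fun h => k8 (h ▸ h2)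
      have hYX' : Y ≠ X' := fun h => h8 (h ▸ k2)
      have a1 : b ≠ f Q X := fun h => hbQ (h ▸ h10)
      have a2 : b ≠ f Q X' := fun h => hbQ (h ▸ k10)
      have a3 : f R Y ≠ f Q X := fun h => h9 (h ▸ h10)
      have a4 : f R Y ≠ f Q X' := fun h => h9 (h ▸ k10)
      refine D.not_antiPasch_of_nodup (p₁ := R) (p₂ := Q) (p₃ := X) (p₄ := X') (p₅ := Y) (p₆ := Y')
        (b₁ := b) (b₂ := f R Y) (b₃ := f Q X) (b₄ := f Q X') ?_ ?_ ⟨hbR, h2, k2⟩ ⟨h12, h13, k13⟩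
        ⟨h10, h11, h6⟩ ⟨k10, k11, k6⟩ hA
      · simp only [List.nodup_cons, List.mem_cons, List.not_mem_nil, or_false, not_or,
          not_false_eq_true, List.nodup_nil, and_true]
        exact ⟨⟨hne, h1.symm, k1.symm, h5.symm, k5.symm⟩,
          ⟨hXQ'.symm, hXQ''.symm, h4.symm, k4.symm⟩, ⟨hX, h3.symm, hXY'⟩, ⟨hYX'.symm, k3.symm⟩, hY⟩
      · simp only [List.nodup_cons, List.mem_cons, List.not_mem_nil, or_false, not_or,
          not_false_eq_true, List.nodup_nil, and_true]
        exact ⟨⟨hb1, a1, a2⟩, ⟨a3, a4⟩, hd⟩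

/-- A block through exactly one of the two points is, after the switching, still a block through
exactly one of them, because its number of points does not change. -/
theorem IsSwitching.inc_iff {D D' : IncStr P B} {n k : ℕ} {R Q : P} (hD : D.IsSteiner n k)
    (h : D.IsSwitching D' n k R Q) (b : B) :
    ((D.inc R b ∧ D.inc Q b) ↔ (D'.inc R b ∧ D'.inc Q b)) ∧
      ((D.inc R b ∨ D.inc Q b) ↔ (D'.inc R b ∨ D'.inc Q b)) := by
  have := hD.finite_points
  have key : ∀ E E' : IncStr P B, E.IsSteiner n k → E'.IsSteiner n k →
      (∀ p, p ≠ R → p ≠ Q → (E'.inc p b ↔ E.inc p b)) →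
      (E.inc R b → E'.inc R b) → (E.inc Q b → E'.inc Q b) →
      (E'.inc R b → E.inc R b) ∧ (E'.inc Q b → E.inc Q b) := by
    intro E E' hE hE' hr h1 h2
    have hsub : {p | E.inc p b} ⊆ {p | E'.inc p b} := by
      intro p hp
      by_cases hpR : p = R
      · subst hpR; exact h1 hp
      by_cases hpQ : p = Q
      · subst hpQ; exact h2 hp
      exact (hr p hpR hpQ).2 hp
    have heq := Set.eq_of_subset_of_ncard_le hsub (by rw [hE.card_block, hE'.card_block])
    exact ⟨fun h => by have : R ∈ {p | E'.inc p b} := h; rwa [← heq] at this,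
      fun h => by have : Q ∈ {p | E'.inc p b} := h; rwa [← heq] at this⟩
  have k1 := key D D' hD h.isSteiner fun p h1 h2 => h.other_rows p h1 h2 b
  have k2 := key D' D h.isSteiner hD fun p h1 h2 => (h.other_rows p h1 h2 b).symm
  by_cases a1 : D.inc R b <;> by_cases a2 : D.inc Q b <;> by_cases a3 : D'.inc R b <;>
    by_cases a4 : D'.inc Q b <;> simp_all

/-- A block through `R` and a block through `Q` that meet off `R` and `Q` are either both switched or
both left alone. -/
theorem IsSwitching.inc_iff_of_meet {D D' : IncStr P B} {n k : ℕ} {R Q : P} (hD : D.IsSteiner n k)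
    (h : D.IsSwitching D' n k R Q) {b d : B} (hb : b ∈ D.blocksThrough R Q)
    (hd : d ∈ D.blocksThrough Q R) {X : P} (hXb : D.inc X b) (hXd : D.inc X d) :
    D'.inc R b ↔ D'.inc Q d := by
  have hbd : b ≠ d := by
    rintro rfl
    exact hb.2 hd.1
  have hXR : X ≠ R := by
    rintro rfl
    exact hd.2 hXd
  have hXQ : X ≠ Q := by
    rintro rfl
    exact hb.2 hXb
  have h1 := h.inc_iff hD b
  have h2 := h.inc_iff hD d
  have hXb' := (h.other_rows X hXR hXQ b).2 hXb
  have hXd' := (h.other_rows X hXR hXQ d).2 hXd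
  have hR : ¬ (D'.inc R b ∧ D'.inc R d) := fun hh =>
    hbd (h.isSteiner.block_eq hXR hXb' hh.1 hXd' hh.2)
  have hQ : ¬ (D'.inc Q b ∧ D'.inc Q d) := fun hh =>
    hbd (h.isSteiner.block_eq hXQ hXb' hh.1 hXd' hh.2)
  obtain ⟨hb1, hb2⟩ := hb
  obtain ⟨hd1, hd2⟩ := hd
  simp only [hb1, hb2, hd1, hd2] at h1 h2
  tauto

/-- A block through `R` that is switched and one that is not would have disjoint sets of second
neighbours, of the same kind as themselves; but these sets are too large for this. -/
theorem IsSteiner.not_isSwitching {D : IncStr P B} {q : ℕ} (hq : 2 ≤ q)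
    (hD : D.IsSteiner (q ^ 3 + 1) (q + 1)) (hA : D.AntiPasch) (D' : IncStr P B) (R Q : P) :
    ¬ D.IsSwitching D' (q ^ 3 + 1) (q + 1) R Q := by
  intro h
  have := hD.finite_blocks
  have hconst : ∀ b ∈ D.blocksThrough R Q, ∀ c ∈ D.secondNeighbours R Q b,
      D'.inc R b ↔ D'.inc R c := by
    rintro b hb c ⟨hc, -, d, hd, ⟨X, hXb, hXd⟩, Y, hYc, hYd⟩
    rw [h.inc_iff_of_meet hD hb hd hXb hXd, h.inc_iff_of_meet hD hc hd hYc hYd]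
  have hno : ¬ ∃ b ∈ D.blocksThrough R Q, ∃ b' ∈ D.blocksThrough R Q,
      D'.inc R b ∧ ¬ D'.inc R b' := by
    rintro ⟨b, hb, b', hb', h1, h2⟩
    have hdisj : Disjoint (insert b (D.secondNeighbours R Q b))
        (insert b' (D.secondNeighbours R Q b')) := by
      rw [Set.disjoint_left]
      intro c hc hc'
      have e1 : D'.inc R c := by
        rcases hc with rfl | hc
        · exact h1
        · exact (hconst b hb c hc).1 h1
      have e2 : ¬ D'.inc R c := by
        rcases hc' with rfl | hc'
        · exact h2
        · rwa [← hconst b' hb' c hc']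
      exact e2 e1
    have hsub : insert b (D.secondNeighbours R Q b) ∪ insert b' (D.secondNeighbours R Q b') ⊆
        D.blocksThrough R Q := by
      rintro c ((rfl | hc) | (rfl | hc))
      exacts [hb, hc.1, hb', hc.1]
    have hle := Set.ncard_le_ncard hsub
    rw [Set.ncard_union_eq hdisj, Set.ncard_insert_of_notMem (fun h => h.2.1 rfl),
      Set.ncard_insert_of_notMem (fun h => h.2.1 rfl)] at hle
    have c1 := hD.card_secondNeighbours hA hb
    have c2 := hD.card_secondNeighbours hA hb'
    have c3 := hD.card_blocksThrough hq h.ne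
    obtain ⟨m, rfl⟩ : ∃ m, q = m + 1 := ⟨q - 1, by omega⟩
    simp only [Nat.add_sub_cancel] at c1 c2
    nlinarith
  have hex : ∀ d ∈ D.blocksThrough Q R, ∃ b ∈ D.blocksThrough R Q, D'.inc R b ↔ D'.inc Q d := by
    intro d hd
    obtain ⟨p, p', hpp, hp, hp'⟩ := hD.exists_ne_of_block (by omega) d
    obtain ⟨X, hXQ, hX⟩ : ∃ X, X ≠ Q ∧ D.inc X d := by
      by_cases hpQ : p = Q
      · exact ⟨p', fun h => hpp (hpQ.trans h.symm), hp'⟩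
      · exact ⟨p, hpQ, hp⟩
    have hXR : X ≠ R := by
      rintro rfl
      exact hd.2 hX
    obtain ⟨b, hbX, hbR⟩ := (hD.existsUnique_block X R hXR).exists
    have hb : b ∈ D.blocksThrough R Q :=
      ⟨hbR, fun hbQ => hd.2 (hD.block_eq hXQ hbX hbQ hX hd.1 ▸ hbR)⟩
    exact ⟨b, hb, h.inc_iff_of_meet hD hb hd hbX hX⟩
  by_cases hall : ∀ b ∈ D.blocksThrough R Q, D'.inc R b
  · refine h.not_unchanged fun b => ?_
    have hi := h.inc_iff hD b
    by_cases hR : D.inc R b <;> by_cases hQ : D.inc Q b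
    · simp_all
    · have := hall b ⟨hR, hQ⟩
      simp_all
    · obtain ⟨c, hc, hcd⟩ := hex b ⟨hQ, hR⟩
      have := hcd.1 (hall c hc)
      simp_all
    · simp_all
  · push Not at hall
    obtain ⟨b', hb', hb''⟩ := hall
    have hall : ∀ b ∈ D.blocksThrough R Q, ¬ D'.inc R b := fun b hb hbR =>
      hno ⟨b, hb, b', hb', hbR, hb''⟩
    refine h.not_interchanged fun b => ?_
    have hi := h.inc_iff hD b
    by_cases hR : D.inc R b <;> by_cases hQ : D.inc Q b
    · simp_all
    · have := hall b ⟨hR, hQ⟩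
      simp_all
    · obtain ⟨c, hc, hcd⟩ := hex b ⟨hQ, hR⟩
      have := fun h => hall c hc (hcd.2 h)
      simp_all
    · simp_all

end Switching

end IncStr

/-! ### The field with `q ^ 2` elements and its involution -/

section Conjugation

open Polynomial

theorem one_lt_of_card_eq_sq (F : Type*) [Field F] [Finite F] (q : ℕ)
    [hF : Fact (Nat.card F = q ^ 2)] : 1 < q := by
  have h : 1 < Nat.card F := Finite.one_lt_card
  rw [hF.out] at h
  by_contra hq
  have : q ^ 2 ≤ 1 ^ 2 := Nat.pow_le_pow_left (by omega) 2
  omega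

theorem ncard_eval_eq_zero_le {F : Type*} [Field F] (p : F[X]) (hp : p ≠ 0) :
    {x | p.eval x = 0}.ncard ≤ p.natDegree := by
  classical
  have : {x | p.eval x = 0} = (p.roots.toFinset : Set F) := by
    ext x
    simp [hp]
  rw [this, Set.ncard_coe_finset]
  exact (Multiset.toFinset_card_le _).trans (p.card_roots')

variable (F : Type*) [Field F] [Finite F] (q : ℕ) [hF : Fact (Nat.card F = q ^ 2)]

theorem add_pow_of_card_eq_sq (x y : F) : (x + y) ^ q = x ^ q + y ^ q := by
  have := Fintype.ofFinite F
  obtain ⟨p, hp⟩ := CharP.exists F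
  obtain ⟨n, hpp, hn⟩ := FiniteField.card F p
  have := Fact.mk hpp
  rw [← Nat.card_eq_fintype_card, hF.out] at hn
  have hdvd : q ∣ p ^ (n : ℕ) := hn ▸ dvd_pow_self q two_ne_zero
  obtain ⟨k, -, rfl⟩ := (Nat.dvd_prime_pow hpp).1 hdvd
  exact add_pow_char_pow x y p k

/-- The involution `x ↦ x ^ q` of the field with `q ^ 2` elements. -/
def conj : F →+* F where
  toFun x := x ^ q
  map_one' := one_pow q
  map_mul' x y := mul_pow x y q
  map_zero' := zero_pow (by have := one_lt_of_card_eq_sq F q; omega)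
  map_add' := add_pow_of_card_eq_sq F q

variable {F q}

local notation "σ" => conj F q

theorem conj_apply (x : F) : σ x = x ^ q := rfl

@[simp]
theorem conj_conj (x : F) : σ (σ x) = x := by
  have := Fintype.ofFinite F
  rw [conj_apply, conj_apply, ← pow_mul, ← sq, ← hF.out, Nat.card_eq_fintype_card,
    FiniteField.pow_card]

theorem norm_conj_conj (x : F) : σ x * σ (σ x) = x * σ x := by rw [conj_conj, mul_comm]

theorem hermNorm_two (v : Fin 2 → F) : hermNorm F q v = v 0 * σ (v 0) + v 1 * σ (v 1) := by
  simp [hermNorm, Fin.sum_univ_two, conj_apply, pow_succ']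

theorem hermNorm_three (v : Fin 3 → F) :
    hermNorm F q v = v 0 * σ (v 0) + v 1 * σ (v 1) + v 2 * σ (v 2) := by
  simp [hermNorm, Fin.sum_univ_three, conj_apply, pow_succ']

theorem hermNorm_smul {m : ℕ} (c : F) (v : Fin m → F) :
    hermNorm F q (c • v) = c * σ c * hermNorm F q v := by
  simp [hermNorm, conj_apply, mul_pow, Finset.mul_sum, pow_succ']
  exact Finset.sum_congr rfl fun i _ => by ring

theorem conj_hermNorm {m : ℕ} (v : Fin m → F) : σ (hermNorm F q v) = hermNorm F q v := by
  rw [hermNorm, map_sum]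
  refine Finset.sum_congr rfl fun i _ => ?_
  rw [pow_succ, ← conj_apply, map_mul, conj_conj, mul_comm]

theorem ncard_trace_and_fixed : {t : F | t + σ t = 0}.ncard = q ∧ {t : F | σ t = t}.ncard = q ∧
    ∀ a, σ a = a → ∃ t, t + σ t = a := by
  have hq := one_lt_of_card_eq_sq F q
  set tr : F →+ F := AddMonoidHom.id F + (σ).toAddMonoidHom with htr
  have tr_apply : ∀ t, tr t = t + σ t := fun t => rfl
  have hker : (tr.ker : Set F) = {t : F | t + σ t = 0} := by
    ext t
    simp [AddMonoidHom.mem_ker, tr_apply]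
  have hsub : (tr.range : Set F) ⊆ {t : F | σ t = t} := by
    rintro _ ⟨t, rfl⟩
    simp [tr_apply, add_comm]
  have h1 : {t : F | t + σ t = 0}.ncard ≤ q := by
    have hd : (X ^ q + X : F[X]).natDegree = q := by
      rw [natDegree_add_eq_left_of_natDegree_lt] <;> simp [hq]
    have := ncard_eval_eq_zero_le (X ^ q + X : F[X]) (by
      intro h
      rw [h] at hd
      simp at hd
      omega)
    rw [hd] at this
    convert this using 4
    simp [conj_apply, add_comm]
  have h2 : {t : F | σ t = t}.ncard ≤ q := by
    have hd : (X ^ q - X : F[X]).natDegree = q := by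
      rw [natDegree_sub_eq_left_of_natDegree_lt] <;> simp [hq]
    have := ncard_eval_eq_zero_le (X ^ q - X : F[X]) (by
      intro h
      rw [h] at hd
      simp at hd
      omega)
    rw [hd] at this
    convert this using 4
    simp [conj_apply, sub_eq_zero]
  have h3 : {t : F | t + σ t = 0}.ncard * (tr.range : Set F).ncard = q ^ 2 := by
    rw [← hker, ← hF.out, ← tr.ker.card_mul_index, AddSubgroup.index_ker]
    rfl
  have h4 := Set.ncard_le_ncard hsub
  have h5 : {t : F | t + σ t = 0}.ncard = q := by nlinarith
  have h6 : (tr.range : Set F).ncard = q := by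
    rw [h5, sq] at h3
    exact Nat.eq_of_mul_eq_mul_left (by omega) h3
  refine ⟨h5, by omega, fun a ha => ?_⟩
  have h7 := Set.eq_of_subset_of_ncard_le hsub (by omega)
  have : a ∈ (tr.range : Set F) := by
    rw [h7]
    exact ha
  exact this

theorem ncard_fixed : {t : F | σ t = t}.ncard = q := ncard_trace_and_fixed.2.1

/-- The equation `Tr (t κ) = a` has `q` solutions. -/
theorem ncard_trace_mul_eq {κ a : F} (hκ : κ ≠ 0) (ha : σ a = a) :
    {t : F | t * κ + σ (t * κ) = a}.ncard = q := by
  obtain ⟨t₀, ht₀⟩ := (ncard_trace_and_fixed (F := F) (q := q)).2.2 a ha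
  have h := (ncard_trace_and_fixed (F := F) (q := q)).1
  rw [← Set.ncard_image_of_injective {t : F | t + σ t = 0} (f := fun t => (t + t₀) / κ)] at h
  · refine Eq.trans ?_ h
    congr 1
    ext t
    simp only [Set.mem_ofPred_eq, Set.mem_image]
    constructor
    · intro ht
      refine ⟨t * κ - t₀, ?_, by field_simp; ring⟩
      rw [map_sub]
      linear_combination ht - ht₀
    · rintro ⟨s, hs, rfl⟩
      rw [div_mul_cancel₀ _ hκ, map_add]
      linear_combination hs + ht₀
  · intro x y hxy
    simpa [hκ] using hxy

theorem exists_trace_mul_eq {κ a : F} (hκ : κ ≠ 0) (ha : σ a = a) :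
    ∃ t : F, t * κ + σ (t * κ) = a := by
  have h := ncard_trace_mul_eq hκ ha
  have := one_lt_of_card_eq_sq F q
  exact Set.nonempty_of_ncard_ne_zero (s := {t : F | t * κ + σ (t * κ) = a}) (by omega)

/-- The norm equation `t ^ (q + 1) = a` has `q + 1` solutions. -/
theorem ncard_norm_eq {a : F} (ha : σ a = a) (ha0 : a ≠ 0) :
    {t : F | t * σ t = a}.ncard = q + 1 := by
  have := Fintype.ofFinite F
  have hq := one_lt_of_card_eq_sq F q
  set f : Fˣ →* Fˣ := powMonoidHom (q + 1) with hf
  have hker : f.ker = rootsOfUnity (q + 1) F := by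
    ext u
    simp [hf, MonoidHom.mem_ker]
  have hpow : ∀ u : Fˣ, u ^ (q ^ 2 - 1) = 1 := by
    intro u
    rw [← hF.out, ← Nat.card_units, pow_card_eq_one']
  have hrange : f.range ≤ rootsOfUnity (q - 1) F := by
    rintro _ ⟨u, rfl⟩
    rw [mem_rootsOfUnity]
    simp only [hf, powMonoidHom_apply]
    rw [← pow_mul, ← hpow u]
    congr 1
    have := Nat.sq_sub_sq q 1
    simpa using this.symm
  have h1 : Nat.card f.ker ≤ q + 1 := by
    rw [hker]
    exact card_rootsOfUnity F (q + 1)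
  have : NeZero (q - 1) := ⟨by omega⟩
  have h2 : Nat.card (rootsOfUnity (q - 1) F) ≤ q - 1 := card_rootsOfUnity F (q - 1)
  have h3 : Nat.card f.ker * Nat.card f.range = (q + 1) * (q - 1) := by
    have := f.ker.card_mul_index
    rw [Subgroup.index_ker] at this
    rw [this, Nat.card_units, hF.out]
    simpa using Nat.sq_sub_sq q 1
  have h4 : Nat.card f.range ≤ Nat.card (rootsOfUnity (q - 1) F) :=
    Subgroup.card_le_of_le hrange
  have h5 : Nat.card f.ker = q + 1 := by
    refine le_antisymm h1 ?_
    have : 0 < q - 1 := by omega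
    nlinarith
  have h6 : Nat.card f.range = q - 1 := by
    rw [h5] at h3
    exact Nat.eq_of_mul_eq_mul_left (by omega) h3
  have h7 : f.range = rootsOfUnity (q - 1) F :=
    Subgroup.eq_of_le_of_card_ge hrange (by omega)
  obtain ⟨t₀, ht₀⟩ : Units.mk0 a ha0 ∈ f.range := by
    rw [h7, mem_rootsOfUnity, Units.ext_iff]
    simp only [Units.val_pow_eq_pow_val, Units.val_mk0, Units.val_one]
    apply mul_left_cancel₀ ha0
    rw [← pow_succ', Nat.sub_add_cancel hq.le, mul_one, ← conj_apply, ha]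
  have ht₀' : (t₀ : F) * σ t₀ = a := by
    have := congrArg Units.val ht₀
    simpa [hf, pow_succ', conj_apply] using this
  rw [← h5, ← Nat.card_coe_set_eq]
  refine Nat.card_congr (Equiv.ofBijective
    (fun u : f.ker => (⟨(t₀ : F) * (u : Fˣ), ?_⟩ : {t : F | t * σ t = a})) ⟨?_, ?_⟩).symm
  · have h8 : ((u : Fˣ) : F) * σ (u : Fˣ) = 1 := by
      have := congrArg Units.val (MonoidHom.mem_ker.1 u.2)
      simpa [hf, pow_succ', conj_apply] using this
    change (t₀ * (u : Fˣ) : F) * σ (t₀ * (u : Fˣ)) = a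
    rw [map_mul]
    linear_combination (t₀ : F) * σ t₀ * h8 + ht₀'
  · intro u v huv
    have : (t₀ * (u : Fˣ) : F) = t₀ * (v : Fˣ) := congrArg Subtype.val huv
    exact Subtype.ext (Units.ext (mul_left_cancel₀ t₀.ne_zero this))
  · rintro ⟨t, ht⟩
    have ht0 : t ≠ 0 := by
      rintro rfl
      simp at ht
      exact ha0 ht.symm
    refine ⟨⟨t₀⁻¹ * Units.mk0 t ht0, ?_⟩, ?_⟩
    · rw [MonoidHom.mem_ker, map_mul, map_inv, inv_mul_eq_one, ht₀]
      ext
      simpa [hf, pow_succ', conj_apply] using ht.symm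
    · ext
      simp

theorem exists_mul_conj_eq {a : F} (ha : σ a = a) : ∃ t : F, t * σ t = a := by
  by_cases ha0 : a = 0
  · exact ⟨0, by simp [ha0]⟩
  · have h := ncard_norm_eq ha ha0
    exact Set.nonempty_of_ncard_ne_zero (s := {t : F | t * σ t = a}) (by omega)

theorem exists_conj_ne : ∃ t : F, σ t ≠ t := by
  by_contra! h
  have h1 := ncard_fixed (F := F) (q := q)
  have h2 : {t : F | σ t = t} = Set.univ := by
    ext t
    simp [h t]
  have hq := one_lt_of_card_eq_sq F q
  rw [h2, Set.ncard_univ, hF.out] at h1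
  nlinarith

end Conjugation

section Model

variable {F : Type*} [Field F] [Finite F] {q : ℕ} [hF : Fact (Nat.card F = q ^ 2)]

local notation "σ" => conj F q

/-! ### Lines and the unit sphere of the Hermitian form -/

variable (F q) in
/-- The vectors of Hermitian norm `1`. -/
abbrev UnitSphere := {r : Fin 2 → F // hermNorm F q r = 1}

variable (F q) in
/-- The elements of norm `-1`. They are the slopes of the isotropic directions. -/
abbrev NegOneNorm := {m : F // m * conj F q m = -1}

theorem NegOneNorm.ne_zero (m : NegOneNorm F q) : m.1 ≠ 0 := by
  intro h
  have := m.2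
  rw [h] at this
  simp at this

theorem UnitSphere.eq_one (r : UnitSphere F q) :
    r.1 0 * σ (r.1 0) + r.1 1 * σ (r.1 1) = 1 := by
  rw [← hermNorm_two, r.2]

omit [Finite F] hF in
theorem UnitSphere.ext_iff' {r r' : UnitSphere F q} :
    r = r' ↔ r.1 0 = r'.1 0 ∧ r.1 1 = r'.1 1 := by
  rw [Subtype.ext_iff, funext_iff, Fin.forall_fin_two]

theorem card_negOneNorm : Nat.card (NegOneNorm F q) = q + 1 :=
  ncard_norm_eq (by simp) (by simp)

theorem card_unitSphere : Nat.card (UnitSphere F q) + q = q ^ 3 := by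
  classical
  have := Fintype.ofFinite F
  have hq := one_lt_of_card_eq_sq F q
  let e : UnitSphere F q ≃ Σ x : F, {y : F // y * σ y = 1 - x * σ x} :=
    { toFun := fun r => ⟨r.1 0, r.1 1, by linear_combination r.eq_one⟩
      invFun := fun p => ⟨![p.1, p.2.1], by
        have := p.2.2
        simp only [hermNorm_two, Matrix.cons_val_zero, Matrix.cons_val_one]
        linear_combination this⟩
      left_inv := fun r => by
        rw [UnitSphere.ext_iff']
        simp
      right_inv := fun p => by simp }
  have hfib : ∀ x : F, Nat.card {y : F // y * σ y = 1 - x * σ x} =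
      if x * σ x = 1 then 1 else q + 1 := by
    intro x
    split_ifs with hx
    · rw [Nat.card_eq_one_iff_unique]
      constructor
      · constructor
        rintro ⟨y, hy⟩ ⟨z, hz⟩
        simp only [hx, sub_self, mul_eq_zero, map_eq_zero, or_self] at hy hz
        simp [hy, hz]
      · exact ⟨0, by simp [hx]⟩
    · exact ncard_norm_eq (by simp [mul_comm]) (by rwa [sub_ne_zero, ne_comm])
  have h1 : (Finset.univ.filter fun x : F => x * σ x = 1).card = q + 1 := by
    have := ncard_norm_eq (F := F) (q := q) (a := 1) (by simp) (by simp)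
    rw [Set.ncard_eq_toFinset_card'] at this
    simpa only [Set.toFinset_ofPred] using this
  have h2 := Finset.card_filter_add_card_filter_not (s := (Finset.univ : Finset F))
    (fun x : F => x * σ x = 1)
  rw [Finset.card_univ, ← Nat.card_eq_fintype_card, hF.out, h1] at h2
  rw [Nat.card_congr e, Nat.card_sigma, Finset.sum_congr rfl fun x _ => hfib x, Finset.sum_ite,
    Finset.sum_const, Finset.sum_const, h1]
  set k := (Finset.univ.filter fun x : F => ¬ x * σ x = 1).card
  simp only [smul_eq_mul]
  nlinarith

/-- Brahmagupta's identity. -/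
theorem hermNorm_mul_hermNorm (r u : Fin 2 → F) :
    (r 0 * u 0 + r 1 * u 1) * σ (r 0 * u 0 + r 1 * u 1) +
      (r 0 * σ (u 1) - r 1 * σ (u 0)) * σ (r 0 * σ (u 1) - r 1 * σ (u 0)) =
    hermNorm F q r * hermNorm F q u := by
  simp only [hermNorm_two, map_add, map_sub, map_mul, conj_conj]
  ring

/-- The lines `r • u = 1` with `u` of norm `1` are tangents: they contain a single vector of norm
`1`. -/
theorem eq_conj_of_hermNorm_eq_one {u : Fin 2 → F} (hu : hermNorm F q u = 1) (r : UnitSphere F q)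
    (h : r.1 0 * u 0 + r.1 1 * u 1 = 1) : r.1 0 = σ (u 0) ∧ r.1 1 = σ (u 1) := by
  have h1 := hermNorm_mul_hermNorm (F := F) (q := q) r.1 u
  rw [h, hu, r.2] at h1
  simp only [map_one, mul_one, add_eq_left, mul_eq_zero, map_eq_zero, or_self] at h1
  rw [hermNorm_two] at hu
  constructor
  · linear_combination (-r.1 0) * hu + σ (u 0) * h + u 1 * h1
  · linear_combination (-r.1 1) * hu + σ (u 1) * h - u 0 * h1

theorem ncard_line {u v : Fin 2 → F} {ε : F} (hu : u ≠ 0) (hv : v 0 * u 0 + v 1 * u 1 = ε) :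
    {r : UnitSphere F q | r.1 0 * u 0 + r.1 1 * u 1 = ε}.ncard =
      {t : F | hermNorm F q v + t * σ t * hermNorm F q u +
        (t * (u 1 * σ (v 0) - u 0 * σ (v 1)) + σ (t * (u 1 * σ (v 0) - u 0 * σ (v 1)))) = 1}.ncard
    := by
  have hnorm : ∀ t : F, hermNorm F q (![v 0 + t * u 1, v 1 - t * u 0]) =
      hermNorm F q v + t * σ t * hermNorm F q u +
        (t * (u 1 * σ (v 0) - u 0 * σ (v 1)) + σ (t * (u 1 * σ (v 0) - u 0 * σ (v 1)))) := by
    intro t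
    simp only [hermNorm_two, map_add, map_sub, map_mul, conj_conj, Matrix.cons_val_zero,
      Matrix.cons_val_one]
    ring
  simp only [← hnorm]
  symm
  refine Set.ncard_congr (fun t ht => ⟨![v 0 + t * u 1, v 1 - t * u 0], ht⟩) ?_ ?_ ?_
  · intro t ht
    simp only [Set.mem_ofPred_eq, Matrix.cons_val_zero, Matrix.cons_val_one]
    linear_combination hv
  · intro t s ht hs h
    rw [UnitSphere.ext_iff'] at h
    simp only [Matrix.cons_val_zero, Matrix.cons_val_one, add_right_inj, sub_right_inj,
      mul_eq_mul_right_iff] at h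
    by_contra hts
    apply hu
    ext i
    fin_cases i
    · exact h.2.resolve_left hts
    · exact h.1.resolve_left hts
  · rintro r hr
    have hr : r.1 0 * u 0 + r.1 1 * u 1 = ε := hr
    obtain ⟨t, h0, h1⟩ : ∃ t, v 0 + t * u 1 = r.1 0 ∧ v 1 - t * u 0 = r.1 1 := by
      by_cases h1 : u 1 = 0
      · have h0 : u 0 ≠ 0 := by
          intro h0
          apply hu
          ext i
          fin_cases i
          · exact h0
          · exact h1
        refine ⟨(v 1 - r.1 1) / u 0, ?_, by field_simp; ring⟩
        rw [h1] at hr hv ⊢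
        apply mul_right_cancel₀ h0
        linear_combination hv - hr
      · refine ⟨(r.1 0 - v 0) / u 1, by field_simp; ring, ?_⟩
        field_simp
        linear_combination hv - hr
    have hmem : hermNorm F q (![v 0 + t * u 1, v 1 - t * u 0]) = 1 := by
      rw [h0, h1, hermNorm_two]
      exact r.eq_one
    refine ⟨t, hmem, ?_⟩
    rw [UnitSphere.ext_iff']
    exact ⟨h0, h1⟩

theorem ncard_line_of_hermNorm_ne_zero {u : Fin 2 → F} (hu : hermNorm F q u ≠ 0) {ε : F}
    (hε : σ ε = ε) (hne : ε * ε ≠ hermNorm F q u) :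
    {r : UnitSphere F q | r.1 0 * u 0 + r.1 1 * u 1 = ε}.ncard = q + 1 := by
  have hu0 : u ≠ 0 := by
    rintro rfl
    simp [hermNorm_two] at hu
  set n := hermNorm F q u with hn
  have hσn : σ n = n := conj_hermNorm u
  have hn' : u 0 * σ (u 0) + u 1 * σ (u 1) = n := (hermNorm_two u).symm
  rw [ncard_line (v := ![ε / n * σ (u 0), ε / n * σ (u 1)]) hu0]
  · rw [← ncard_norm_eq (F := F) (q := q) (a := (1 - ε * ε / n) / n)]
    · congr 1
      ext t
      simp only [hermNorm_two, Set.mem_ofPred_eq, Matrix.cons_val_zero, Matrix.cons_val_one,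
        map_mul, map_div₀, conj_conj, hε, hσn, map_sub]
      rw [hn', eq_div_iff hu, eq_sub_iff_add_eq]
      refine Eq.congr_left ?_
      field_simp
      linear_combination ε ^ 2 * hn'
    · simp [hε, hσn]
    · rw [Ne, div_eq_zero_iff, not_or, sub_eq_zero, eq_div_iff hu, one_mul]
      exact ⟨hne.symm, hu⟩
  · simp only [Matrix.cons_val_zero, Matrix.cons_val_one]
    field_simp
    linear_combination ε * hn'

theorem ncard_line_of_isotropic {u : Fin 2 → F} (hu0 : u ≠ 0) (hu : hermNorm F q u = 0) :
    {r : UnitSphere F q | r.1 0 * u 0 + r.1 1 * u 1 = 1}.ncard = q := by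
  obtain ⟨v, hv⟩ : ∃ v : Fin 2 → F, v 0 * u 0 + v 1 * u 1 = 1 := by
    by_cases h0 : u 0 = 0
    · have h1 : u 1 ≠ 0 := by
        intro h1
        apply hu0
        ext i
        fin_cases i
        · exact h0
        · exact h1
      exact ⟨![0, (u 1)⁻¹], by simp [h1]⟩
    · exact ⟨![(u 0)⁻¹, 0], by simp [h0]⟩
  rw [ncard_line hu0 hv, hu]
  have hκ : u 1 * σ (v 0) - u 0 * σ (v 1) ≠ 0 := by
    intro hκ
    have hκ' := congrArg σ hκ
    simp only [map_sub, map_mul, conj_conj, map_zero] at hκ'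
    rw [hermNorm_two] at hu
    have h0 : σ (u 0) = 0 := by
      linear_combination (-σ (u 0)) * hv - u 1 * hκ' + v 0 * hu
    have h1 : σ (u 1) = 0 := by
      linear_combination (-σ (u 1)) * hv + u 0 * hκ' + v 1 * hu
    rw [map_eq_zero] at h0 h1
    simp [h0, h1] at hv
  refine Eq.trans ?_ (ncard_trace_mul_eq (q := q) (a := 1 - hermNorm F q v) hκ ?_)
  · congr 1
    ext t
    simp only [Set.mem_ofPred_eq, mul_zero, add_zero]
    rw [eq_sub_iff_add_eq']
  · simp [conj_hermNorm]

theorem exists_mem_line_of_isotropic {u : Fin 2 → F} (hu0 : u ≠ 0) (hu : hermNorm F q u = 0) :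
    ∃ r : UnitSphere F q, r.1 0 * u 0 + r.1 1 * u 1 = 1 := by
  have h := ncard_line_of_isotropic hu0 hu
  have := one_lt_of_card_eq_sq F q
  exact Set.nonempty_of_ncard_ne_zero
    (s := {r : UnitSphere F q | r.1 0 * u 0 + r.1 1 * u 1 = 1}) (by omega)

/-! ### The model: two ways to attach points at infinity to the lines -/

variable (F q) in
/-- The sets of vectors of norm `1` on the lines through the origin with non-isotropic direction. -/
abbrev CentralLine := {X : Set (UnitSphere F q) // ∃ u : Fin 2 → F, hermNorm F q u ≠ 0 ∧
  X = {r : UnitSphere F q | r.1 0 * u 0 + r.1 1 * u 1 = 0}}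

variable (F q) in
/-- The vectors `u` for which the line `{r | r • u = 1}` is not a tangent of the unit sphere. -/
abbrev OuterLine := {u : Fin 2 → F // u ≠ 0 ∧ hermNorm F q u ≠ 1}

/-- The incidence structure on the vectors of norm `1` and the elements `m` of norm `-1` whose
blocks are the secant lines, and the set `none` of all `m`. The point `m` is attached to the
line `{r | r • u = 1}` if `u 1 = m * τ (u 0)`. The relevant maps `τ` are the identity and the
involution. -/
def unitalModel (τ : F →+* F) :
    IncStr (UnitSphere F q ⊕ NegOneNorm F q) (Option (CentralLine F q ⊕ OuterLine F q)) where
  inc p b := match p, b with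
    | Sum.inl r, some (Sum.inl X) => r ∈ X.1
    | Sum.inl r, some (Sum.inr u) => r.1 0 * u.1 0 + r.1 1 * u.1 1 = 1
    | Sum.inl _, none => False
    | Sum.inr _, some (Sum.inl _) => False
    | Sum.inr m, some (Sum.inr u) => u.1 1 = m.1 * τ (u.1 0)
    | Sum.inr _, none => True

section Incidence

variable (τ : F →+* F) (r r' : UnitSphere F q) (m : NegOneNorm F q) (X : CentralLine F q)
  (u : OuterLine F q)

@[simp]
theorem unitalModel_inl_inl :
    (unitalModel τ).inc (Sum.inl r) (some (Sum.inl X)) ↔ r ∈ X.1 := Iff.rfl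

@[simp]
theorem unitalModel_inl_inr : (unitalModel τ).inc (Sum.inl r) (some (Sum.inr u)) ↔
    r.1 0 * u.1 0 + r.1 1 * u.1 1 = 1 := Iff.rfl

@[simp]
theorem unitalModel_inl_none : ¬ (unitalModel τ).inc (Sum.inl r) none := id

@[simp]
theorem unitalModel_inr_inl : ¬ (unitalModel τ).inc (Sum.inr m) (some (Sum.inl X)) := id

@[simp]
theorem unitalModel_inr_inr :
    (unitalModel τ).inc (Sum.inr m) (some (Sum.inr u)) ↔ u.1 1 = m.1 * τ (u.1 0) := Iff.rfl

@[simp]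
theorem unitalModel_inr_none : (unitalModel τ).inc (Sum.inr m) none := trivial

end Incidence

theorem hermNorm_eq_zero_of_eq_mul {τ : F →+* F} (hτ : ∀ x, τ x * σ (τ x) = x * σ x)
    {u : Fin 2 → F} (m : NegOneNorm F q) (h : u 1 = m.1 * τ (u 0)) : hermNorm F q u = 0 := by
  rw [hermNorm_two, h, map_mul]
  linear_combination τ (u 0) * σ (τ (u 0)) * m.2 - hτ (u 0)

/-- The slope at infinity of an isotropic vector. -/
theorem existsUnique_slope {τ : F →+* F} (hτ : ∀ x, τ x * σ (τ x) = x * σ x)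
    {u : Fin 2 → F} (hu0 : u ≠ 0) (hu : hermNorm F q u = 0) :
    ∃! m : NegOneNorm F q, u 1 = m.1 * τ (u 0) := by
  rw [hermNorm_two] at hu
  have h0 : u 0 ≠ 0 := by
    intro h0
    have h1 : u 1 = 0 := by simpa [h0] using hu
    apply hu0
    ext i
    fin_cases i
    · exact h0
    · exact h1
  have h0' : τ (u 0) ≠ 0 := by simpa using h0
  refine ⟨⟨u 1 / τ (u 0), ?_⟩, ?_, ?_⟩
  · rw [map_div₀, div_mul_div_comm, hτ, div_eq_iff (by simpa using h0)]
    linear_combination hu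
  · simp [h0']
  · rintro m hm
    apply Subtype.ext
    simp only [hm]
    field_simp

theorem ncard_block_unitalModel {τ : F →+* F} (hτ : ∀ x, τ x * σ (τ x) = x * σ x)
    (b : Option (CentralLine F q ⊕ OuterLine F q)) :
    {p | (unitalModel τ).inc p b}.ncard = q + 1 := by
  rcases b with _ | X | u
  · have : {p | (unitalModel (F := F) (q := q) τ).inc p none} = Sum.inr '' Set.univ := by
      ext p
      rcases p with r | m <;> simp
    rw [this, Set.ncard_image_of_injective _ Sum.inr_injective, Set.ncard_univ, card_negOneNorm]
  · have : {p | (unitalModel (F := F) (q := q) τ).inc p (some (Sum.inl X))} = Sum.inl '' X.1 := by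
      ext p
      rcases p with r | m <;> simp
    rw [this, Set.ncard_image_of_injective _ Sum.inl_injective]
    obtain ⟨u, hu, h⟩ := X.2
    rw [h]
    exact ncard_line_of_hermNorm_ne_zero hu (by simp) (by simpa using hu.symm)
  · have : {p | (unitalModel (F := F) (q := q) τ).inc p (some (Sum.inr u))} =
        Sum.inl '' {r | r.1 0 * u.1 0 + r.1 1 * u.1 1 = 1} ∪
          Sum.inr '' {m | u.1 1 = m.1 * τ (u.1 0)} := by
      ext p
      rcases p with r | m <;> simp
    rw [this, Set.ncard_union_eq (by
      rw [Set.disjoint_left]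
      rintro _ ⟨r, -, rfl⟩ ⟨m, -, h⟩
      exact absurd h (by simp)), Set.ncard_image_of_injective _ Sum.inl_injective,
      Set.ncard_image_of_injective _ Sum.inr_injective]
    by_cases hu : hermNorm F q u.1 = 0
    · rw [ncard_line_of_isotropic u.2.1 hu]
      obtain ⟨m, hm, hm'⟩ := existsUnique_slope hτ u.2.1 hu
      have : {m : NegOneNorm F q | u.1 1 = m.1 * τ (u.1 0)} = {m} := by
        ext m'
        refine ⟨fun h => hm' _ h, ?_⟩
        rintro rfl
        exact hm
      rw [this, Set.ncard_singleton]
    · rw [ncard_line_of_hermNorm_ne_zero hu (by simp) (by simpa using u.2.2.symm)]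
      have : {m : NegOneNorm F q | u.1 1 = m.1 * τ (u.1 0)} = ∅ := by
        ext m
        simp only [Set.mem_ofPred_eq, Set.mem_empty_iff_false, iff_false]
        exact fun h => hu (hermNorm_eq_zero_of_eq_mul hτ m h)
      rw [this, Set.ncard_empty]

/-- The attached line through a vector of norm `1` and a point at infinity: `u 0` is the solution of
an additive equation, which is unique and hence exists because `F` is finite. -/
theorem existsUnique_attached {τ : F →+* F} (hτ : ∀ x, τ x * σ (τ x) = x * σ x)
    (r : UnitSphere F q) (m : NegOneNorm F q) :
    ∃! x : F, r.1 0 * x + r.1 1 * (m.1 * τ x) = 1 := by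
  let f : F →+ F := (AddMonoidHom.mulLeft (r.1 0)) +
    (AddMonoidHom.mulLeft (r.1 1 * m.1)).comp τ.toAddMonoidHom
  have hf : ∀ x, f x = r.1 0 * x + r.1 1 * (m.1 * τ x) := by
    intro x
    simp [f, mul_assoc]
  have hinj : Function.Injective f := by
    rw [injective_iff_map_eq_zero]
    intro x hx
    rw [hf, add_eq_zero_iff_eq_neg] at hx
    have h1 : r.1 0 * x * σ (r.1 0 * x) = r.1 1 * (m.1 * τ x) * σ (r.1 1 * (m.1 * τ x)) := by
      rw [hx]
      simp
    simp only [map_mul] at h1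
    have h2 : x * σ x = 0 := by
      linear_combination h1 + r.1 1 * σ (r.1 1) * m.1 * σ m.1 * hτ x +
        r.1 1 * σ (r.1 1) * x * σ x * m.2 - x * σ x * r.eq_one
    simpa using h2
  have hbij := Finite.injective_iff_bijective.1 hinj
  simpa only [hf] using hbij.existsUnique 1

omit [Finite F] hF in
theorem eq_of_collinear_zero {r r' : UnitSphere F q} {u : Fin 2 → F}
    (h : r.1 0 * u 0 + r.1 1 * u 1 = 1) (h' : r'.1 0 * u 0 + r'.1 1 * u 1 = 1)
    (hdet : r.1 0 * r'.1 1 - r.1 1 * r'.1 0 = 0) : r = r' := by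
  rw [UnitSphere.ext_iff']
  constructor
  · linear_combination (-r.1 0) * h' + r'.1 0 * h + u 1 * hdet
  · linear_combination (-r.1 1) * h' + r'.1 1 * h - u 0 * hdet

theorem det_eq_zero_of_mem {r r' : UnitSphere F q} {w : Fin 2 → F} (hw : hermNorm F q w ≠ 0)
    (h : r.1 0 * w 0 + r.1 1 * w 1 = 0) (h' : r'.1 0 * w 0 + r'.1 1 * w 1 = 0) :
    r.1 0 * r'.1 1 - r.1 1 * r'.1 0 = 0 := by
  by_contra hdet
  apply hw
  have h0 : w 0 = 0 := by
    apply mul_left_cancel₀ hdet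
    linear_combination r'.1 1 * h - r.1 1 * h'
  have h1 : w 1 = 0 := by
    apply mul_left_cancel₀ hdet
    linear_combination r.1 0 * h' - r'.1 0 * h
  simp [hermNorm_two, h0, h1]

theorem centralLine_eq {r : UnitSphere F q} {X : CentralLine F q} (h : r ∈ X.1) :
    X.1 = {r' | r.1 0 * r'.1 1 - r.1 1 * r'.1 0 = 0} := by
  obtain ⟨w, hw, hX⟩ := X.2
  rw [hX] at h ⊢
  have h : r.1 0 * w 0 + r.1 1 * w 1 = 0 := h
  ext r'
  refine ⟨fun h' => det_eq_zero_of_mem hw h h', fun h' => ?_⟩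
  have h' : r.1 0 * r'.1 1 - r.1 1 * r'.1 0 = 0 := h'
  change r'.1 0 * w 0 + r'.1 1 * w 1 = 0
  linear_combination (r'.1 0 * σ (r.1 0) + r'.1 1 * σ (r.1 1)) * h -
    (r'.1 0 * w 0 + r'.1 1 * w 1) * r.eq_one + (σ (r.1 0) * w 1 - σ (r.1 1) * w 0) * h'

theorem existsUnique_block_inl_inl (τ : F →+* F) {r r' : UnitSphere F q} (hne : r ≠ r') :
    ∃! b, (unitalModel τ).inc (Sum.inl r) b ∧ (unitalModel τ).inc (Sum.inl r') b := by
  by_cases hdet : r.1 0 * r'.1 1 - r.1 1 * r'.1 0 = 0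
  · refine ⟨some (Sum.inl ⟨{x | r.1 0 * x.1 1 - r.1 1 * x.1 0 = 0}, ![r.1 1, -r.1 0], ?_, ?_⟩),
      ⟨?_, ?_⟩, ?_⟩
    · have : hermNorm F q ![r.1 1, -r.1 0] = 1 := by
        rw [hermNorm_two]
        simp only [Matrix.cons_val_zero, Matrix.cons_val_one, map_neg]
        linear_combination r.eq_one
      simp [this]
    · ext x
      simp only [Set.mem_ofPred_eq, Matrix.cons_val_zero, Matrix.cons_val_one]
      constructor <;> intro h <;> linear_combination -h
    · simp [mul_comm]
    · simpa using hdet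
    · rintro (_ | X | u) ⟨h, h'⟩
      · simp at h
      · simp only [unitalModel_inl_inl] at h
        simp only [Option.some.injEq, Sum.inl.injEq]
        exact Subtype.ext (centralLine_eq h)
      · exact absurd (eq_of_collinear_zero h h' hdet) hne
  · set δ := r.1 0 * r'.1 1 - r.1 1 * r'.1 0 with hδ
    set u : Fin 2 → F := ![(r'.1 1 - r.1 1) / δ, (r.1 0 - r'.1 0) / δ] with hu
    have h1 : r.1 0 * u 0 + r.1 1 * u 1 = 1 := by
      simp only [hu, Matrix.cons_val_zero, Matrix.cons_val_one]
      field_simp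
      rw [hδ]
      ring
    have h2 : r'.1 0 * u 0 + r'.1 1 * u 1 = 1 := by
      simp only [hu, Matrix.cons_val_zero, Matrix.cons_val_one]
      field_simp
      rw [hδ]
      ring
    refine ⟨some (Sum.inr ⟨u, ?_, ?_⟩), ⟨h1, h2⟩, ?_⟩
    · intro h
      simp [h] at h1
    · intro h
      obtain ⟨a1, a2⟩ := eq_conj_of_hermNorm_eq_one h r h1
      obtain ⟨a3, a4⟩ := eq_conj_of_hermNorm_eq_one h r' h2
      exact hne (UnitSphere.ext_iff'.2 ⟨a1.trans a3.symm, a2.trans a4.symm⟩)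
    · rintro (_ | X | u') ⟨h, h'⟩
      · simp at h
      · obtain ⟨w, hw, hX⟩ := X.2
        simp only [unitalModel_inl_inl, hX, Set.mem_ofPred_eq] at h h'
        exact absurd (det_eq_zero_of_mem hw h h') hdet
      · simp only [unitalModel_inl_inr] at h h'
        simp only [Option.some.injEq, Sum.inr.injEq]
        apply Subtype.ext
        ext i
        apply mul_left_cancel₀ hdet
        fin_cases i
        · simp only [Fin.zero_eta]
          linear_combination r'.1 1 * (h - h1) - r.1 1 * (h' - h2)
        · simp only [Fin.mk_one]
          linear_combination r.1 0 * (h' - h2) - r'.1 0 * (h - h1)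

theorem existsUnique_block_inl_inr {τ : F →+* F} (hτ : ∀ x, τ x * σ (τ x) = x * σ x)
    (r : UnitSphere F q) (m : NegOneNorm F q) :
    ∃! b, (unitalModel τ).inc (Sum.inl r) b ∧ (unitalModel τ).inc (Sum.inr m) b := by
  obtain ⟨x, hx, hx'⟩ := existsUnique_attached hτ r m
  refine ⟨some (Sum.inr ⟨![x, m.1 * τ x], ?_, ?_⟩), ⟨hx, by simp⟩, ?_⟩
  · intro h
    have h0 := congrFun h 0
    simp only [Matrix.cons_val_zero, Pi.zero_apply] at h0
    simp [h0] at hx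
  · rw [hermNorm_eq_zero_of_eq_mul hτ m (by simp)]
    exact zero_ne_one
  · rintro (_ | X | u) ⟨h, h'⟩
    · simp at h
    · simp at h'
    · simp only [unitalModel_inl_inr, unitalModel_inr_inr] at h h'
      rw [h'] at h
      have := hx' _ h
      simp only [Option.some.injEq, Sum.inr.injEq]
      apply Subtype.ext
      ext i
      fin_cases i
      · exact this
      · simp [h', this]

theorem existsUnique_block_inr_inr (τ : F →+* F) {m m' : NegOneNorm F q} (hne : m ≠ m') :
    ∃! b, (unitalModel τ).inc (Sum.inr m) b ∧ (unitalModel τ).inc (Sum.inr m') b := by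
  refine ⟨none, ⟨trivial, trivial⟩, ?_⟩
  rintro (_ | X | u) ⟨h, h'⟩
  · rfl
  · simp at h
  · simp only [unitalModel_inr_inr] at h h'
    exfalso
    rw [h, mul_eq_mul_right_iff, map_eq_zero] at h'
    rcases h' with h' | h'
    · exact hne (Subtype.ext h')
    · apply u.2.1
      ext i
      fin_cases i
      · exact h'
      · simp [h, h']

theorem isSteiner_unitalModel {τ : F →+* F} (hτ : ∀ x, τ x * σ (τ x) = x * σ x) :
    (unitalModel (q := q) τ).IsSteiner (q ^ 3 + 1) (q + 1) := by
  have hq := one_lt_of_card_eq_sq F q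
  have hex : ∀ p p' : UnitSphere F q ⊕ NegOneNorm F q, p ≠ p' →
      ∃! b, (unitalModel τ).inc p b ∧ (unitalModel τ).inc p' b := by
    rintro (r | m) (r' | m') hne
    · exact existsUnique_block_inl_inl τ (by simpa using hne)
    · exact existsUnique_block_inl_inr hτ r m'
    · simpa only [and_comm] using existsUnique_block_inl_inr hτ r' m
    · exact existsUnique_block_inr_inr τ (by simpa using hne)
  refine ⟨inferInstance, inferInstance, ?_, ?_, ncard_block_unitalModel hτ, hex⟩
  · rw [Nat.card_sum, card_negOneNorm, ← card_unitSphere (F := F)]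
    ring
  · intro b b' h
    have h1 : 1 < {p | (unitalModel τ).inc p b}.ncard := by
      rw [ncard_block_unitalModel hτ]
      omega
    rw [Set.one_lt_ncard] at h1
    obtain ⟨p, hp, p', hp', hne⟩ := h1
    exact (hex p p' hne).unique ⟨hp, hp'⟩ ⟨(h p).1 hp, (h p').1 hp'⟩

end Model

section Hermitian

variable {F : Type*} [Field F]

/-! ### Points and lines of the projective plane -/

/-- The line with the equation `w • v = 0`. -/
def lineOf (w : Fin 3 → F) (hw : w ≠ 0) : {L : Submodule F (Fin 3 → F) // Module.finrank F L = 2} :=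
  ⟨LinearMap.ker (w 0 • LinearMap.proj 0 + w 1 • LinearMap.proj 1 + w 2 • LinearMap.proj 2 :
    (Fin 3 → F) →ₗ[F] F), by
    have h : (w 0 • LinearMap.proj 0 + w 1 • LinearMap.proj 1 + w 2 • LinearMap.proj 2 :
        (Fin 3 → F) →ₗ[F] F) ≠ 0 := by
      intro h
      apply hw
      ext i
      have := LinearMap.congr_fun h (Pi.single i 1)
      fin_cases i <;> simpa [Pi.single_apply] using this
    have := Module.Dual.finrank_ker_add_one_of_ne_zero h
    simpa using this⟩

theorem mem_lineOf {w v : Fin 3 → F} {hw : w ≠ 0} :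
    v ∈ (lineOf w hw).1 ↔ w 0 * v 0 + w 1 * v 1 + w 2 * v 2 = 0 := by
  simp [lineOf]

theorem projPlane_inc_mk {v : Fin 3 → F} (hv : v ≠ 0)
    (L : {L : Submodule F (Fin 3 → F) // Module.finrank F L = 2}) :
    (projPlane F).inc (Projectivization.mk F v hv) L ↔ v ∈ L.1 := by
  change (Projectivization.mk F v hv).submodule ≤ L.1 ↔ _
  rw [Projectivization.submodule_mk, Submodule.span_singleton_le_iff_mem]

theorem projPlane_inc_iff (p : ℙ F (Fin 3 → F))
    (L : {L : Submodule F (Fin 3 → F) // Module.finrank F L = 2}) :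
    (projPlane F).inc p L ↔ p.rep ∈ L.1 := by
  rw [← projPlane_inc_mk p.rep_nonzero, Projectivization.mk_rep]

theorem eq_span_of_inc {p p' : ℙ F (Fin 3 → F)} (hne : p ≠ p')
    {L : {L : Submodule F (Fin 3 → F) // Module.finrank F L = 2}}
    (h : (projPlane F).inc p L) (h' : (projPlane F).inc p' L) :
    L.1 = Submodule.span F {p.rep, p'.rep} := by
  rw [projPlane_inc_iff] at h h'
  have hli : LinearIndependent F ![p.rep, p'.rep] := by
    have := Projectivization.independent_iff.1 ((Projectivization.independent_pair_iff_ne _ _).2 hne)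
    have heq : Projectivization.rep ∘ ![p, p'] = ![p.rep, p'.rep] := by
      funext i
      fin_cases i <;> rfl
    rwa [heq] at this
  have hfin := finrank_span_eq_card hli
  have hrange : Set.range ![p.rep, p'.rep] = {p.rep, p'.rep} := by
    simp [Set.pair_comm]
  rw [hrange, Fintype.card_fin] at hfin
  symm
  apply Submodule.eq_of_le_of_finrank_eq
  · rw [Submodule.span_le]
    rintro v (rfl | rfl)
    exacts [h, h']
  · rw [hfin, L.2]

theorem projPlane_block_eq {p p' : ℙ F (Fin 3 → F)} (hne : p ≠ p')
    {L L' : {L : Submodule F (Fin 3 → F) // Module.finrank F L = 2}}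
    (h1 : (projPlane F).inc p L) (h2 : (projPlane F).inc p' L)
    (h3 : (projPlane F).inc p L') (h4 : (projPlane F).inc p' L') : L = L' :=
  Subtype.ext ((eq_span_of_inc hne h1 h2).trans (eq_span_of_inc hne h3 h4).symm)

/-- A third point on the line joining two points is a combination of these, with nonzero
coefficients. -/
theorem exists_rep_eq {p p' p'' : ℙ F (Fin 3 → F)} (h : p ≠ p') (h' : p'' ≠ p) (h'' : p'' ≠ p')
    {L : {L : Submodule F (Fin 3 → F) // Module.finrank F L = 2}}
    (h1 : (projPlane F).inc p L) (h2 : (projPlane F).inc p' L) (h3 : (projPlane F).inc p'' L) :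
    ∃ x y : F, x ≠ 0 ∧ y ≠ 0 ∧ p''.rep = x • p.rep + y • p'.rep := by
  rw [projPlane_inc_iff, eq_span_of_inc h h1 h2, Submodule.mem_span_pair] at h3
  obtain ⟨x, y, hxy⟩ := h3
  refine ⟨x, y, ?_, ?_, hxy.symm⟩
  · rintro rfl
    apply h''
    rw [← p''.mk_rep, ← p'.mk_rep, Projectivization.mk_eq_mk_iff']
    exact ⟨y, by rw [← hxy]; simp⟩
  · rintro rfl
    apply h'
    rw [← p''.mk_rep, ← p.mk_rep, Projectivization.mk_eq_mk_iff']
    exact ⟨x, by rw [← hxy]; simp⟩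

variable [Finite F] {q : ℕ} [hF : Fact (Nat.card F = q ^ 2)]

local notation "σ" => conj F q

/-! ### The Hermitian unital is isomorphic to the model -/

theorem mk_mem_hermPoints {v : Fin 3 → F} (hv : v ≠ 0) :
    Projectivization.mk F v hv ∈ hermPoints F q ↔ hermNorm F q v = 0 := by
  obtain ⟨a, ha⟩ := Projectivization.exists_smul_eq_mk_rep F v hv
  change hermNorm F q _ = 0 ↔ _
  rw [← ha, Units.smul_def, hermNorm_smul]
  simp

/-- The Hermitian unital is the unit sphere, scaled by an element `s` of norm `-1`, together with
the isotropic directions. -/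
theorem isomorphic_hermitianUnital :
    (unitalModel (F := F) (q := q) (RingHom.id F)).Isomorphic (hermitianUnital F q) := by
  have hq := one_lt_of_card_eq_sq F q
  obtain ⟨s, hs⟩ := exists_mul_conj_eq (F := F) (q := q) (a := -1) (by simp)
  have hs0 : s ≠ 0 := by
    rintro rfl
    simp at hs
  have hne1 : ∀ r : UnitSphere F q, ![s * r.1 0, s * r.1 1, 1] ≠ 0 := by
    intro r h
    simpa using congrFun h 2
  have hne2 : ∀ m : NegOneNorm F q, ![m.1, -1, 0] ≠ 0 := by
    intro r h
    simpa using congrFun h 1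
  let f : UnitSphere F q ⊕ NegOneNorm F q → hermPoints F q := Sum.elim
    (fun r => ⟨Projectivization.mk F _ (hne1 r), by
      rw [mk_mem_hermPoints, hermNorm_three]
      simp only [Matrix.cons_val_zero, Matrix.cons_val_one, map_mul, map_one, Matrix.cons_val]
      linear_combination s * σ s * r.eq_one + hs⟩)
    (fun m => ⟨Projectivization.mk F _ (hne2 m), by
      rw [mk_mem_hermPoints, hermNorm_three]
      simp only [Matrix.cons_val_zero, Matrix.cons_val_one, Matrix.cons_val, map_neg, map_one,
        map_zero]
      linear_combination m.2⟩)
  have hinj : Function.Injective f := by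
    rintro (r | m) (r' | m') h
    · have h := congrArg Subtype.val h
      simp only [f, Sum.elim_inl, Projectivization.mk_eq_mk_iff'] at h
      obtain ⟨a, ha⟩ := h
      have h2 := congrFun ha 2
      have h0 := congrFun ha 0
      have h1 := congrFun ha 1
      simp at h2
      subst h2
      simp [hs0] at h0 h1
      rw [Sum.inl.injEq, UnitSphere.ext_iff']
      exact ⟨h0.symm, h1.symm⟩
    · have h := congrArg Subtype.val h
      simp only [f, Sum.elim_inl, Sum.elim_inr, Projectivization.mk_eq_mk_iff'] at h
      obtain ⟨a, ha⟩ := h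
      simpa using congrFun ha 2
    · have h := congrArg Subtype.val h
      simp only [f, Sum.elim_inl, Sum.elim_inr, Projectivization.mk_eq_mk_iff'] at h
      obtain ⟨a, ha⟩ := h
      have h2 := congrFun ha 2
      have h1 := congrFun ha 1
      simp at h2
      subst h2
      simp at h1
    · have h := congrArg Subtype.val h
      simp only [f, Sum.elim_inr, Projectivization.mk_eq_mk_iff'] at h
      obtain ⟨a, ha⟩ := h
      have h0 := congrFun ha 0
      have h1 := congrFun ha 1
      simp at h1
      subst h1
      simp at h0
      rw [Sum.inr.injEq]
      exact Subtype.ext h0.symm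
  have hsurj : Function.Surjective f := by
    rintro ⟨p, hp⟩
    have hp' : hermNorm F q p.rep = 0 := hp
    rw [hermNorm_three] at hp'
    by_cases h2 : p.rep 2 = 0
    · have h1 : p.rep 1 ≠ 0 := by
        intro h1
        apply p.rep_nonzero
        ext i
        fin_cases i
        · simpa [h1, h2] using hp'
        · exact h1
        · exact h2
      refine ⟨Sum.inr ⟨-p.rep 0 / p.rep 1, ?_⟩, ?_⟩
      · rw [map_div₀, div_mul_div_comm, div_eq_iff (by simpa using h1), map_neg]
        simp only [h2, map_zero, mul_zero, add_zero] at hp'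
        linear_combination hp'
      · apply Subtype.ext
        simp only [f, Sum.elim_inr]
        refine Eq.trans ?_ p.mk_rep
        rw [Projectivization.mk_eq_mk_iff']
        refine ⟨-(p.rep 1)⁻¹, ?_⟩
        ext i
        fin_cases i
        · simp
          field_simp
        · simp [h1]
        · simp [h2]
    · refine ⟨Sum.inl ⟨![p.rep 0 / (s * p.rep 2), p.rep 1 / (s * p.rep 2)], ?_⟩, ?_⟩
      · rw [hermNorm_two]
        simp only [Matrix.cons_val_zero, Matrix.cons_val_one, map_div₀, div_mul_div_comm]
        rw [← add_div, div_eq_one_iff_eq (by simp [hs0, h2]), map_mul]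
        linear_combination hp' - p.rep 2 * σ (p.rep 2) * hs
      · apply Subtype.ext
        simp only [f, Sum.elim_inl]
        refine Eq.trans ?_ p.mk_rep
        rw [Projectivization.mk_eq_mk_iff']
        refine ⟨(p.rep 2)⁻¹, ?_⟩
        ext i
        fin_cases i
        · simp
          field_simp
        · simp
          field_simp
        · simp [h2]
  have hbij : Function.Bijective f := ⟨hinj, hsurj⟩
  refine (isSteiner_unitalModel (fun x => rfl)).isomorphic_induced (by omega) (projPlane F)
    (hermPoints F q) (fun p _ p' _ hne b b' => projPlane_block_eq hne) (Equiv.ofBijective f hbij) ?_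
  have hinl : ∀ r w (hw : w ≠ 0), (projPlane F).inc (f (Sum.inl r)).1 (lineOf w hw) ↔
      s * (r.1 0 * w 0 + r.1 1 * w 1) + w 2 = 0 := by
    intro r w hw
    simp only [f, Sum.elim_inl]
    rw [projPlane_inc_mk, mem_lineOf]
    simp only [Matrix.cons_val_zero, Matrix.cons_val_one, Matrix.cons_val]
    refine Eq.congr_left ?_
    ring
  have hinr : ∀ m w (hw : w ≠ 0), (projPlane F).inc (f (Sum.inr m)).1 (lineOf w hw) ↔
      w 1 = m.1 * w 0 := by
    intro m w hw
    simp only [f, Sum.elim_inr]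
    rw [projPlane_inc_mk, mem_lineOf]
    simp only [Matrix.cons_val_zero, Matrix.cons_val_one, Matrix.cons_val]
    constructor
    · intro h
      linear_combination -h
    · intro h
      linear_combination -h
  rintro (_ | X | u)
  · refine ⟨lineOf ![0, 0, 1] (fun h => by simpa using congrFun h 2), ?_⟩
    rintro (r | m)
    · rw [Equiv.ofBijective_apply, hinl]
      simp
    · rw [Equiv.ofBijective_apply, hinr]
      simp
  · obtain ⟨w, hw, hX⟩ := X.2
    refine ⟨lineOf ![w 0, w 1, 0] (fun h => hw ?_), ?_⟩
    · have h0 : w 0 = 0 := congrFun h 0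
      have h1 : w 1 = 0 := congrFun h 1
      simp [hermNorm_two, h0, h1]
    · rintro (r | m)
      · rw [Equiv.ofBijective_apply, hinl, unitalModel_inl_inl, hX]
        simp [hs0]
      · rw [Equiv.ofBijective_apply, hinr]
        simp only [unitalModel_inr_inl, Matrix.cons_val_zero, Matrix.cons_val_one, false_iff]
        exact fun h => hw (hermNorm_eq_zero_of_eq_mul (τ := RingHom.id F) (fun x => rfl) m h)
  · refine ⟨lineOf ![u.1 0, u.1 1, -s] (fun h => hs0 (by simpa using congrFun h 2)), ?_⟩
    rintro (r | m)
    · rw [Equiv.ofBijective_apply, hinl, unitalModel_inl_inr]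
      simp only [Matrix.cons_val_zero, Matrix.cons_val_one, Matrix.cons_val]
      rw [add_neg_eq_zero, mul_eq_left₀ hs0]
    · rw [Equiv.ofBijective_apply, hinr]
      simp

theorem isSteiner_hermitianUnital : (hermitianUnital F q).IsSteiner (q ^ 3 + 1) (q + 1) :=
  (isSteiner_unitalModel (fun _ => rfl)).of_isomorphic isomorphic_hermitianUnital.symm

/-! ### The Hermitian unital contains no Pasch configuration -/

/-- The Hermitian form. -/
def hermForm (u v : Fin 3 → F) : F := u 0 * σ (v 0) + u 1 * σ (v 1) + u 2 * σ (v 2)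

/-- The Gram determinant of three isotropic vectors. -/
theorem gram_det (A B C : Fin 3 → F) (hA : hermNorm F q A = 0) (hB : hermNorm F q B = 0)
    (hC : hermNorm F q C = 0) :
    (Matrix.of ![A, B, C]).det * σ (Matrix.of ![A, B, C]).det =
      hermForm (q := q) A B * hermForm (q := q) B C * hermForm (q := q) C A +
        σ (hermForm (q := q) A B * hermForm (q := q) B C * hermForm (q := q) C A) := by
  set M := Matrix.of ![A, B, C] with hM
  have h1 : M.det * σ M.det = (M * (M.map σ).transpose).det := by
    rw [Matrix.det_mul, Matrix.det_transpose, RingHom.map_det]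
    rfl
  have h2 : M * (M.map σ).transpose = Matrix.of ![
      ![0, hermForm (q := q) A B, σ (hermForm (q := q) C A)],
      ![σ (hermForm (q := q) A B), 0, hermForm (q := q) B C],
      ![hermForm (q := q) C A, σ (hermForm (q := q) B C), 0]] := by
    rw [hermNorm_three] at hA hB hC
    ext i j
    rw [Matrix.mul_apply, Fin.sum_univ_three]
    fin_cases i <;> fin_cases j <;> simp [hM, hermForm, hA, hB, hC, mul_comm]
  rw [h1, h2, Matrix.det_fin_three]
  simp
  ring

/-- Three vertices `A`, `B`, `C` of a Pasch configuration of isotropic points form a triangle, and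
the other three vertices are collinear points on its sides. The condition of Menelaus for these
turns the condition that they are isotropic into the vanishing of the Gram determinant of the
triangle. -/
theorem antiPasch_hermitianUnital : (hermitianUnital F q).AntiPasch := by
  rintro ⟨p, b, hp, hb, ⟨h00, h02, h03⟩, ⟨h10, h14, h15⟩, ⟨h21, h22, h24⟩, h31, h33, h35⟩
  have hne : ∀ {i j}, i ≠ j → (p i).1 ≠ (p j).1 := fun h h' => h (hp (Subtype.ext h'))
  have hiso : ∀ i, hermNorm F q (p i).1.rep = 0 := fun i => (p i).2
  set A := (p 0).1.rep with hA
  set B := (p 2).1.rep with hB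
  set C := (p 4).1.rep with hC
  obtain ⟨x, y, hx, hy, h3⟩ := exists_rep_eq (p'' := (p 3).1) (hne (by decide : (0 : Fin 6) ≠ 2))
    (hne (by decide)) (hne (by decide)) h00 h02 h03
  obtain ⟨z, w, hz, hw, h5⟩ := exists_rep_eq (p'' := (p 5).1) (hne (by decide : (0 : Fin 6) ≠ 4))
    (hne (by decide)) (hne (by decide)) h10 h14 h15
  obtain ⟨e, f, he, hf, h1⟩ := exists_rep_eq (p'' := (p 1).1) (hne (by decide : (2 : Fin 6) ≠ 4))
    (hne (by decide)) (hne (by decide)) h22 h24 h21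
  obtain ⟨x', y', -, -, h5'⟩ := exists_rep_eq (p'' := (p 5).1) (hne (by decide : (1 : Fin 6) ≠ 3))
    (hne (by decide)) (hne (by decide)) h31 h33 h35
  rw [← hA, ← hB] at h3
  rw [← hA, ← hC] at h5
  rw [← hB, ← hC] at h1
  have hdet : (Matrix.of ![A, B, C]).det ≠ 0 := by
    intro hdet
    obtain ⟨w, hw0, hw⟩ := Matrix.exists_mulVec_eq_zero_iff.2 hdet
    have hmem : ∀ v ∈ ({A, B, C} : Set (Fin 3 → F)), v ∈ (lineOf w hw0).1 := by
      intro v hv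
      rw [mem_lineOf]
      have h0 := congrFun hw 0
      have h1 := congrFun hw 1
      have h2 := congrFun hw 2
      simp only [Matrix.mulVec, dotProduct, Fin.sum_univ_three, Matrix.of_apply,
        Matrix.cons_val_zero, Matrix.cons_val_one, Matrix.cons_val, Pi.zero_apply] at h0 h1 h2
      rcases hv with rfl | rfl | rfl
      · linear_combination h0
      · linear_combination h1
      · linear_combination h2
    have a1 : (b 0).1 = lineOf w hw0 := projPlane_block_eq (hne (by decide : (0 : Fin 6) ≠ 2))
      h00 h02 ((projPlane_inc_iff _ _).2 (hmem _ (by simp [hA])))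
      ((projPlane_inc_iff _ _).2 (hmem _ (by simp [hB])))
    have a2 : (b 1).1 = lineOf w hw0 := projPlane_block_eq (hne (by decide : (0 : Fin 6) ≠ 4))
      h10 h14 ((projPlane_inc_iff _ _).2 (hmem _ (by simp [hA])))
      ((projPlane_inc_iff _ _).2 (hmem _ (by simp [hC])))
    exact absurd (hb (Subtype.ext (a1.trans a2.symm))) (by decide)
  have hcoef : z = y' * x ∧ 0 = x' * e + y' * y ∧ w = x' * f := by
    have hli : LinearIndependent F (Matrix.of ![A, B, C]).row :=
      Matrix.linearIndependent_rows_iff_isUnit.2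
        ((Matrix.isUnit_iff_isUnit_det _).2 (isUnit_iff_ne_zero.2 hdet))
    have := Fintype.linearIndependent_iff.1 hli
      ![z - y' * x, -(x' * e + y' * y), w - x' * f] (by
        have h6 : z • A + w • C = x' • (e • B + f • C) + y' • (x • A + y • B) := by
          rw [← h1, ← h3, ← h5]
          exact h5'
        rw [Fin.sum_univ_three]
        ext i
        have := congrFun h6 i
        simp [Matrix.row] at this ⊢
        linear_combination this)
    have a0 := this 0
    have a1 := this 1
    have a2 := this 2
    simp only [Matrix.cons_val_zero, Matrix.cons_val_one, Matrix.cons_val] at a0 a1 a2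
    exact ⟨by linear_combination a0, by linear_combination a1, by linear_combination a2⟩
  obtain ⟨m1, m2, m3⟩ := hcoef
  have hmen : w * e * x = -(f * y * z) := by
    rw [m1, m3]
    linear_combination (-(f * x)) * m2
  have hcomb : ∀ (a c : F) (u v : Fin 3 → F), hermNorm F q u = 0 → hermNorm F q v = 0 →
      hermNorm F q (a • u + c • v) = 0 →
      a * σ c * hermForm (q := q) u v + c * σ a * σ (hermForm (q := q) u v) = 0 := by
    intro a c u v hu hv huv
    rw [hermNorm_three] at hu hv huv
    simp only [hermForm, Pi.add_apply, Pi.smul_apply, smul_eq_mul, map_add, map_mul,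
      conj_conj] at huv ⊢
    linear_combination huv - a * σ a * hu - c * σ c * hv
  have g1 := hcomb x y A B (hiso 0) (hiso 2) (h3 ▸ hiso 3)
  have g2 := hcomb e f B C (hiso 2) (hiso 4) (h1 ▸ hiso 1)
  have g3 := hcomb w z C A (hiso 4) (hiso 0) (by rw [add_comm, ← h5]; exact hiso 5)
  have hgram := gram_det A B C (hiso 0) (hiso 2) (hiso 4)
  set a := hermForm (q := q) A B
  set c := hermForm (q := q) B C
  set d := hermForm (q := q) C A
  have hmen' : σ w * σ e * σ x = -(σ f * σ y * σ z) := by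
    rw [← map_mul, ← map_mul, hmen]
    simp
  have hzero : a * c * d + σ (a * c * d) = 0 := by
    have hn : f * y * z * σ (f * y * z) ≠ 0 := by simp [hf, hy, hz]
    apply mul_left_cancel₀ hn
    simp only [map_mul, mul_zero]
    have k1 : x * σ y * a = -(y * σ x * σ a) := by linear_combination g1
    have k2 : e * σ f * c = -(f * σ e * σ c) := by linear_combination g2
    have k3 : w * σ z * d = -(z * σ w * σ d) := by linear_combination g3
    have k4 : (x * σ y * a) * (e * σ f * c) * (w * σ z * d) =
        -((y * σ x * σ a) * (f * σ e * σ c) * (z * σ w * σ d)) := by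
      rw [k1, k2, k3]
      ring
    linear_combination -k4 + (σ f * σ y * σ z * a * c * d) * hmen +
      (f * y * z * σ a * σ c * σ d) * hmen'
  rw [hzero] at hgram
  simp [hdet] at hgram

end Hermitian

section Gruening

variable {F : Type*} [Field F] [Finite F] {q : ℕ} [hF : Fact (Nat.card F = q ^ 2)]

local notation "σ" => conj F q

/-! ### The Baer subplanes of the derivation set -/

/-- Hilbert 90: an element of norm `1` is a quotient of conjugates. -/
theorem exists_eq_mul_conj {g : F} (hg : g * σ g = 1) : ∃ a, a ≠ 0 ∧ a = g * σ a := by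
  by_cases h : g = -1
  · obtain ⟨t, ht⟩ := exists_conj_ne (F := F) (q := q)
    refine ⟨t - σ t, sub_ne_zero.2 ht.symm, ?_⟩
    rw [h, map_sub, conj_conj]
    ring
  · refine ⟨1 + g, fun h' => h (by linear_combination h'), ?_⟩
    rw [map_add, map_one]
    linear_combination -hg

variable (q) in
/-- The Baer subplane `{(x, c * σ x)}`. -/
def baerSubplane (c : F) : AddSubgroup (Fin 2 → F) where
  carrier := {v | v 1 = c * σ (v 0)}
  zero_mem' := by simp
  add_mem' := by
    intro v w hv hw
    change v 1 + w 1 = c * σ (v 0 + w 0)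
    rw [map_add, mul_add, ← hv, ← hw]
  neg_mem' := by
    intro v hv
    change -v 1 = c * σ (-v 0)
    rw [map_neg, mul_neg, ← hv]

theorem mem_baerSubplane {c : F} {v : Fin 2 → F} : v ∈ baerSubplane q c ↔ v 1 = c * σ (v 0) :=
  Iff.rfl

theorem baerSubplane_injective : Function.Injective (baerSubplane (F := F) q) := by
  intro c c' h
  have : ![1, c] ∈ baerSubplane q c := by simp [mem_baerSubplane]
  rw [h, mem_baerSubplane] at this
  simpa using this

theorem isBaerDirection_baerSubplane {c : F} (hc : c * σ c = -1) :
    IsBaerDirection F q (baerSubplane q c) where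
  smul_mem a ha w hw := by
    rw [mem_baerSubplane] at hw ⊢
    rw [← conj_apply] at ha
    simp only [Pi.smul_apply, smul_eq_mul, map_mul, hw, ha]
    ring
  card_eq := by
    rw [← hF.out]
    exact Nat.card_congr
      { toFun := fun v => v.1 0
        invFun := fun x => ⟨![x, c * σ x], by simp [mem_baerSubplane]⟩
        left_inv := fun v => by
          ext i
          fin_cases i
          · rfl
          · exact (mem_baerSubplane.1 v.2).symm
        right_inv := fun x => rfl }
  directions v hv := by
    rw [hermNorm_two]
    constructor
    · rintro ⟨a, ha, h⟩
      rw [mem_baerSubplane] at h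
      simp only [Pi.smul_apply, smul_eq_mul, map_mul] at h
      have h' := congrArg σ h
      simp only [map_mul, conj_conj] at h'
      have : a * σ a ≠ 0 := by simp [ha]
      apply mul_left_cancel₀ this
      linear_combination (σ a * σ (v 1)) * h + c * σ a * σ (v 0) * h' +
        a * σ a * v 0 * σ (v 0) * hc
    · intro h
      have h0 : v 0 ≠ 0 := by
        intro h0
        apply hv
        ext i
        fin_cases i
        · exact h0
        · simpa [h0] using h
      have h1 : v 1 ≠ 0 := by
        intro h1
        apply h0
        simpa [h1] using h
      obtain ⟨a, ha0, ha⟩ := exists_eq_mul_conj (q := q) (g := c * σ (v 0) / v 1) (by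
        simp only [map_div₀, map_mul, conj_conj]
        rw [div_mul_div_comm, div_eq_one_iff_eq (by simp [h1])]
        linear_combination v 0 * σ (v 0) * hc - h)
      refine ⟨a, ha0, ?_⟩
      rw [mem_baerSubplane]
      simp only [Pi.smul_apply, smul_eq_mul, map_mul]
      rw [div_mul_eq_mul_div, eq_div_iff h1] at ha
      linear_combination ha

/-- An additive map that fixes `1` and preserves norms also preserves traces. It maps each `x` to `x`
or to its conjugate, hence is the identity or the involution, because a group is not the union of two
proper subgroups. -/
theorem eq_id_or_eq_conj (ψ : F →+ F) (h1 : ψ 1 = 1) (hN : ∀ x, ψ x * σ (ψ x) = x * σ x) :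
    (∀ x, ψ x = x) ∨ ∀ x, ψ x = σ x := by
  have hor : ∀ x, ψ x = x ∨ ψ x = σ x := by
    intro x
    have h2 := hN (x + 1)
    simp only [map_add, h1, map_one] at h2
    have h3 : (ψ x - x) * (ψ x - σ x) = 0 := by
      linear_combination (-ψ x) * hN x + ψ x * h2 - hN x
    rcases mul_eq_zero.1 h3 with h | h
    · exact Or.inl (sub_eq_zero.1 h)
    · exact Or.inr (sub_eq_zero.1 h)
  by_contra! hcon
  obtain ⟨⟨x, hx⟩, y, hy⟩ := hcon
  have hx' := (hor x).resolve_left hx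
  have hy' := (hor y).resolve_right hy
  have hxy := hor (x + y)
  simp only [map_add, hx', hy'] at hxy
  rcases hxy with h | h
  · exact hx (by rw [hx']; exact add_right_cancel h)
  · exact hy (by rw [hy']; exact add_left_cancel h)

theorem IsBaerDirection.exists_eq {W : AddSubgroup (Fin 2 → F)} (hW : IsBaerDirection F q W) :
    ∃ c, c * σ c = -1 ∧ W = baerSubplane q c := by
  have hq := one_lt_of_card_eq_sq F q
  have hiso : ∀ w ∈ W, w 0 * σ (w 0) + w 1 * σ (w 1) = 0 := by
    intro w hw
    rw [← hermNorm_two]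
    by_cases hw0 : w = 0
    · simp [hw0, hermNorm_two]
    · exact (hW.directions w hw0).1 ⟨1, one_ne_zero, by simpa using hw⟩
  -- the projection to the first coordinate is bijective on `W`
  let π : W →+ F := (Pi.evalAddMonoidHom (fun _ : Fin 2 => F) 0).comp W.subtype
  have hπ : Function.Injective π := by
    rw [injective_iff_map_eq_zero]
    intro w hw
    have h0 : w.1 0 = 0 := hw
    have := hiso _ w.2
    ext i
    fin_cases i
    · exact h0
    · simpa [h0] using this
  have hbij : Function.Bijective π := by
    have := Fintype.ofFinite F
    have := Fintype.ofFinite W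
    rw [Fintype.bijective_iff_injective_and_card]
    refine ⟨hπ, ?_⟩
    rw [← Nat.card_eq_fintype_card, ← Nat.card_eq_fintype_card, hF.out, hW.card_eq]
  let e : W ≃+ F := AddEquiv.ofBijective π hbij
  have he0 : ∀ x, (e.symm x).1 0 = x := fun x => e.apply_symm_apply x
  let φ : F →+ F := ((Pi.evalAddMonoidHom (fun _ : Fin 2 => F) 1).comp W.subtype).comp
    e.symm.toAddMonoidHom
  have hφ : ∀ x, φ x = (e.symm x).1 1 := fun x => rfl
  have hmem : ∀ w, w ∈ W ↔ w 1 = φ (w 0) := by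
    intro w
    constructor
    · intro hw
      have : e.symm (w 0) = ⟨w, hw⟩ := by
        rw [AddEquiv.symm_apply_eq]
        rfl
      rw [hφ, this]
    · intro h
      have : w = (e.symm (w 0)).1 := by
        ext i
        fin_cases i
        · exact (he0 _).symm
        · exact h
      rw [this]
      exact (e.symm (w 0)).2
  have hN : ∀ x, x * σ x + φ x * σ (φ x) = 0 := by
    intro x
    have := hiso _ (e.symm x).2
    rwa [he0] at this
  have hc : φ 1 * σ (φ 1) = -1 := by
    have := hN 1
    simp only [map_one, mul_one] at this
    linear_combination this
  have hc0 : φ 1 ≠ 0 := by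
    intro h
    simp [h] at hc
  refine ⟨φ 1, hc, ?_⟩
  rcases eq_id_or_eq_conj (q := q) ((AddMonoidHom.mulLeft (φ 1)⁻¹).comp φ) (by simp [hc0]) (by
    intro x
    simp only [AddMonoidHom.comp_apply, AddMonoidHom.coe_mulLeft, map_mul, map_inv₀]
    have hc' : (φ 1)⁻¹ * (σ (φ 1))⁻¹ = -1 := by
      rw [← mul_inv, hc]
      norm_num
    linear_combination φ x * σ (φ x) * hc' - hN x) with h | h
  · -- in this case `W` would be an `F`-subspace, and have only one direction
    exfalso
    simp only [AddMonoidHom.comp_apply, AddMonoidHom.coe_mulLeft] at h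
    obtain ⟨c', hc', hne⟩ : ∃ c' : F, c' * σ c' = -1 ∧ c' ≠ φ 1 := by
      have h1 := ncard_norm_eq (F := F) (q := q) (a := -1) (by simp) (by simp)
      have h2 : 1 < {t : F | t * σ t = -1}.ncard := by omega
      exact Set.exists_ne_of_one_lt_ncard h2 _
    obtain ⟨a, ha, hmem'⟩ := (hW.directions ![1, c'] (fun h => by simpa using congrFun h 0)).2 (by
      rw [hermNorm_two]
      simp [hc'])
    rw [hmem] at hmem'
    simp only [Pi.smul_apply, Matrix.cons_val_zero, Matrix.cons_val_one, smul_eq_mul,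
      mul_one] at hmem'
    have := h a
    rw [inv_mul_eq_iff_eq_mul₀ hc0] at this
    rw [this, mul_comm] at hmem'
    exact hne (mul_right_cancel₀ ha hmem')
  · ext w
    rw [hmem, mem_baerSubplane]
    have := h (w 0)
    simp only [AddMonoidHom.comp_apply, AddMonoidHom.coe_mulLeft] at this
    rw [inv_mul_eq_iff_eq_mul₀ hc0] at this
    rw [this]

/-! ### The Hall plane -/

theorem eq_zero_of_mem_of_mem {W W' : AddSubgroup (Fin 2 → F)} (hW : W ∈ hallSpread F q)
    (hW' : W' ∈ hallSpread F q) (hne : W ≠ W') {v : Fin 2 → F} (h : v ∈ W) (h' : v ∈ W') :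
    v = 0 := by
  by_contra hv
  -- a nonzero vector determines its member of the spread
  have key : ∀ W ∈ hallSpread F q, v ∈ W →
      (hermNorm F q v ≠ 0 ∧ W = (Submodule.span F {v}).toAddSubgroup) ∨
      (hermNorm F q v = 0 ∧ W = baerSubplane q (v 1 / σ (v 0))) := by
    rintro W (⟨w, hw, rfl⟩ | hW) hvW
    · left
      obtain ⟨a, rfl⟩ := Submodule.mem_span_singleton.1 hvW
      have ha : a ≠ 0 := by
        rintro rfl
        simp at hv
      refine ⟨?_, ?_⟩
      · rw [hermNorm_smul]
        simp [ha, hw]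
      · rw [Submodule.span_singleton_smul_eq (IsUnit.mk0 a ha)]
    · right
      obtain ⟨c, hc, rfl⟩ := hW.exists_eq
      refine ⟨(hW.directions v hv).1 ⟨1, one_ne_zero, by simpa using hvW⟩, ?_⟩
      rw [mem_baerSubplane] at hvW
      have h0 : v 0 ≠ 0 := by
        intro h0
        apply hv
        ext i
        fin_cases i
        · exact h0
        · simp [hvW, h0]
      rw [hvW, mul_div_cancel_right₀ _ (by simpa using h0)]
  rcases key W hW h with ⟨h1, h2⟩ | ⟨h1, h2⟩ <;> rcases key W' hW' h' with ⟨h3, h4⟩ | ⟨h3, h4⟩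
  · exact hne (h2.trans h4.symm)
  · exact h1 h3
  · exact h3 h1
  · exact hne (h2.trans h4.symm)

theorem translate_eq {G : Type*} [AddCommGroup G] {W : AddSubgroup G} {v x : G} (h : x - v ∈ W) :
    {y | y - v ∈ W} = {y | y - x ∈ W} := by
  ext y
  constructor
  · intro hy
    have := W.sub_mem hy h
    rwa [sub_sub_sub_cancel_right] at this
  · intro hy
    have := W.add_mem hy h
    rwa [sub_add_sub_cancel] at this

theorem eq_of_translate_eq {G : Type*} [AddCommGroup G] {W W' : AddSubgroup G} {v v' : G}
    (h : {y | y - v ∈ W} = {y | y - v' ∈ W'}) : W = W' := by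
  have hv : v - v' ∈ W' := by
    have : v ∈ {y | y - v ∈ W} := by simp
    rw [h] at this
    exact this
  rw [translate_eq hv] at h
  ext x
  have := Set.ext_iff.1 h (x + v)
  simpa using this

theorem hallPlane_block_eq {p p' : (Fin 2 → F) ⊕ hallSpread F q} (hne : p ≠ p')
    {b b' : Option (hallLines F q)} (h1 : (hallPlane F q).inc p b) (h2 : (hallPlane F q).inc p' b)
    (h3 : (hallPlane F q).inc p b') (h4 : (hallPlane F q).inc p' b') : b = b' := by
  have aff_inf : ∀ (x : Fin 2 → F) (W : hallSpread F q) (X X' : hallLines F q),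
      x ∈ X.1 → (∃ v : Fin 2 → F, X.1 = {x | x - v ∈ W.1}) →
      x ∈ X'.1 → (∃ v : Fin 2 → F, X'.1 = {x | x - v ∈ W.1}) → X = X' := by
    rintro x W X X' hx ⟨v, hv⟩ hx' ⟨v', hv'⟩
    rw [hv] at hx
    rw [hv'] at hx'
    exact Subtype.ext (by rw [hv, hv', translate_eq hx, translate_eq hx'])
  rcases p with x | W <;> rcases p' with x' | W'
  · rcases b with _ | ⟨X, W, hW, v, rfl⟩
    · exact h1.elim
    rcases b' with _ | ⟨X', W', hW', v', rfl⟩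
    · exact h3.elim
    have h1 : x - v ∈ W := h1
    have h2 : x' - v ∈ W := h2
    have h3 : x - v' ∈ W' := h3
    have h4 : x' - v' ∈ W' := h4
    have e1 := W.sub_mem h1 h2
    have e2 := W'.sub_mem h3 h4
    rw [sub_sub_sub_cancel_right] at e1 e2
    have hWW : W = W' := by
      by_contra hWW
      apply hne
      rw [sub_eq_zero.1 (eq_zero_of_mem_of_mem hW hW' hWW e1 e2)]
    subst hWW
    exact congrArg some (Subtype.ext ((translate_eq h1).trans (translate_eq h3).symm))
  · rcases b with _ | X
    · exact h1.elim
    rcases b' with _ | X'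
    · exact h3.elim
    exact congrArg some (aff_inf x W' X X' h1 h2 h3 h4)
  · rcases b with _ | X
    · exact h2.elim
    rcases b' with _ | X'
    · exact h4.elim
    exact congrArg some (aff_inf x' W X X' h2 h1 h4 h3)
  · have : ∀ b, (hallPlane F q).inc (Sum.inr W) b → (hallPlane F q).inc (Sum.inr W') b →
        b = none := by
      rintro (_ | X) h h'
      · rfl
      · obtain ⟨v, hv⟩ := h
        obtain ⟨v', hv'⟩ := h'
        exact absurd (congrArg Sum.inr (Subtype.ext (eq_of_translate_eq (hv.symm.trans hv')))) hne
    rw [this b h1 h2, this b' h3 h4]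

/-! ### Grüning's unital is isomorphic to the twisted model -/

/-- An attached line of the twisted model is cut out by a translate of a Baer subplane. -/
theorem mem_line_iff_mem_baer (r : UnitSphere F q) (m : NegOneNorm F q) (x : F) :
    r.1 0 * x + r.1 1 * (m.1 * σ x) = 1 ↔ σ (r.1 0) - m.1 * r.1 1 = x := by
  have hsol : r.1 0 * (σ (r.1 0) - m.1 * r.1 1) +
      r.1 1 * (m.1 * σ (σ (r.1 0) - m.1 * r.1 1)) = 1 := by
    simp only [map_sub, map_mul, conj_conj]
    linear_combination r.eq_one - r.1 1 * σ (r.1 1) * m.2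
  constructor
  · exact fun h => (existsUnique_attached norm_conj_conj r m).unique hsol h
  · rintro rfl
    exact hsol

theorem isomorphic_grueningUnital :
    (unitalModel (F := F) (q := q) (conj F q)).Isomorphic (grueningUnital F q) := by
  have hq := one_lt_of_card_eq_sq F q
  obtain ⟨s, hs⟩ := exists_mul_conj_eq (F := F) (q := q) (a := -1) (by simp)
  have hs0 : s ≠ 0 := by
    rintro rfl
    simp at hs
  have hs0' : σ s ≠ 0 := by simpa using hs0
  have hm : ∀ m : NegOneNorm F q, (s ^ 2 * σ m.1) * σ (s ^ 2 * σ m.1) = -1 := by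
    intro m
    simp only [map_mul, map_pow, conj_conj]
    linear_combination s ^ 2 * σ s ^ 2 * m.2 - (s * σ s - 1) * hs
  let W : NegOneNorm F q → hallSpread F q := fun m =>
    ⟨baerSubplane q (s ^ 2 * σ m.1), Or.inr (isBaerDirection_baerSubplane (hm m))⟩
  let f : UnitSphere F q ⊕ NegOneNorm F q → grueningPoints F q := Sum.elim
    (fun r => ⟨Sum.inl (s • r.1), Or.inl ⟨_, rfl, by rw [hermNorm_smul, r.2, hs, mul_one]⟩⟩)
    (fun m => ⟨Sum.inr (W m), Or.inr ⟨_, rfl, isBaerDirection_baerSubplane (hm m)⟩⟩)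
  have hinj : Function.Injective f := by
    rintro (r | m) (r' | m') h
    · have h := congrArg Subtype.val h
      simp only [f, Sum.elim_inl, Sum.inl.injEq] at h
      rw [Sum.inl.injEq]
      exact Subtype.ext (smul_right_injective _ hs0 h)
    · exact absurd (congrArg Subtype.val h) (by simp [f])
    · exact absurd (congrArg Subtype.val h) (by simp [f])
    · have h := congrArg Subtype.val h
      simp only [f, Sum.elim_inr, Sum.inr.injEq] at h
      have h := baerSubplane_injective (congrArg Subtype.val h)
      rw [Sum.inr.injEq]
      exact Subtype.ext ((conj F q).injective (mul_left_cancel₀ (pow_ne_zero 2 hs0) h))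
  have hsurj : Function.Surjective f := by
    rintro ⟨_, ⟨x, rfl, hx⟩ | ⟨⟨W', hW'⟩, rfl, hx⟩⟩
    · refine ⟨Sum.inl ⟨s⁻¹ • x, ?_⟩, ?_⟩
      · rw [hermNorm_smul, hx, map_inv₀, ← mul_inv, hs]
        norm_num
      · simp [f, hs0]
    · obtain ⟨c, hc, rfl⟩ := IsBaerDirection.exists_eq hx
      refine ⟨Sum.inr ⟨σ (c / s ^ 2), ?_⟩, ?_⟩
      · rw [conj_conj, map_div₀, map_pow]
        rw [div_mul_div_comm, mul_comm, hc, div_eq_iff (by simp [hs0])]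
        linear_combination (s * σ s - 1) * hs
      · simp only [f, W, Sum.elim_inr, conj_conj]
        congr 3
        field_simp
  have hbij : Function.Bijective f := ⟨hinj, hsurj⟩
  have hperp : ∀ w : Fin 2 → F, hermNorm F q ![w 1, -w 0] = hermNorm F q w := by
    intro w
    simp only [hermNorm_two, Matrix.cons_val_zero, Matrix.cons_val_one, map_neg]
    ring
  have hspan : ∀ w x : Fin 2 → F, w ≠ 0 →
      (x ∈ (Submodule.span F {![w 1, -w 0]}).toAddSubgroup ↔ x 0 * w 0 + x 1 * w 1 = 0) := by
    intro w x hw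
    rw [Submodule.mem_toAddSubgroup, Submodule.mem_span_singleton]
    constructor
    · rintro ⟨a, rfl⟩
      simp
      ring
    · intro h
      by_cases h1 : w 1 = 0
      · have h0 : w 0 ≠ 0 := by
          intro h0
          apply hw
          ext i
          fin_cases i
          · exact h0
          · exact h1
        refine ⟨-x 1 / w 0, ?_⟩
        ext i
        fin_cases i
        · simpa [h0, h1, eq_comm] using h
        · simp
          field_simp
      · refine ⟨x 0 / w 1, ?_⟩
        ext i
        fin_cases i
        · simp
          field_simp
        · simp
          field_simp
          linear_combination -h
  -- a line of non-isotropic direction is no translate of a Baer subplane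
  have hnot : ∀ (w v v' : Fin 2 → F) (m : NegOneNorm F q), hermNorm F q w ≠ 0 →
      {x | x - v ∈ (Submodule.span F {![w 1, -w 0]}).toAddSubgroup} ≠ {x | x - v' ∈ (W m).1} := by
    intro w v v' m hw h
    have h1 := eq_of_translate_eq h
    have h2 : ![w 1, -w 0] ∈ (W m).1 := by
      rw [← h1]
      exact Submodule.mem_span_singleton_self _
    apply hw
    rw [← hperp, ← (isBaerDirection_baerSubplane (hm m)).directions]
    · exact ⟨1, one_ne_zero, by simpa using h2⟩
    · intro h0
      apply hw
      rw [← hperp, h0]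
      simp [hermNorm_two]
  refine (isSteiner_unitalModel norm_conj_conj).isomorphic_induced
    (by omega) (hallPlane F q) (grueningPoints F q)
    (fun p _ p' _ hne b b' => hallPlane_block_eq hne) (Equiv.ofBijective f hbij) ?_
  rintro (_ | X | u)
  · refine ⟨none, ?_⟩
    rintro (r | m)
    · exact Iff.rfl
    · exact Iff.rfl
  · obtain ⟨w, hw, hX⟩ := X.2
    have hw0 : w ≠ 0 := by
      rintro rfl
      simp [hermNorm_two] at hw
    refine ⟨some ⟨{x | x - 0 ∈ (Submodule.span F {![w 1, -w 0]}).toAddSubgroup}, _,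
      Or.inl ⟨_, by rwa [hperp], rfl⟩, 0, rfl⟩, ?_⟩
    rintro (r | m)
    · rw [unitalModel_inl_inl, hX]
      change _ ↔ s • r.1 - 0 ∈ (Submodule.span F {![w 1, -w 0]}).toAddSubgroup
      rw [hspan _ _ hw0]
      simp only [Set.mem_ofPred_eq, sub_zero, Pi.smul_apply, smul_eq_mul, mul_assoc, ← mul_add]
      simp [hs0]
    · simp only [unitalModel_inr_inl, false_iff]
      rintro ⟨v, hv⟩
      exact hnot _ _ _ _ hw hv
  · by_cases hu : hermNorm F q u.1 = 0
    · obtain ⟨m', hm', hmu⟩ := existsUnique_slope (τ := conj F q)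
        norm_conj_conj u.2.1 hu
      refine ⟨some ⟨{x | x - ![s * σ (u.1 0), 0] ∈ (W m').1}, _, (W m').2, _, rfl⟩, ?_⟩
      rintro (r | m)
      · rw [unitalModel_inl_inr, hm', mem_line_iff_mem_baer]
        change _ ↔ s • r.1 - ![s * σ (u.1 0), 0] ∈ baerSubplane q _
        rw [mem_baerSubplane]
        simp only [Pi.sub_apply, Pi.smul_apply, smul_eq_mul, Matrix.cons_val_zero,
          Matrix.cons_val_one, sub_zero, map_sub, map_mul, conj_conj]
        have e1 : s * r.1 1 = s ^ 2 * σ m'.1 * (σ s * σ (r.1 0) - σ s * u.1 0) ↔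
            σ (r.1 0) - m'.1 * r.1 1 = u.1 0 := by
          constructor
          · intro h
            apply mul_left_cancel₀ hs0
            linear_combination (-m'.1) * h - s ^ 2 * σ s * (σ (r.1 0) - u.1 0) * m'.2 +
              s * (σ (r.1 0) - u.1 0) * hs
          · intro h
            linear_combination (-(s ^ 2 * σ s * σ m'.1)) * h - s ^ 2 * σ s * r.1 1 * m'.2 +
              s * r.1 1 * hs
        exact e1.symm
      · rw [unitalModel_inr_inr]
        constructor
        · intro h
          rw [hmu m h]
          exact ⟨_, rfl⟩
        · rintro ⟨v, hv⟩
          have h := baerSubplane_injective (eq_of_translate_eq hv)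
          have h := (conj F q).injective (mul_left_cancel₀ (pow_ne_zero 2 hs0) h)
          rw [← h]
          exact hm'
    · -- `v` is the foot of the perpendicular from the origin, scaled by `s`
      set n := hermNorm F q u.1 with hn
      have hn' : u.1 0 * σ (u.1 0) + u.1 1 * σ (u.1 1) = n := (hermNorm_two u.1).symm
      set v : Fin 2 → F := ![s / n * σ (u.1 0), s / n * σ (u.1 1)] with hv
      have hvu : v 0 * u.1 0 + v 1 * u.1 1 = s := by
        simp only [hv, Matrix.cons_val_zero, Matrix.cons_val_one]
        field_simp
        linear_combination hn'
      refine ⟨some ⟨{x | x - v ∈ (Submodule.span F {![u.1 1, -u.1 0]}).toAddSubgroup}, _,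
        Or.inl ⟨_, by rwa [hperp], rfl⟩, v, rfl⟩, ?_⟩
      rintro (r | m)
      · rw [unitalModel_inl_inr]
        change _ ↔ s • r.1 - v ∈ (Submodule.span F {![u.1 1, -u.1 0]}).toAddSubgroup
        rw [hspan _ _ u.2.1]
        simp only [Pi.sub_apply, Pi.smul_apply, smul_eq_mul]
        constructor
        · intro h
          linear_combination s * h - hvu
        · intro h
          apply mul_left_cancel₀ hs0
          linear_combination h + hvu
      · rw [unitalModel_inr_inr]
        constructor
        · intro h
          exact absurd (hermNorm_eq_zero_of_eq_mul norm_conj_conj m h) hu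
        · rintro ⟨v', hv'⟩
          exact absurd hv' (hnot _ _ _ _ hu)

end Gruening

section Twisted

variable {F : Type*} [Field F] [Finite F] {q : ℕ} [hF : Fact (Nat.card F = q ^ 2)]

local notation "σ" => conj F q

/-! ### The paramodification of the Hermitian unital -/

theorem existsUnique_point_iff {τ : F →+* F} (hτ : ∀ x, τ x * σ (τ x) = x * σ x)
    (c : Option (CentralLine F q ⊕ OuterLine F q)) :
    (∃! p, (unitalModel (q := q) τ).inc p none ∧ (unitalModel (q := q) τ).inc p c) ↔
      ∃ u, c = some (Sum.inr u) ∧ hermNorm F q u.1 = 0 := by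
  have hq := one_lt_of_card_eq_sq F q
  rcases c with _ | X | u
  · refine iff_of_false ?_ (by simp)
    rintro ⟨p, -, hp⟩
    have h1 : 1 < Nat.card (NegOneNorm F q) := by
      rw [card_negOneNorm]
      omega
    obtain ⟨m, m', hne⟩ := Finite.one_lt_card_iff_nontrivial.1 h1
    apply hne
    rw [← Sum.inr.injEq (α := UnitSphere F q), hp (Sum.inr m) ⟨trivial, trivial⟩,
      hp (Sum.inr m') ⟨trivial, trivial⟩]
  · refine iff_of_false ?_ (by simp)
    rintro ⟨r | m, ⟨h1, h2⟩, -⟩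
    · exact h1
    · exact h2
  · simp only [Option.some.injEq, Sum.inr.injEq, exists_eq_left']
    constructor
    · rintro ⟨r | m, ⟨h1, h2⟩, -⟩
      · exact h1.elim
      · exact hermNorm_eq_zero_of_eq_mul hτ m h2
    · intro hu
      obtain ⟨m, hm, hm'⟩ := existsUnique_slope hτ u.2.1 hu
      refine ⟨Sum.inr m, ⟨trivial, hm⟩, ?_⟩
      rintro (r | m') ⟨h1, h2⟩
      · exact h1.elim
      · rw [hm' m' h2]

/-- Passing from the model of the Hermitian unital to the twisted model is a paramodification: the
isotropic lines are attached to other points at infinity. -/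
theorem exists_paramodification_hermitianUnital :
    ∃ b χ, (hermitianUnital F q).IsProperColoring b χ ∧
      ¬ (hermitianUnital F q).EquivColoring b χ ((hermitianUnital F q).trivialColoring b) ∧
      ((hermitianUnital F q).paramodification b χ).Isomorphic
        (unitalModel (F := F) (q := q) (conj F q)) := by
  have hid : ∀ x : F, RingHom.id F x * σ (RingHom.id F x) = x * σ x := fun _ => rfl
  have hcj : ∀ x : F, σ x * σ (σ x) = x * σ x := norm_conj_conj
  have hex : ∀ c, (∃! p, (unitalModel (q := q) (RingHom.id F)).inc p none ∧
      (unitalModel (q := q) (RingHom.id F)).inc p c) ↔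
      ∃! p, (unitalModel (q := q) (RingHom.id F)).inc p none ∧
        (unitalModel (conj F q)).inc p c := fun c => by
    rw [existsUnique_point_iff hid, ← existsUnique_point_iff hcj]
    refine existsUnique_congr fun p => and_congr_left' ?_
    rcases p with r | m <;> rfl
  refine IncStr.exists_paramodification_isomorphic (unitalModel (q := q) (RingHom.id F))
    (unitalModel (conj F q)) isomorphic_hermitianUnital.symm none
    (fun p p' hne c c' => (isSteiner_unitalModel hcj).block_eq hne) ?_ (fun c => (hex c).1) ?_ ?_
  · rintro (r | m) hp c
    · rcases c with _ | X | u <;> rfl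
    · exact absurd trivial hp
  · intro c hc p
    rw [existsUnique_point_iff hid] at hc
    rcases c with _ | X | u
    · rcases p with r | m <;> rfl
    · rcases p with r | m <;> rfl
    · rcases p with r | m
      · rfl
      · have hu : hermNorm F q u.1 ≠ 0 := fun h => hc ⟨u, rfl, h⟩
        exact iff_of_false (fun h => hu (hermNorm_eq_zero_of_eq_mul hcj m h))
          (fun h => hu (hermNorm_eq_zero_of_eq_mul hid m h))
  · obtain ⟨m, hm⟩ := exists_mul_conj_eq (F := F) (q := q) (a := -1) (by simp)
    obtain ⟨z, hz⟩ := exists_conj_ne (F := F) (q := q)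
    have hz0 : z ≠ 0 := by
      rintro rfl
      simp at hz
    have hiso : ∀ t : F, hermNorm F q ![t, t * m] = 0 := by
      intro t
      simp only [hermNorm_two, Matrix.cons_val_zero, Matrix.cons_val_one, map_mul]
      linear_combination t * σ t * hm
    have hne : ∀ t : F, t ≠ 0 → ![t, t * m] ≠ 0 := fun t ht h => ht (congrFun h 0)
    have hne1 : ∀ t : F, hermNorm F q ![t, t * m] ≠ 1 := fun t h => by simp [hiso t] at h
    refine ⟨some (Sum.inr ⟨![1, 1 * m], hne 1 one_ne_zero, hne1 1⟩),
      some (Sum.inr ⟨![z, z * m], hne z hz0, hne1 z⟩), Sum.inr ⟨m, hm⟩,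
      (existsUnique_point_iff hid _).2 ⟨_, rfl, hiso 1⟩,
      (existsUnique_point_iff hid _).2 ⟨_, rfl, hiso z⟩, trivial, by simp, by simp [mul_comm], ?_⟩
    rintro ⟨r | m', h1, h2, h3⟩
    · exact h1
    · simp only [unitalModel_inr_inr, Matrix.cons_val_zero, Matrix.cons_val_one, one_mul, map_one,
        mul_one] at h2 h3
      rw [← h2, mul_comm] at h3
      have hm0 : m ≠ 0 := by
        rintro rfl
        simp at hm
      exact hz (mul_left_cancel₀ hm0 h3).symm

/-! ### A Pasch configuration in the twisted model -/

/-- Blocks are cut out by linear equations. -/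
theorem inc_of_collinear (τ : F →+* F) {r r' x : UnitSphere F q}
    {b : Option (CentralLine F q ⊕ OuterLine F q)}
    (h : (unitalModel τ).inc (Sum.inl r) b) (h' : (unitalModel τ).inc (Sum.inl r') b) (c : F)
    (h0 : x.1 0 = r.1 0 + c * (r'.1 0 - r.1 0)) (h1 : x.1 1 = r.1 1 + c * (r'.1 1 - r.1 1)) :
    (unitalModel τ).inc (Sum.inl x) b := by
  rcases b with _ | X | u
  · exact h.elim
  · obtain ⟨w, hw, hX⟩ := X.2
    rw [unitalModel_inl_inl, hX] at h h' ⊢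
    simp only [Set.mem_ofPred_eq] at h h' ⊢
    rw [h0, h1]
    linear_combination (1 - c) * h + c * h'
  · rw [unitalModel_inl_inr] at h h' ⊢
    rw [h0, h1]
    linear_combination (1 - c) * h + c * h'

theorem exists_trace_eq_one (hq : 2 < q) : ∃ η : F, η + σ η = 1 ∧ σ η ≠ η := by
  have h := ncard_trace_mul_eq (F := F) (q := q) (κ := 1) (a := 1) one_ne_zero (by simp)
  obtain ⟨t, ht, t', ht', hne⟩ := (Set.one_lt_ncard (s := {t : F | t * 1 + σ (t * 1) = 1})).1
    (by omega)
  simp only [Set.mem_ofPred_eq, mul_one] at ht ht'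
  by_contra! hcon
  rw [hcon t ht] at ht
  rw [hcon t' ht'] at ht'
  apply hne
  linear_combination t' * ht - t * ht'

theorem exists_norm_eq_trace_ne (hq : 2 < q) {μ : F} (hμ : σ μ = μ) (hμ0 : μ ≠ 0) :
    ∃ ω ω' : F, ω ≠ ω' ∧ (ω * σ ω = μ ∧ ω + σ ω + μ ≠ 0) ∧
      (ω' * σ ω' = μ ∧ ω' + σ ω' + μ ≠ 0) := by
  classical
  open Polynomial in
  have h1 : {ω : F | ω ^ 2 + μ * ω + μ = 0}.ncard ≤ 2 := by
    have hd : (X ^ 2 + C μ * X + C μ : F[X]).natDegree = 2 := by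
      compute_degree!
    have := ncard_eval_eq_zero_le (X ^ 2 + C μ * X + C μ : F[X]) (by
      intro h
      simp [h] at hd)
    rw [hd] at this
    simpa using this
  have h2 := ncard_norm_eq hμ hμ0
  have h3 := Set.le_ncard_sdiff {ω : F | ω ^ 2 + μ * ω + μ = 0} {ω : F | ω * σ ω = μ}
  obtain ⟨ω, ⟨hω, hω'⟩, ω', ⟨hω'', hω'''⟩, hne⟩ := (Set.one_lt_ncard
    (s := {ω : F | ω * σ ω = μ} \ {ω : F | ω ^ 2 + μ * ω + μ = 0})).1 (by omega)
  simp only [Set.mem_ofPred_eq] at hω hω' hω'' hω'''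
  refine ⟨ω, ω', hne, ⟨hω, fun h => hω' ?_⟩, hω'', fun h => hω''' ?_⟩
  · linear_combination ω * h - hω
  · linear_combination ω' * h - hω''

/-- A Pasch configuration in the twisted model with exactly one point at infinity: two of its blocks
are attached to the point `m`, and the other two meet in `(1, 0)`. An attached line to `m` is
a level set of the function `r ↦ σ (r 0) - m * r 1`. Let `η` have trace `1`, and let `ω`
satisfy `N ω * N η = 1`. The point in which the line through `(1, 0)` with direction
`(1, -σ m * (1 + ω))` meets the level set with value `σ η` then has norm `1`, and the same is
true for the value `η`. Two choices of `ω` give the configuration; the choices for which the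
direction is isotropic are to be avoided. -/
theorem not_antiPasch_unitalModel_conj (hq : 2 < q) :
    ¬ (unitalModel (F := F) (q := q) (conj F q)).AntiPasch := by
  have hcj : ∀ x : F, σ x * σ (σ x) = x * σ x := norm_conj_conj
  obtain ⟨η, hη, hne⟩ := exists_trace_eq_one (F := F) hq
  obtain ⟨m, hm⟩ := exists_mul_conj_eq (F := F) (q := q) (a := -1) (by simp)
  have hη0 : η ≠ 0 := by
    rintro rfl
    simp at hη
  have hση0 : σ η ≠ 0 := by simpa using hη0
  set μ := (η * σ η)⁻¹ with hμ
  have hμη : μ * (η * σ η) = 1 := inv_mul_cancel₀ (mul_ne_zero hη0 hση0)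
  have hσμ : σ μ = μ := by
    rw [hμ]
    simp [mul_comm]
  obtain ⟨ω, ω', hωω', hω, hω'⟩ := exists_norm_eq_trace_ne hq hσμ
    (inv_ne_zero (mul_ne_zero hη0 hση0))
  let α : F → F → F := fun ω η => (1 + σ ω * η) / (ω + σ ω + μ)
  have hα : ∀ ω η : F, α ω η = (1 + σ ω * η) / (ω + σ ω + μ) := fun _ _ => rfl
  have hσα : ∀ ω η : F, σ (α ω η) = (1 + ω * σ η) / (ω + σ ω + μ) := by
    intro ω η
    rw [hα, map_div₀]
    simp only [map_add, map_mul, map_one, conj_conj, hσμ]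
    rw [add_comm (σ ω) ω]
  have hα0 : ∀ ω η : F, ω + σ ω + μ ≠ 0 → η + σ η = 1 → μ * (η * σ η) = 1 → α ω η ≠ 0 := by
    intro ω η hd hη hμη
    rw [hα]
    refine div_ne_zero (fun h => hd ?_) hd
    have h' := congrArg σ h
    simp only [map_add, map_mul, map_one, conj_conj, map_zero] at h'
    linear_combination μ * σ η * h + μ * η * h' - μ * hη - (ω + σ ω) * hμη
  have hmem : ∀ ω η : F, ω * σ ω = μ → ω + σ ω + μ ≠ 0 → η + σ η = 1 → μ * (η * σ η) = 1 →
      hermNorm F q ![1 + α ω η, -σ m * (1 + ω) * α ω η] = 1 := by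
    intro ω η hN hd hη hμη
    have h1 : (ω + σ ω + μ) * α ω η = 1 + σ ω * η := mul_div_cancel₀ _ hd
    have h2 : (ω + σ ω + μ) * σ (α ω η) = 1 + ω * σ η := by
      rw [hσα]
      exact mul_div_cancel₀ _ hd
    simp only [hermNorm_two, Matrix.cons_val_zero, Matrix.cons_val_one, map_add, map_mul, map_one,
      map_neg, conj_conj]
    set a := α ω η
    apply mul_left_cancel₀ hd
    linear_combination (ω + σ ω + μ) * (1 + ω) * (1 + σ ω) * a * σ a * hm -
      (ω + σ ω + μ) * a * σ a * hN - (ω + σ ω + μ) * σ a * h1 - (1 + σ ω * η) * h2 + h1 + h2 -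
      η * σ η * hN - hμη
  have hinv : ∀ ω η : F, ω * σ ω = μ → ω + σ ω + μ ≠ 0 → η + σ η = 1 →
      σ (1 + α ω η) - m * (-σ m * (1 + ω) * α ω η) = σ η := by
    intro ω η hN hd hη
    have h1 : (ω + σ ω + μ) * α ω η = 1 + σ ω * η := mul_div_cancel₀ _ hd
    have h2 : (ω + σ ω + μ) * σ (α ω η) = 1 + ω * σ η := by
      rw [hσα]
      exact mul_div_cancel₀ _ hd
    rw [map_add, map_one]
    apply mul_left_cancel₀ hd
    linear_combination (ω + σ ω + μ) * (1 + ω) * α ω η * hm - (1 + ω) * h1 + h2 - η * hN -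
      (σ ω + μ) * hη
  have hη' : σ η + σ (σ η) = 1 := by rw [conj_conj, add_comm, hη]
  have hμη' : μ * (σ η * σ (σ η)) = 1 := by rw [hcj, hμη]
  have hm0 : m ≠ 0 := by
    rintro rfl
    simp at hm
  have hσm0 : σ m ≠ 0 := by simpa using hm0
  let pt : ∀ ω η : F, ω * σ ω = μ → ω + σ ω + μ ≠ 0 → η + σ η = 1 → μ * (η * σ η) = 1 →
    UnitSphere F q := fun ω η h1 h2 h3 h4 => ⟨_, hmem ω η h1 h2 h3 h4⟩
  set P₂ : UnitSphere F q := ⟨![1, 0], by simp [hermNorm_two]⟩ with hP₂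
  set P₃ := pt ω η hω.1 hω.2 hη hμη with hP₃
  set P₄ := pt ω' η hω'.1 hω'.2 hη hμη with hP₄
  set P₅ := pt ω (σ η) hω.1 hω.2 hη' hμη' with hP₅
  set P₆ := pt ω' (σ η) hω'.1 hω'.2 hη' hμη' with hP₆
  -- the invariants of the points with respect to the Baer subplane
  have i2 : σ (P₂.1 0) - m * P₂.1 1 = 1 := by simp [hP₂]
  have i3 : σ (P₃.1 0) - m * P₃.1 1 = σ η := hinv ω η hω.1 hω.2 hη
  have i4 : σ (P₄.1 0) - m * P₄.1 1 = σ η := hinv ω' η hω'.1 hω'.2 hη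
  have i5 : σ (P₅.1 0) - m * P₅.1 1 = η := by
    rw [← conj_conj (q := q) η]
    exact hinv ω (σ η) hω.1 hω.2 hη'
  have i6 : σ (P₆.1 0) - m * P₆.1 1 = η := by
    rw [← conj_conj (q := q) η]
    exact hinv ω' (σ η) hω'.1 hω'.2 hη'
  have hpt_ne : ∀ {ω ω' η : F} (h1 h2 h3 h4 h1' h2'), ω ≠ ω' →
      pt ω η h1 h2 h3 h4 ≠ pt ω' η h1' h2' h3 h4 := by
    intro ω ω' η h1 h2 h3 h4 h1' h2' hne h
    rw [UnitSphere.ext_iff'] at h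
    obtain ⟨h0, h5⟩ := h
    have h0 : 1 + α ω η = 1 + α ω' η := h0
    have h5 : -σ m * (1 + ω) * α ω η = -σ m * (1 + ω') * α ω' η := h5
    have h0 := add_left_cancel h0
    rw [← h0] at h5
    have := mul_left_cancel₀ (neg_ne_zero.2 hσm0) (mul_right_cancel₀ (hα0 ω η h2 h3 h4) h5)
    exact hne (add_left_cancel this)
  have hpt_ne2 : ∀ {ω η : F} (h1 h2 h3 h4), P₂ ≠ pt ω η h1 h2 h3 h4 := by
    intro ω η h1 h2 h3 h4 h
    rw [UnitSphere.ext_iff'] at h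
    have h0 : 1 = 1 + α ω η := h.1
    exact hα0 ω η h2 h3 h4 (by linear_combination -h0)
  have n34 : P₃ ≠ P₄ := hpt_ne hω.1 hω.2 hη hμη hω'.1 hω'.2 hωω'
  have n56 : P₅ ≠ P₆ := hpt_ne hω.1 hω.2 hη' hμη' hω'.1 hω'.2 hωω'
  have n23 : P₂ ≠ P₃ := hpt_ne2 hω.1 hω.2 hη hμη
  have n24 : P₂ ≠ P₄ := hpt_ne2 hω'.1 hω'.2 hη hμη
  have n25 : P₂ ≠ P₅ := hpt_ne2 hω.1 hω.2 hη' hμη'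
  have n26 : P₂ ≠ P₆ := hpt_ne2 hω'.1 hω'.2 hη' hμη'
  have n35 : P₃ ≠ P₅ := fun h => hne (by rw [← i3, h, i5])
  have n36 : P₃ ≠ P₆ := fun h => hne (by rw [← i3, h, i6])
  have n45 : P₄ ≠ P₅ := fun h => hne (by rw [← i4, h, i5])
  have n46 : P₄ ≠ P₆ := fun h => hne (by rw [← i4, h, i6])
  have hη1 : η ≠ 1 := by
    rintro rfl
    simp at hne
  have hση1 : σ η ≠ 1 := by
    intro h
    apply hη1
    rw [← conj_conj (q := q) η, h, map_one]
  -- the two blocks through the point at infinity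
  let B : ∀ x : F, x ≠ 0 → OuterLine F q := fun x hx => ⟨![x, m * σ x],
    fun h => hx (congrFun h 0), by
      rw [hermNorm_eq_zero_of_eq_mul hcj ⟨m, hm⟩ (by simp)]
      exact zero_ne_one⟩
  have hB : ∀ (r : UnitSphere F q) x (hx : x ≠ 0),
      (unitalModel (conj F q)).inc (Sum.inl r) (some (Sum.inr (B x hx))) ↔
        σ (r.1 0) - m * r.1 1 = x := fun r x hx => mem_line_iff_mem_baer r ⟨m, hm⟩ x
  have hBinf : ∀ x (hx : x ≠ 0),
      (unitalModel (conj F q)).inc (Sum.inr ⟨m, hm⟩) (some (Sum.inr (B x hx))) := by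
    intro x hx
    simp [B]
  obtain ⟨b₃, ⟨h32, h33⟩, -⟩ := existsUnique_block_inl_inl (conj F q) n23
  obtain ⟨b₄, ⟨h42, h44⟩, -⟩ := existsUnique_block_inl_inl (conj F q) n24
  have hcol : ∀ {ω η η' : F} (h1 h2 h3 h4 h3' h4' b),
      (unitalModel (conj F q)).inc (Sum.inl P₂) b →
      (unitalModel (conj F q)).inc (Sum.inl (pt ω η h1 h2 h3 h4)) b →
      (unitalModel (conj F q)).inc (Sum.inl (pt ω η' h1 h2 h3' h4')) b := by
    intro ω η η' h1 h2 h3 h4 h3' h4' b hb hb'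
    have h5 := hα0 ω η h2 h3 h4
    refine inc_of_collinear _ hb hb' (α ω η' / α ω η) ?_ ?_
    · change 1 + α ω η' = 1 + α ω η' / α ω η * (1 + α ω η - 1)
      field_simp
      ring
    · change -σ m * (1 + ω) * α ω η' = 0 + α ω η' / α ω η * (-σ m * (1 + ω) * α ω η - 0)
      field_simp
      ring
  have h35 : (unitalModel (conj F q)).inc (Sum.inl P₅) b₃ := hcol hω.1 hω.2 hη hμη hη' hμη' _ h32 h33
  have h46 : (unitalModel (conj F q)).inc (Sum.inl P₆) b₄ := hcol hω'.1 hω'.2 hη hμη hη' hμη' _ h42 h44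
  have k3 := (hB P₃ _ hση0).2 i3
  have k4 := (hB P₄ _ hση0).2 i4
  have k12 : B (σ η) hση0 ≠ B η hη0 := fun h => hne (congrFun (congrArg Subtype.val h) 0)
  have k2 : ¬ (unitalModel (conj F q)).inc (Sum.inl P₂) (some (Sum.inr (B (σ η) hση0))) := by
    rw [hB P₂ _ hση0, i2]
    exact hση1.symm
  have k2' : ¬ (unitalModel (conj F q)).inc (Sum.inl P₂) (some (Sum.inr (B η hη0))) := by
    rw [hB P₂ _ hη0, i2]
    exact hη1.symm
  refine IncStr.not_antiPasch_of_nodup _ (p₁ := Sum.inr ⟨m, hm⟩) (p₂ := Sum.inl P₂)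
    (p₃ := Sum.inl P₃) (p₄ := Sum.inl P₄) (p₅ := Sum.inl P₅) (p₆ := Sum.inl P₆)
    (b₁ := some (Sum.inr (B (σ η) hση0))) (b₂ := some (Sum.inr (B η hη0))) (b₃ := b₃) (b₄ := b₄)
    ?_ ?_ ⟨hBinf _ hση0, k3, k4⟩
    ⟨hBinf _ hη0, (hB P₅ _ hη0).2 i5, (hB P₆ _ hη0).2 i6⟩
    ⟨h32, h33, h35⟩ ⟨h42, h44, h46⟩
  · simp only [List.nodup_cons, List.mem_cons, List.not_mem_nil, or_false, not_or,
      not_false_eq_true, List.nodup_nil, and_true, reduceCtorEq, Sum.inl.injEq]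
    exact ⟨trivial, ⟨n23, n24, n25, n26⟩, ⟨n34, n35, n36⟩, ⟨n45, n46⟩, n56⟩
  · simp only [List.nodup_cons, List.mem_cons, List.not_mem_nil, or_false, not_or,
      not_false_eq_true, List.nodup_nil, and_true]
    refine ⟨⟨by simpa using k12, ?_, ?_⟩, ⟨?_, ?_⟩, ?_⟩
    · rintro rfl
      exact k2 h32
    · rintro rfl
      exact k2 h42
    · rintro rfl
      exact k2' h32
    · rintro rfl
      exact k2' h42
    · rintro rfl
      have := (isSteiner_unitalModel hcj).block_eq (by simpa using n34) h33 h44 k3 k4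
      exact k2 (this ▸ h32)

end Twisted

section SpecialUnitary

variable {F : Type*} [Field F] [Finite F] {q : ℕ} [hF : Fact (Nat.card F = q ^ 2)]

local notation "σ" => conj F q

/-! ### The special unitary group -/

omit [Finite F] hF in
theorem mulVec_two (g : SU2 F q) (u : Fin 2 → F) :
    g.1.1.mulVec u = ![g.1.1 0 0 * u 0 + g.1.1 0 1 * u 1, g.1.1 1 0 * u 0 + g.1.1 1 1 * u 1] := by
  ext i
  fin_cases i <;> simp [Matrix.mulVec, dotProduct, Fin.sum_univ_two]

omit [Finite F] hF in
theorem mul_mulVec (g h : SU2 F q) (u : Fin 2 → F) :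
    (g * h).1.1.mulVec u = g.1.1.mulVec (h.1.1.mulVec u) := by
  rw [Matrix.mulVec_mulVec]
  rfl

omit [Finite F] hF in
theorem one_mulVec (u : Fin 2 → F) : (1 : SU2 F q).1.1.mulVec u = u :=
  Matrix.one_mulVec u

omit [Finite F] hF in
theorem inv_mulVec_mulVec (g : SU2 F q) (u : Fin 2 → F) :
    g⁻¹.1.1.mulVec (g.1.1.mulVec u) = u := by
  rw [← mul_mulVec, inv_mul_cancel, one_mulVec]

omit [Finite F] hF in
theorem mulVec_inv_mulVec (g : SU2 F q) (u : Fin 2 → F) :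
    g.1.1.mulVec (g⁻¹.1.1.mulVec u) = u := by
  rw [← mul_mulVec, mul_inv_cancel, one_mulVec]

omit [Finite F] hF in
theorem hermNorm_mulVec (g : SU2 F q) (u : Fin 2 → F) :
    hermNorm F q (g.1.1.mulVec u) = hermNorm F q u := g.2 u

omit [Finite F] hF in
theorem mulVec_ne_zero (g : SU2 F q) {u : Fin 2 → F} (hu : u ≠ 0) : g.1.1.mulVec u ≠ 0 := by
  intro h
  apply hu
  rw [← inv_mulVec_mulVec g u, h, Matrix.mulVec_zero]

/-- The elements of `SU(2, q)` are the matrices with rows `(a, b)` and `(-σ b, σ a)`, where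
`N a + N b = 1`. -/
theorem SU2_entries (g : SU2 F q) :
    g.1.1 0 0 * σ (g.1.1 0 0) + g.1.1 0 1 * σ (g.1.1 0 1) = 1 ∧
      g.1.1 1 0 = -σ (g.1.1 0 1) ∧ g.1.1 1 1 = σ (g.1.1 0 0) := by
  have hdet := g.1.2
  rw [Matrix.det_fin_two] at hdet
  have hN : ∀ x y : F, hermNorm F q (g.1.1.mulVec ![x, y]) = x * σ x + y * σ y := by
    intro x y
    rw [hermNorm_mulVec, hermNorm_two]
    rfl
  simp only [mulVec_two, hermNorm_two, Matrix.cons_val_zero, Matrix.cons_val_one] at hN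
  set a := g.1.1 0 0
  set b := g.1.1 0 1
  set c := g.1.1 1 0
  set d := g.1.1 1 1
  have h1 := hN 1 0
  have h2 := hN 0 1
  simp only [mul_one, mul_zero, add_zero, zero_add, map_one, map_zero] at h1 h2
  have h3 : a * σ b + c * σ d = 0 := by
    by_contra h
    obtain ⟨t, ht⟩ := exists_trace_mul_eq (q := q) (a := 1) h (map_one _)
    have h4 := hN t 1
    simp only [mul_one, map_one, map_add, map_mul, conj_conj] at h4 ht
    have : (1 : F) = 0 := by
      linear_combination h4 - ht - t * σ t * h1 - h2
    exact one_ne_zero this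
  have h3' := congrArg σ h3
  simp only [map_add, map_mul, conj_conj, map_zero] at h3'
  have h5 : d = σ a := by
    linear_combination (-d) * h1 + σ a * hdet + c * h3'
  have h6 : c = -σ b := by
    have : b = -σ c := by linear_combination (-b) * h1 - σ c * hdet + a * h3'
    rw [this]
    simp
  refine ⟨?_, h6, h5⟩
  rw [h6, map_neg, conj_conj] at h1
  linear_combination h1

theorem mulVec_one (g : SU2 F q) (u : Fin 2 → F) :
    g.1.1.mulVec u 1 = -σ (g.1.1 0 1) * u 0 + σ (g.1.1 0 0) * u 1 := by
  rw [mulVec_two, (SU2_entries g).2.1, (SU2_entries g).2.2]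
  rfl

omit [Finite F] hF in
theorem mulVec_zero' (g : SU2 F q) (u : Fin 2 → F) :
    g.1.1.mulVec u 0 = g.1.1 0 0 * u 0 + g.1.1 0 1 * u 1 := by
  rw [mulVec_two]
  rfl

variable (F q) in
/-- `SU(2, q)` acts regularly on the vectors of norm `1`. An element of `SU(2, q)` is identified with
its first row. -/
def rowEquiv : SU2 F q ≃ UnitSphere F q where
  toFun g := ⟨![g.1.1 0 0, g.1.1 0 1], by
    rw [hermNorm_two]
    exact (SU2_entries g).1⟩
  invFun r := ⟨⟨!![r.1 0, r.1 1; -σ (r.1 1), σ (r.1 0)], by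
    rw [Matrix.det_fin_two_of]
    linear_combination r.eq_one⟩, by
    intro v
    simp only [hermNorm_two, Matrix.mulVec, dotProduct, Fin.sum_univ_two, Matrix.of_apply,
      Matrix.cons_val_zero, Matrix.cons_val_one, map_add, map_mul, map_neg, conj_conj,
      Matrix.cons_val']
    linear_combination (v 0 * σ (v 0) + v 1 * σ (v 1)) * r.eq_one⟩
  left_inv g := by
    obtain ⟨-, h1, h2⟩ := SU2_entries g
    apply Subtype.ext
    apply Subtype.ext
    ext i j
    fin_cases i <;> fin_cases j
    · rfl
    · rfl
    · exact h1.symm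
    · exact h2.symm
  right_inv r := by
    rw [UnitSphere.ext_iff']
    exact ⟨rfl, rfl⟩

theorem rowEquiv_symm_mulVec (r : UnitSphere F q) (u : Fin 2 → F) :
    ((rowEquiv F q).symm r).1.1.mulVec u 0 = r.1 0 * u 0 + r.1 1 * u 1 :=
  mulVec_zero' _ _

theorem card_SU2 : Nat.card (SU2 F q) = q ^ 3 - q := by
  rw [Nat.card_congr (rowEquiv F q), ← card_unitSphere (F := F), Nat.add_sub_cancel]

theorem SU2_ext {g h : SU2 F q} (h0 : g.1.1 0 0 = h.1.1 0 0) (h1 : g.1.1 0 1 = h.1.1 0 1) :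
    g = h := by
  apply (rowEquiv F q).injective
  rw [UnitSphere.ext_iff']
  exact ⟨h0, h1⟩

theorem SU2_eq_one {g : SU2 F q} (h0 : g.1.1 0 0 = 1) (h1 : g.1.1 0 1 = 0) : g = 1 :=
  SU2_ext h0 h1

/-- Baer subplanes of isotropic vectors are invariant. -/
theorem mulVec_mem_baerSubplane (g : SU2 F q) {m : F} (hm : m * σ m = -1) {u : Fin 2 → F}
    (hu : u 1 = m * σ (u 0)) : g.1.1.mulVec u 1 = m * σ (g.1.1.mulVec u 0) := by
  rw [mulVec_one, mulVec_zero', hu]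
  simp only [map_add, map_mul, conj_conj]
  linear_combination (-σ (g.1.1 0 1) * u 0) * hm

/-- The action on the vectors of a given nonzero norm is regular. -/
theorem eq_of_mulVec_eq {g h : SU2 F q} {u : Fin 2 → F} (hu : hermNorm F q u ≠ 0)
    (heq : g.1.1.mulVec u = h.1.1.mulVec u) : g = h := by
  have h0 := congrFun heq 0
  have h1 := congrArg σ (congrFun heq 1)
  rw [mulVec_zero', mulVec_zero'] at h0
  rw [mulVec_one, mulVec_one] at h1
  simp only [map_add, map_mul, map_neg, conj_conj] at h1
  have hu' := hermNorm_two (q := q) u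
  apply SU2_ext
  · apply mul_right_cancel₀ hu
    rw [hu']
    linear_combination σ (u 0) * h0 + u 1 * h1
  · apply mul_right_cancel₀ hu
    rw [hu']
    linear_combination σ (u 1) * h0 - u 0 * h1

theorem exists_mulVec_eq {u w : Fin 2 → F} (hu : hermNorm F q u ≠ 0)
    (h : hermNorm F q u = hermNorm F q w) : ∃ g : SU2 F q, g.1.1.mulVec u = w := by
  have hu' := hermNorm_two (q := q) u
  have hw' := hermNorm_two (q := q) w
  have hσ := conj_hermNorm (q := q) u
  rw [← h] at hw'
  set n := hermNorm F q u
  refine ⟨(rowEquiv F q).symm ⟨![(w 0 * σ (u 0) + σ (w 1) * u 1) / n,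
    (w 0 * σ (u 1) - σ (w 1) * u 0) / n], ?_⟩, ?_⟩
  · rw [hermNorm_two]
    simp only [Matrix.cons_val_zero, Matrix.cons_val_one, map_div₀, map_add, map_sub, map_mul,
      conj_conj, hσ]
    field_simp
    linear_combination (-n) * hu' - (u 0 * σ (u 0) + u 1 * σ (u 1)) * hw'
  · ext i
    fin_cases i
    · simp only [Fin.zero_eta]
      rw [rowEquiv_symm_mulVec]
      simp only [Matrix.cons_val_zero, Matrix.cons_val_one]
      field_simp
      linear_combination (-w 0) * hu'
    · simp only [Fin.mk_one]
      rw [mulVec_one]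
      simp only [rowEquiv, Equiv.coe_fn_symm_mk, Matrix.of_apply, Matrix.cons_val_zero,
        Matrix.cons_val_one, Matrix.cons_val', map_div₀, map_add, map_sub, map_mul, conj_conj, hσ]
      field_simp
      linear_combination (-w 1) * hu'

theorem exists_mulVec_zero_eq_one {u : Fin 2 → F} (hu0 : u ≠ 0) (hu : hermNorm F q u = 0) :
    ∃ g : SU2 F q, g.1.1.mulVec u 0 = 1 := by
  obtain ⟨r, hr⟩ := exists_mem_line_of_isotropic hu0 hu
  exact ⟨(rowEquiv F q).symm r, by rw [rowEquiv_symm_mulVec, hr]⟩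

/-! ### Level sets in the special unitary group -/

variable (q) in
/-- The group elements that correspond to the vectors of norm `1` on the line `r • u = ε`. -/
def levelSet (u : Fin 2 → F) (ε : F) : Set (SU2 F q) := {g | g.1.1.mulVec u 0 = ε}

omit [Finite F] hF in
theorem mem_levelSet {u : Fin 2 → F} {ε : F} {g : SU2 F q} :
    g ∈ levelSet q u ε ↔ g.1.1.mulVec u 0 = ε := Iff.rfl

theorem ncard_levelSet (u : Fin 2 → F) (ε : F) : (levelSet q u ε).ncard =
    {r : UnitSphere F q | r.1 0 * u 0 + r.1 1 * u 1 = ε}.ncard := by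
  rw [← Set.ncard_image_of_injective _ (rowEquiv F q).symm.injective]
  congr 1
  ext g
  obtain ⟨r, rfl⟩ := (rowEquiv F q).symm.surjective g
  rw [mem_levelSet, rowEquiv_symm_mulVec]
  simp

omit [Finite F] hF in
theorem rightTranslate_levelSet (u : Fin 2 → F) (ε : F) (g : SU2 F q) :
    rightTranslate (levelSet q u ε) g = levelSet q (g⁻¹.1.1.mulVec u) ε := by
  ext x
  simp only [rightTranslate, Set.mem_image, mem_levelSet]
  constructor
  · rintro ⟨y, hy, rfl⟩
    rw [mul_mulVec, mulVec_inv_mulVec, hy]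
  · intro hx
    exact ⟨x * g⁻¹, by rw [mul_mulVec, hx], by simp⟩

omit [Finite F] hF in
theorem levelSet_smul (u : Fin 2 → F) (ε : F) {c : F} (hc : c ≠ 0) :
    levelSet q (c • u) (c * ε) = levelSet q u ε := by
  ext x
  rw [mem_levelSet, mem_levelSet, Matrix.mulVec_smul, Pi.smul_apply, smul_eq_mul,
    mul_right_inj' hc]

theorem one_lt_ncard_levelSet {u : Fin 2 → F} (hu0 : u ≠ 0) (hu : hermNorm F q u ≠ 1) :
    1 < (levelSet q u 1).ncard := by
  have hq := one_lt_of_card_eq_sq F q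
  rw [ncard_levelSet]
  by_cases h : hermNorm F q u = 0
  · rw [ncard_line_of_isotropic hu0 h]
    exact hq
  · rw [ncard_line_of_hermNorm_ne_zero h (by simp) (by simpa using hu.symm)]
    omega

theorem levelSet_injective {u w : Fin 2 → F} (hu0 : u ≠ 0) (hu : hermNorm F q u ≠ 1)
    (hw0 : w ≠ 0) (hw : hermNorm F q w ≠ 1) (h : levelSet q u 1 = levelSet q w 1) : u = w := by
  obtain ⟨g, hg, g', hg', hne⟩ := (Set.one_lt_ncard (s := levelSet q u 1)).1
    (one_lt_ncard_levelSet hu0 hu)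
  have hg2 := hg
  have hg2' := hg'
  rw [h] at hg2 hg2'
  obtain ⟨r, rfl⟩ := (rowEquiv F q).symm.surjective g
  obtain ⟨r', rfl⟩ := (rowEquiv F q).symm.surjective g'
  rw [mem_levelSet, rowEquiv_symm_mulVec] at hg hg' hg2 hg2'
  have hne' : (Sum.inl r : UnitSphere F q ⊕ NegOneNorm F q) ≠ Sum.inl r' := by
    rintro h
    exact hne (by rw [Sum.inl.inj h])
  have := (isSteiner_unitalModel (q := q) (τ := RingHom.id F) (fun _ => rfl)).block_eq hne'
    (b := some (Sum.inr ⟨u, hu0, hu⟩)) (b' := some (Sum.inr ⟨w, hw0, hw⟩)) hg hg' hg2 hg2'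
  simpa using this

/-! ### The subgroups and the sets of the construction -/

variable (F q) in
/-- The diagonal subgroup. -/
def diagonalSubgroup : Subgroup (SU2 F q) where
  carrier := levelSet q ![0, 1] 0
  one_mem' := by simp [mem_levelSet]
  mul_mem' := by
    intro g h hg hh
    rw [mem_levelSet, mulVec_zero'] at hg hh ⊢
    simp only [Matrix.cons_val_zero, Matrix.cons_val_one, mul_zero, zero_add, mul_one] at hg hh ⊢
    change (g.1.1 * h.1.1) 0 1 = 0
    rw [Matrix.mul_apply, Fin.sum_univ_two, hg, hh]
    ring
  inv_mem' := by
    intro g hg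
    rw [mem_levelSet, mulVec_zero'] at hg ⊢
    simp only [Matrix.cons_val_zero, Matrix.cons_val_one, mul_zero, zero_add, mul_one] at hg ⊢
    change (g.1⁻¹).1 0 1 = 0
    rw [Matrix.SpecialLinearGroup.coe_inv, Matrix.adjugate_fin_two]
    simp [hg]

variable (q) in
/-- The stabilizer of the vector `(1, m)`. If `m` has norm `-1`, so that the vector is isotropic, this
is a group of transvections. -/
def transvectionSubgroup (m : F) : Subgroup (SU2 F q) where
  carrier := {g | g.1.1.mulVec ![1, m] = ![1, m]}
  one_mem' := one_mulVec _
  mul_mem' := by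
    intro g h hg hh
    rw [Set.mem_ofPred_eq] at hg hh ⊢
    rw [mul_mulVec, hh, hg]
  inv_mem' := by
    intro g hg
    rw [Set.mem_ofPred_eq] at hg ⊢
    rw [← hg, inv_mulVec_mulVec, hg]

omit [Finite F] hF in
theorem mem_transvectionSubgroup {m : F} {g : SU2 F q} :
    g ∈ transvectionSubgroup q m ↔ g.1.1.mulVec ![1, m] = ![1, m] := Iff.rfl

theorem coe_transvectionSubgroup {m : F} (hm : m * σ m = -1) :
    (transvectionSubgroup q m : Set (SU2 F q)) = levelSet q ![1, m] 1 := by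
  ext g
  rw [SetLike.mem_coe, mem_transvectionSubgroup, mem_levelSet]
  constructor
  · intro h
    rw [h]
    rfl
  · intro h
    have := mulVec_mem_baerSubplane g hm (u := ![1, m]) (by simp)
    rw [h, map_one, mul_one] at this
    ext i
    fin_cases i
    · exact h
    · exact this

theorem hermNorm_one_eq {m : F} : hermNorm F q ![1, m] = 1 + m * σ m := by
  simp [hermNorm_two]

omit [Finite F] hF [Field F] in
theorem one_vec_ne_zero [Field F] (m : F) : ![1, m] ≠ 0 := by
  intro h
  simpa using congrFun h 0

omit [Finite F] hF in
theorem mem_conjSubgroup {G : Type*} [Group G] {T : Subgroup G} {g h : G} :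
    g ∈ conjSubgroup T h ↔ h * g * h⁻¹ ∈ T := by
  rw [conjSubgroup, Subgroup.mem_map]
  constructor
  · rintro ⟨t, ht, rfl⟩
    simpa [mul_assoc] using ht
  · intro hg
    exact ⟨_, hg, by simp [mul_assoc]⟩

/-- The conjugates of a group of transvections are the groups of transvections of the various
isotropic directions. -/
theorem mem_conjClass_iff (m₀ : NegOneNorm F q) (C : Subgroup (SU2 F q)) :
    C ∈ conjClass (transvectionSubgroup q m₀.1) ↔
      ∃ m : NegOneNorm F q, C = transvectionSubgroup q m.1 := by
  have key : ∀ (h : SU2 F q) (m : F) (z : F), z ≠ 0 → h.1.1.mulVec ![1, m] = z • ![1, m₀.1] →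
      conjSubgroup (transvectionSubgroup q m₀.1) h = transvectionSubgroup q m := by
    intro h m z hz hh
    have hh' : ![1, m₀.1] = z⁻¹ • h.1.1.mulVec ![1, m] := by rw [hh, inv_smul_smul₀ hz]
    ext g
    rw [mem_conjSubgroup, mem_transvectionSubgroup, mem_transvectionSubgroup, hh',
      Matrix.mulVec_smul, mul_mulVec, mul_mulVec, inv_mulVec_mulVec]
    constructor
    · intro h1
      have := smul_right_injective _ (inv_ne_zero hz) h1
      rw [← inv_mulVec_mulVec h (g.1.1.mulVec ![1, m]), this, inv_mulVec_mulVec]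
    · intro h1
      rw [h1]
  have hm0 : ∀ m : NegOneNorm F q, hermNorm F q ![1, m.1] = 0 := by
    intro m
    rw [hermNorm_one_eq, m.2]
    ring
  constructor
  · rintro ⟨h, rfl⟩
    set w := h⁻¹.1.1.mulVec ![1, m₀.1] with hw
    have hw0 : w ≠ 0 := mulVec_ne_zero _ (one_vec_ne_zero _)
    obtain ⟨m, hm, -⟩ := existsUnique_slope (q := q) (τ := RingHom.id F) (fun _ => rfl) hw0
      (by rw [hw, hermNorm_mulVec, hm0])
    have hm : w 1 = m.1 * w 0 := hm
    have hw00 : w 0 ≠ 0 := by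
      intro h0
      apply hw0
      ext i
      fin_cases i
      · exact h0
      · simp [hm, h0]
    refine ⟨m, key h m.1 (w 0)⁻¹ (inv_ne_zero hw00) ?_⟩
    have : ![1, m.1] = (w 0)⁻¹ • w := by
      ext i
      fin_cases i
      · simp [hw00]
      · simp [hm]
        field_simp
    rw [this, Matrix.mulVec_smul, hw, mulVec_inv_mulVec]
  · rintro ⟨m, rfl⟩
    obtain ⟨z, hz, hz'⟩ := exists_eq_mul_conj (q := q) (g := m.1 / m₀.1) (by
      rw [map_div₀, div_mul_div_comm, m.2, m₀.2]
      norm_num)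
    obtain ⟨h, hh⟩ := exists_mulVec_zero_eq_one (q := q) (u := z⁻¹ • ![1, m.1])
      (smul_ne_zero (inv_ne_zero hz) (one_vec_ne_zero _)) (by rw [hermNorm_smul, hm0, mul_zero])
    refine ⟨h, (key h m.1 z hz ?_).symm⟩
    rw [Matrix.mulVec_smul, Pi.smul_apply, smul_eq_mul, inv_mul_eq_iff_eq_mul₀ hz, mul_one] at hh
    have h1 := mulVec_mem_baerSubplane h m.2 (u := ![1, m.1]) (by simp)
    rw [hh] at h1
    ext i
    fin_cases i
    · simpa using hh
    · have hm₀ := m₀.ne_zero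
      simp only [Fin.mk_one, Pi.smul_apply, Matrix.cons_val_one, smul_eq_mul]
      rw [h1]
      rw [div_mul_eq_mul_div, eq_div_iff hm₀] at hz'
      exact hz'.symm

theorem card_transvectionSubgroup (m : NegOneNorm F q) :
    Nat.card (transvectionSubgroup q m.1) = q := by
  have : Nat.card (transvectionSubgroup q m.1) =
    (transvectionSubgroup q m.1 : Set (SU2 F q)).ncard := rfl
  rw [this, coe_transvectionSubgroup m.2, ncard_levelSet,
    ncard_line_of_isotropic (one_vec_ne_zero _)]
  rw [hermNorm_one_eq, m.2]
  ring

theorem transvectionSubgroup_inf_eq_bot {m m' : F} (hne : m ≠ m') :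
    transvectionSubgroup q m ⊓ transvectionSubgroup q m' = ⊥ := by
  rw [eq_bot_iff]
  rintro g ⟨h, h'⟩
  have h := congrFun (mem_transvectionSubgroup.1 h) 0
  have h' := congrFun (mem_transvectionSubgroup.1 h') 0
  rw [mulVec_zero'] at h h'
  simp only [Matrix.cons_val_zero, Matrix.cons_val_one, mul_one] at h h'
  have hb : g.1.1 0 1 = 0 := by
    apply mul_right_cancel₀ (sub_ne_zero.2 hne)
    linear_combination h - h'
  rw [Subgroup.mem_bot]
  refine SU2_eq_one ?_ hb
  rwa [hb, zero_mul, add_zero] at h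

theorem transvectionSubgroup_injective {m m' : NegOneNorm F q}
    (h : transvectionSubgroup q m.1 = transvectionSubgroup q m'.1) : m = m' := by
  by_contra hne
  have h1 := transvectionSubgroup_inf_eq_bot (q := q) (fun h => hne (Subtype.ext h) : m.1 ≠ m'.1)
  rw [← h, inf_idem] at h1
  have h2 := card_transvectionSubgroup m
  rw [h1, Subgroup.card_bot] at h2
  have := one_lt_of_card_eq_sq F q
  omega

variable (q) in
open Classical in
/-- A solution `y` of `y ^ (q + 1) = b`. -/
noncomputable def normRoot (b : F) : F := if h : ∃ y, y * σ y = b then h.choose else 0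

theorem normRoot_spec {b : F} (hb : σ b = b) : normRoot q b * σ (normRoot q b) = b := by
  rw [normRoot, dif_pos (exists_mul_conj_eq hb)]
  exact (exists_mul_conj_eq hb).choose_spec

variable (F q) in
/-- The parameters of the remaining orbits of `SU(2, q)` on the secants. -/
def orbitParameters : Set F := {b | σ b = b ∧ b ≠ 0 ∧ b ≠ -1}

variable (F q) in
/-- Representatives of the orbits of `SU(2, q)` on the secants of non-isotropic direction not through
the origin. Each contains `1`, that is, the vector `(1, 0)` lies on the secant. -/
def secantFamily : Set (Set (SU2 F q)) :=
  (fun b => levelSet q ![1, normRoot q b] 1) '' orbitParameters F q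

theorem hermNorm_normRoot {b : F} (hb : σ b = b) :
    hermNorm F q ![1, normRoot q b] = 1 + b := by
  rw [hermNorm_one_eq, normRoot_spec hb]

theorem ncard_orbitParameters : (orbitParameters F q).ncard = q - 2 := by
  have h : orbitParameters F q = {b : F | σ b = b} \ {0, -1} := by
    ext b
    simp [orbitParameters]
  rw [h, Set.ncard_sdiff, ncard_fixed, Set.ncard_pair]
  · exact (neg_ne_zero.2 one_ne_zero).symm
  · rintro b (rfl | rfl) <;> simp

/-- If `1` and `g` are on a common secant `r • u = 1`, then `u = (1, t)` where `t` is this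
invariant. It vanishes on the diagonal subgroup, by the convention for division by zero. -/
def secantInvariant (g : SU2 F q) : F := (1 - g.1.1 0 0) / g.1.1 0 1

theorem secantInvariant_eq_zero_iff {g : SU2 F q} :
    secantInvariant g = 0 ↔ g.1.1 0 1 = 0 := by
  rw [secantInvariant, div_eq_zero_iff, or_iff_right_of_imp]
  intro h
  have := (SU2_entries g).1
  rw [← sub_eq_zero.1 h] at this
  simpa using this

theorem secantInvariant_eq_iff {g : SU2 F q} (hg : g ≠ 1) {t : F} (ht : t ≠ 0) :
    secantInvariant g = t ↔ g.1.1.mulVec ![1, t] 0 = 1 := by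
  rw [mulVec_zero']
  simp only [Matrix.cons_val_zero, Matrix.cons_val_one, mul_one]
  constructor
  · intro h
    have hb : g.1.1 0 1 ≠ 0 := fun hb => ht (h ▸ secantInvariant_eq_zero_iff.2 hb)
    rw [secantInvariant, div_eq_iff hb] at h
    linear_combination -h
  · intro h
    have hb : g.1.1 0 1 ≠ 0 := by
      intro hb
      rw [hb, zero_mul, add_zero] at h
      exact hg (SU2_eq_one h hb)
    rw [secantInvariant, div_eq_iff hb]
    linear_combination -h

omit [Finite F] in
theorem eq_vec_of_zero_eq_one {w : Fin 2 → F} (h : w 0 = 1) : w = ![1, w 1] := by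
  ext i
  fin_cases i
  · exact h
  · rfl

theorem mem_quotientSet_iff {b : F} (hb : b ∈ orbitParameters F q) {g : SU2 F q} :
    g ∈ quotientSet (levelSet q ![1, normRoot q b] 1) ↔
      g ≠ 1 ∧ secantInvariant g * σ (secantInvariant g) = b := by
  obtain ⟨hb1, hb2, hb3⟩ := hb
  have hN := hermNorm_normRoot hb1
  constructor
  · rintro ⟨x, hx, y, hy, hne, rfl⟩
    have hg : x * y⁻¹ ≠ 1 := fun h => hne (mul_inv_eq_one.1 h)
    refine ⟨hg, ?_⟩
    set w := y.1.1.mulVec ![1, normRoot q b] with hw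
    have hw1 : w = ![1, w 1] := eq_vec_of_zero_eq_one hy
    have hwN : w 1 * σ (w 1) = b := by
      have : hermNorm F q w = 1 + b := by rw [hw, hermNorm_mulVec, hN]
      rw [hw1, hermNorm_one_eq] at this
      exact add_left_cancel this
    have ht : w 1 ≠ 0 := by
      intro h
      rw [h] at hwN
      simp at hwN
      exact hb2 hwN.symm
    have : secantInvariant (x * y⁻¹) = w 1 := by
      rw [secantInvariant_eq_iff hg ht, ← hw1, mul_mulVec, hw, inv_mulVec_mulVec]
      exact hx
    rw [this, hwN]
  · rintro ⟨hg, hgb⟩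
    set t := secantInvariant g with ht
    have ht0 : t ≠ 0 := by
      intro h
      rw [h] at hgb
      simp at hgb
      exact hb2 hgb.symm
    have h1 := (secantInvariant_eq_iff hg ht0).1 ht.symm
    obtain ⟨y, hy⟩ := exists_mulVec_eq (q := q) (u := ![1, normRoot q b]) (w := ![1, t])
      (by
        rw [hN]
        intro h
        exact hb3 (by linear_combination h))
      (by rw [hN, hermNorm_one_eq, hgb])
    refine ⟨g * y, ?_, y, ?_, ?_, by simp⟩
    · rw [mem_levelSet, mul_mulVec, hy, h1]
    · rw [mem_levelSet, hy]
      rfl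
    · simpa using hg

open Classical in
/-- The members of the partition are the fibres of a function on the nontrivial elements. -/
theorem exists_fibre_of_mem_partitionSystem (m₀ : NegOneNorm F q) {X : Set (SU2 F q)}
    (hX : X ∈ partitionSystem (transvectionSubgroup q m₀.1) (diagonalSubgroup F q)
      (secantFamily F q)) :
    ∃ i : F × F, X = {g | g ≠ 1 ∧ (secantInvariant g * σ (secantInvariant g),
      if secantInvariant g * σ (secantInvariant g) = -1 then secantInvariant g else 0) = i} := by
  rcases hX with rfl | ⟨C, hC, rfl⟩ | ⟨D, ⟨b, hb, rfl⟩, rfl⟩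
  · refine ⟨(0, 0), ?_⟩
    ext g
    have h1 : g ∈ (diagonalSubgroup F q : Set (SU2 F q)) ↔ secantInvariant g = 0 := by
      rw [secantInvariant_eq_zero_iff]
      change g.1.1.mulVec ![0, 1] 0 = 0 ↔ _
      rw [mulVec_zero']
      simp
    rw [Set.mem_sdiff, h1, and_comm]
    refine and_congr Iff.rfl ⟨fun h => by simp [h], fun h => ?_⟩
    simpa using congrArg Prod.fst h
  · obtain ⟨m, rfl⟩ := (mem_conjClass_iff m₀ C).1 hC
    refine ⟨(-1, m.1), ?_⟩
    ext g
    rw [Set.mem_sdiff, coe_transvectionSubgroup m.2, mem_levelSet, and_comm]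
    refine and_congr_right fun hg => ?_
    rw [← secantInvariant_eq_iff hg m.ne_zero]
    constructor
    · rintro h
      rw [h, if_pos m.2, m.2]
    · intro h
      rw [Prod.mk.injEq] at h
      rw [if_pos h.1] at h
      exact h.2
  · refine ⟨(b, 0), ?_⟩
    ext g
    rw [mem_quotientSet_iff hb]
    refine and_congr_right fun hg => ⟨fun h => ?_, fun h => congrArg Prod.fst h⟩
    rw [h, if_neg hb.2.2]

theorem isGSVSystem (m₀ : NegOneNorm F q) :
    IsGSVSystem q (transvectionSubgroup q m₀.1) (diagonalSubgroup F q) (secantFamily F q) where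
  card_group := card_SU2
  card_T := card_transvectionSubgroup m₀
  trivial_intersection C hC C' hC' hne := by
    obtain ⟨m, rfl⟩ := (mem_conjClass_iff m₀ C).1 hC
    obtain ⟨m', rfl⟩ := (mem_conjClass_iff m₀ C').1 hC'
    exact transvectionSubgroup_inf_eq_bot fun h => hne (by rw [h])
  card_S := by
    change (levelSet q ![0, 1] (0 : F)).ncard = q + 1
    have h : hermNorm F q ![(0 : F), 1] = 1 := by simp [hermNorm_two]
    rw [ncard_levelSet, ncard_line_of_hermNorm_ne_zero] <;> simp [h]
  one_mem := by
    rintro _ ⟨b, hb, rfl⟩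
    simp [mem_levelSet]
  card_mem := by
    rintro _ ⟨b, hb, rfl⟩
    have h := hermNorm_normRoot hb.1
    rw [ncard_levelSet, ncard_line_of_hermNorm_ne_zero _ (by simp)]
    · rw [h]
      simpa using hb.2.1
    · rw [h]
      intro h'
      exact hb.2.2 (by linear_combination h')
  card_system := by
    rw [secantFamily, Set.InjOn.ncard_image, ncard_orbitParameters]
    intro b hb b' hb' h
    have hq := one_lt_of_card_eq_sq F q
    -- a member of the family has a nontrivial quotient, whose invariant determines the parameter
    obtain ⟨g, hg, g', hg', hne⟩ := (Set.one_lt_ncard (s := levelSet q ![1, normRoot q b] 1)).1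
      (one_lt_ncard_levelSet (one_vec_ne_zero _) (by
        rw [hermNorm_normRoot hb.1]
        simpa using hb.2.1))
    have h1 : g * g'⁻¹ ∈ quotientSet (levelSet q ![1, normRoot q b] 1) :=
      ⟨g, hg, g', hg', hne, rfl⟩
    have h2 := h1
    simp only at h
    rw [h] at h2
    rw [mem_quotientSet_iff hb] at h1
    rw [mem_quotientSet_iff hb'] at h2
    exact h1.2.symm.trans h2.2
  injective_quotient := by
    rintro _ ⟨b, hb, rfl⟩ x hx y hy x' hx' y' hy' hne hne' heq
    have hN := hermNorm_normRoot hb.1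
    have hg : x * y⁻¹ ≠ 1 := fun h => hne (mul_inv_eq_one.1 h)
    have key : ∀ x y : SU2 F q, x ∈ levelSet q ![1, normRoot q b] 1 →
        y ∈ levelSet q ![1, normRoot q b] 1 → x * y⁻¹ ≠ 1 →
        y.1.1.mulVec ![1, normRoot q b] = ![1, secantInvariant (x * y⁻¹)] := by
      intro x y hx hy hg
      set w := y.1.1.mulVec ![1, normRoot q b] with hw
      have hw1 : w = ![1, w 1] := eq_vec_of_zero_eq_one hy
      have ht : w 1 ≠ 0 := by
        intro h
        have : hermNorm F q w = 1 + b := by rw [hw, hermNorm_mulVec, hN]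
        rw [hw1, hermNorm_one_eq, h] at this
        simp at this
        exact hb.2.1 this
      have : secantInvariant (x * y⁻¹) = w 1 := by
        rw [secantInvariant_eq_iff hg ht, ← hw1, mul_mulVec, hw, inv_mulVec_mulVec]
        exact hx
      rw [this]
      exact hw1
    have hy' : y = y' := by
      apply eq_of_mulVec_eq (q := q) (u := ![1, normRoot q b])
      · rw [hN]
        intro h'
        exact hb.2.2 (by linear_combination h')
      · rw [key x y hx hy hg, key x' y' hx' hy' (heq ▸ hg), heq]
    subst hy'
    exact ⟨mul_right_cancel heq, rfl⟩
  pairwiseDisjoint := by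
    intro X hX Y hY hne
    obtain ⟨i, hi⟩ := exists_fibre_of_mem_partitionSystem m₀ hX
    obtain ⟨j, hj⟩ := exists_fibre_of_mem_partitionSystem m₀ hY
    rw [Function.onFun, id, id, Set.disjoint_left]
    intro g hg hg'
    rw [hi] at hg
    rw [hj] at hg'
    apply hne
    rw [hi, hj, ← hg.2, ← hg'.2]
  sUnion_eq := by
    ext g
    constructor
    · rintro ⟨X, hX, hg⟩
      obtain ⟨i, rfl⟩ := exists_fibre_of_mem_partitionSystem m₀ hX
      exact hg.1
    · intro hg
      have hg : g ≠ 1 := hg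
      by_cases h0 : secantInvariant g = 0
      · refine ⟨_, Or.inl rfl, ?_, hg⟩
        change g.1.1.mulVec ![0, 1] 0 = 0
        rw [mulVec_zero', secantInvariant_eq_zero_iff.1 h0]
        simp
      by_cases h1 : secantInvariant g * σ (secantInvariant g) = -1
      · refine ⟨_, Or.inr (Or.inl ⟨_, (mem_conjClass_iff m₀ _).2 ⟨⟨_, h1⟩, rfl⟩, rfl⟩), ?_, hg⟩
        rw [coe_transvectionSubgroup h1, mem_levelSet, ← secantInvariant_eq_iff hg h0]
      · have hb : secantInvariant g * σ (secantInvariant g) ∈ orbitParameters F q :=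
          ⟨by rw [map_mul, conj_conj, mul_comm], by simp [h0], h1⟩
        exact ⟨_, Or.inr (Or.inr ⟨_, ⟨_, hb, rfl⟩, rfl⟩), (mem_quotientSet_iff hb).2 ⟨hg, rfl⟩⟩

/-! ### The two unitals of the construction -/

/-- The affine blocks of the construction are the secants. -/
theorem mem_gsvBlocks_iff (m₀ : NegOneNorm F q) (X : Set (SU2 F q)) :
    X ∈ gsvBlocks (transvectionSubgroup q m₀.1) (diagonalSubgroup F q) (secantFamily F q) ↔
      (∃ u, hermNorm F q u ≠ 0 ∧ X = levelSet q u 0) ∨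
        ∃ u, u ≠ 0 ∧ hermNorm F q u ≠ 1 ∧ X = levelSet q u 1 := by
  constructor
  · rintro (⟨g, rfl⟩ | ⟨C, hC, g, rfl⟩ | ⟨_, ⟨b, hb, rfl⟩, g, rfl⟩)
    · left
      refine ⟨_, ?_, rightTranslate_levelSet ![0, 1] 0 g⟩
      rw [hermNorm_mulVec]
      simp [hermNorm_two]
    · right
      obtain ⟨m, rfl⟩ := (mem_conjClass_iff m₀ C).1 hC
      refine ⟨_, mulVec_ne_zero g⁻¹ (one_vec_ne_zero m.1), ?_, ?_⟩
      · rw [hermNorm_mulVec, hermNorm_one_eq, m.2]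
        simp
      · rw [coe_transvectionSubgroup m.2, rightTranslate_levelSet]
    · right
      refine ⟨_, mulVec_ne_zero g⁻¹ (one_vec_ne_zero _), ?_, rightTranslate_levelSet _ 1 g⟩
      rw [hermNorm_mulVec, hermNorm_normRoot hb.1]
      simpa using hb.2.1
  · rintro (⟨u, hu, rfl⟩ | ⟨u, hu0, hu1, rfl⟩)
    · left
      have hσ := conj_hermNorm (q := q) u
      obtain ⟨c, hc⟩ := exists_mul_conj_eq (F := F) (q := q) (a := (hermNorm F q u)⁻¹)
        (by rw [map_inv₀, hσ])
      have hc0 : c ≠ 0 := by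
        rintro rfl
        simp at hc
        exact hu hc.symm
      have h1 : hermNorm F q (c • u) = 1 := by
        rw [hermNorm_smul, hc, inv_mul_cancel₀ hu]
      obtain ⟨g, hg⟩ := exists_mulVec_eq (q := q) (u := c • u) (w := ![0, 1]) (by simp [h1])
        (by rw [h1]; simp [hermNorm_two])
      refine ⟨g, ?_⟩
      rw [← levelSet_smul u 0 hc0, mul_zero]
      refine Eq.trans ?_ (rightTranslate_levelSet ![0, 1] 0 g).symm
      rw [← hg, inv_mulVec_mulVec]
    · right
      by_cases hu : hermNorm F q u = 0
      · left
        obtain ⟨m, hm, -⟩ := existsUnique_slope (τ := conj F q) norm_conj_conj hu0 hu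
        obtain ⟨g, hg⟩ := exists_mulVec_zero_eq_one hu0 hu
        refine ⟨_, (mem_conjClass_iff m₀ _).2 ⟨m, rfl⟩, g, ?_⟩
        have h1 := mulVec_mem_baerSubplane g m.2 hm
        rw [hg, map_one, mul_one] at h1
        rw [coe_transvectionSubgroup m.2, rightTranslate_levelSet, ← h1,
          ← eq_vec_of_zero_eq_one hg, inv_mulVec_mulVec]
      · right
        have hσ := conj_hermNorm (q := q) u
        have hb : hermNorm F q u - 1 ∈ orbitParameters F q :=
          ⟨by rw [map_sub, hσ, map_one], sub_ne_zero.2 hu1, fun h => hu (by linear_combination h)⟩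
        obtain ⟨g, hg⟩ := exists_mulVec_eq (q := q) (u := u)
          (w := ![1, normRoot q (hermNorm F q u - 1)]) hu
          (by rw [hermNorm_normRoot hb.1]; ring)
        refine ⟨_, ⟨_, hb, rfl⟩, g, ?_⟩
        simp only
        rw [rightTranslate_levelSet, ← hg, inv_mulVec_mulVec]

theorem leftTranslate_transvectionSubgroup {m : F} (hm : m * σ m = -1) (g : SU2 F q) :
    ∃ z, z ≠ 0 ∧ g.1.1.mulVec ![1, m] 0 = z ∧
      leftTranslate g (transvectionSubgroup q m : Set (SU2 F q)) =
        levelSet q (z⁻¹ • ![1, m]) 1 := by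
  have h1 : ∀ g : SU2 F q, g.1.1.mulVec ![1, m] 1 = m * σ (g.1.1.mulVec ![1, m] 0) := fun g =>
    mulVec_mem_baerSubplane g hm (u := ![1, m]) (by simp)
  have hz : g.1.1.mulVec ![1, m] 0 ≠ 0 := by
    intro hz
    apply mulVec_ne_zero g (one_vec_ne_zero m)
    ext i
    fin_cases i
    · exact hz
    · simp [h1, hz]
  refine ⟨_, hz, rfl, ?_⟩
  ext x
  rw [mem_levelSet, Matrix.mulVec_smul, Pi.smul_apply, smul_eq_mul, inv_mul_eq_iff_eq_mul₀ hz,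
    mul_one]
  simp only [leftTranslate, Set.mem_image, SetLike.mem_coe, mem_transvectionSubgroup]
  constructor
  · rintro ⟨t, ht, rfl⟩
    rw [mul_mulVec, ht]
  · intro hx
    refine ⟨g⁻¹ * x, ?_, by simp⟩
    have : x.1.1.mulVec ![1, m] = g.1.1.mulVec ![1, m] := by
      ext i
      fin_cases i
      · exact hx
      · simp only [Fin.mk_one]
        rw [h1, h1, hx]
    rw [mul_mulVec, this, inv_mulVec_mulVec]

theorem ncard_translate (m : NegOneNorm F q) (g : SU2 F q) :
    (leftTranslate g (transvectionSubgroup q m.1 : Set (SU2 F q))).ncard = q ∧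
      (rightTranslate (transvectionSubgroup q m.1 : Set (SU2 F q)) g).ncard = q := by
  constructor
  · rw [leftTranslate, Set.ncard_image_of_injective _ (mul_right_injective g)]
    exact card_transvectionSubgroup m
  · rw [rightTranslate, Set.ncard_image_of_injective _ (mul_left_injective g)]
    exact card_transvectionSubgroup m

theorem ncard_levelSet_zero {u : Fin 2 → F} (hu : hermNorm F q u ≠ 0) :
    (levelSet q u 0).ncard = q + 1 := by
  rw [ncard_levelSet, ncard_line_of_hermNorm_ne_zero hu (by simp) (by simpa using hu.symm)]

/-- The isotropic lines that are left cosets of the conjugate with parameter `m` are those that are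
attached to `m` in the model of the Hermitian unital. -/
theorem exists_leftTranslate_iff (m : NegOneNorm F q) {u : Fin 2 → F} (hu0 : u ≠ 0)
    (hu1 : hermNorm F q u ≠ 1) :
    (∃ g, levelSet q u 1 = leftTranslate g (transvectionSubgroup q m.1 : Set (SU2 F q))) ↔
      u 1 = m.1 * u 0 := by
  have hm0 : hermNorm F q ![1, m.1] = 0 := by
    rw [hermNorm_one_eq, m.2]
    ring
  constructor
  · rintro ⟨g, hg⟩
    obtain ⟨z, hz, -, h⟩ := leftTranslate_transvectionSubgroup m.2 g
    rw [h] at hg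
    rw [levelSet_injective hu0 hu1 (smul_ne_zero (inv_ne_zero hz) (one_vec_ne_zero _))
      (by rw [hermNorm_smul, hm0, mul_zero]; exact zero_ne_one) hg]
    simp [mul_comm]
  · intro h
    have hu : hermNorm F q u = 0 :=
      hermNorm_eq_zero_of_eq_mul (τ := RingHom.id F) (fun _ => rfl) m h
    obtain ⟨g, hg⟩ := exists_mulVec_zero_eq_one hu0 hu
    have hu00 : u 0 ≠ 0 := by
      intro h0
      apply hu0
      ext i
      fin_cases i
      · exact h0
      · simp [h, h0]
    have hu' : u = u 0 • ![1, m.1] := by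
      ext i
      fin_cases i
      · simp
      · simp [h, mul_comm]
    obtain ⟨z, hz, hgz, hgz'⟩ := leftTranslate_transvectionSubgroup m.2 g
    refine ⟨g, ?_⟩
    rw [hgz']
    rw [hu', Matrix.mulVec_smul, Pi.smul_apply, hgz, smul_eq_mul] at hg
    rw [← eq_inv_of_mul_eq_one_left hg, ← hu']

/-- The isotropic lines that are right cosets of the conjugate with parameter `m` are those that are
attached to `m` in the twisted model, because `SU(2, q)` preserves the Baer subplane of the vectors
`(x, m * σ x)`. -/
theorem exists_rightTranslate_iff (m : NegOneNorm F q) {u : Fin 2 → F} (hu0 : u ≠ 0)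
    (hu1 : hermNorm F q u ≠ 1) :
    (∃ g, levelSet q u 1 = rightTranslate (transvectionSubgroup q m.1 : Set (SU2 F q)) g) ↔
      u 1 = m.1 * σ (u 0) := by
  constructor
  · rintro ⟨g, hg⟩
    rw [coe_transvectionSubgroup m.2, rightTranslate_levelSet] at hg
    rw [levelSet_injective hu0 hu1 (mulVec_ne_zero g⁻¹ (one_vec_ne_zero _))
      (by
        rw [hermNorm_mulVec, hermNorm_one_eq, m.2]
        simp) hg]
    exact mulVec_mem_baerSubplane g⁻¹ m.2 (by simp)
  · intro h
    obtain ⟨g, hg⟩ := exists_mulVec_zero_eq_one hu0 (hermNorm_eq_zero_of_eq_mul norm_conj_conj m h)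
    refine ⟨g, ?_⟩
    have h1 := mulVec_mem_baerSubplane g m.2 h
    rw [hg, map_one, mul_one] at h1
    rw [coe_transvectionSubgroup m.2, rightTranslate_levelSet, ← h1,
      ← eq_vec_of_zero_eq_one hg, inv_mulVec_mulVec]

/-- An incidence structure on the points and blocks of the construction is isomorphic to a model if
the conjugates of `T` are attached to the secants as in the model. -/
theorem isomorphic_of_attached (m₀ : NegOneNorm F q) {τ : F →+* F}
    (hτ : ∀ x, τ x * σ (τ x) = x * σ x)
    (E : IncStr (SU2 F q ⊕ conjClass (transvectionSubgroup q m₀.1))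
      (Option (gsvBlocks (transvectionSubgroup q m₀.1) (diagonalSubgroup F q)
        (secantFamily F q))))
    (h1 : ∀ g X, E.inc (Sum.inl g) (some X) ↔ g ∈ X.1) (h2 : ∀ g, ¬ E.inc (Sum.inl g) none)
    (h3 : ∀ C, E.inc (Sum.inr C) none)
    (h4 : ∀ (m : NegOneNorm F q) hm u hu, hermNorm F q u ≠ 0 →
      ¬ E.inc (Sum.inr ⟨transvectionSubgroup q m.1, hm⟩) (some ⟨levelSet q u 0, hu⟩))
    (h5 : ∀ (m : NegOneNorm F q) hm u hu, u ≠ 0 → hermNorm F q u ≠ 1 →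
      (E.inc (Sum.inr ⟨transvectionSubgroup q m.1, hm⟩) (some ⟨levelSet q u 1, hu⟩) ↔
        u 1 = m.1 * τ (u 0))) :
    (unitalModel (q := q) τ).Isomorphic E := by
  let f : NegOneNorm F q → conjClass (transvectionSubgroup q m₀.1) := fun m =>
    ⟨transvectionSubgroup q m.1, (mem_conjClass_iff m₀ _).2 ⟨m, rfl⟩⟩
  have hf : Function.Bijective f := by
    constructor
    · intro m m' h
      exact transvectionSubgroup_injective (congrArg Subtype.val h)
    · rintro ⟨C, hC⟩
      obtain ⟨m, rfl⟩ := (mem_conjClass_iff m₀ C).1 hC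
      exact ⟨m, rfl⟩
  have hne : ∀ X : gsvBlocks (transvectionSubgroup q m₀.1) (diagonalSubgroup F q)
      (secantFamily F q), X.1.Nonempty := by
    rintro ⟨X, hX⟩
    rcases (mem_gsvBlocks_iff m₀ X).1 hX with ⟨u, hu, rfl⟩ | ⟨u, hu0, hu1, rfl⟩
    · have h : (levelSet q u 0).ncard ≠ 0 := by
        rw [ncard_levelSet_zero hu]
        omega
      exact Set.nonempty_of_ncard_ne_zero h
    · have h := one_lt_ncard_levelSet hu0 hu1
      exact Set.nonempty_of_ncard_ne_zero (s := levelSet q u 1) (by omega)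
  let e : UnitSphere F q ⊕ NegOneNorm F q ≃ SU2 F q ⊕ conjClass (transvectionSubgroup q m₀.1) :=
    Equiv.sumCongr (rowEquiv F q).symm (Equiv.ofBijective f hf)
  have k0 : ∀ u (hu : hermNorm F q u ≠ 0) hX p,
      (unitalModel τ).inc p (some (Sum.inl ⟨_, u, hu, rfl⟩)) ↔
        E.inc (e p) (some ⟨levelSet q u 0, hX⟩) := by
    rintro u hu hX (r | m)
    · rw [show e (Sum.inl r) = Sum.inl ((rowEquiv F q).symm r) from rfl, h1]
      simp only [mem_levelSet, rowEquiv_symm_mulVec, unitalModel_inl_inl, Set.mem_ofPred_eq]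
    · exact iff_of_false id (h4 m _ u hX hu)
  have k1 : ∀ u (hu0 : u ≠ 0) (hu1 : hermNorm F q u ≠ 1) hX p,
      (unitalModel τ).inc p (some (Sum.inr ⟨u, hu0, hu1⟩)) ↔
        E.inc (e p) (some ⟨levelSet q u 1, hX⟩) := by
    rintro u hu0 hu1 hX (r | m)
    · rw [show e (Sum.inl r) = Sum.inl ((rowEquiv F q).symm r) from rfl, h1]
      simp only [mem_levelSet, rowEquiv_symm_mulVec, unitalModel_inl_inr]
    · exact (h5 m _ u hX hu0 hu1).symm
  have knone : ∀ p, (unitalModel (q := q) τ).inc p none ↔ E.inc (e p) none := by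
    rintro (r | m)
    · exact iff_of_false id (h2 _)
    · exact iff_of_true trivial (h3 _)
  refine IncStr.isomorphic_of_simple (isSteiner_unitalModel hτ).simple ?_ e ?_ ?_
  · rintro (_ | X) (_ | X') h
    · rfl
    · obtain ⟨g, hg⟩ := hne X'
      exact absurd ((h (Sum.inl g)).2 ((h1 g X').2 hg)) (h2 g)
    · obtain ⟨g, hg⟩ := hne X
      exact absurd ((h (Sum.inl g)).1 ((h1 g X).2 hg)) (h2 g)
    · congr 1
      apply Subtype.ext
      ext g
      rw [← h1, ← h1, h]
  · rintro (_ | ⟨X, u, hu, rfl⟩ | ⟨u, hu0, hu1⟩)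
    · exact ⟨none, knone⟩
    · exact ⟨some ⟨_, (mem_gsvBlocks_iff m₀ _).2 (Or.inl ⟨u, hu, rfl⟩)⟩, k0 u hu _⟩
    · exact ⟨some ⟨_, (mem_gsvBlocks_iff m₀ _).2 (Or.inr ⟨u, hu0, hu1, rfl⟩)⟩, k1 u hu0 hu1 _⟩
  · rintro (_ | ⟨X, hX⟩)
    · exact ⟨none, knone⟩
    · rcases (mem_gsvBlocks_iff m₀ X).1 hX with ⟨u, hu, rfl⟩ | ⟨u, hu0, hu1, rfl⟩
      · exact ⟨_, k0 u hu hX⟩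
      · exact ⟨_, k1 u hu0 hu1 hX⟩

theorem isomorphic_gsvUnital (m₀ : NegOneNorm F q) :
    (unitalModel (q := q) (RingHom.id F)).Isomorphic
      (gsvUnital (transvectionSubgroup q m₀.1) (diagonalSubgroup F q) (secantFamily F q)) := by
  refine isomorphic_of_attached m₀ (fun _ => rfl) _ (fun _ _ => Iff.rfl) (fun _ => id)
    (fun _ => trivial) ?_ fun m _ u _ hu0 hu1 => exists_leftTranslate_iff m hu0 hu1
  rintro m _ u _ hu ⟨g, hg⟩
  have h := ncard_levelSet_zero hu
  replace hg : levelSet q u 0 = leftTranslate g (transvectionSubgroup q m.1 : Set (SU2 F q)) := hg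
  rw [hg, (ncard_translate m g).1] at h
  omega

theorem isomorphic_gsvUnitalFlat (m₀ : NegOneNorm F q) :
    (unitalModel (F := F) (q := q) (conj F q)).Isomorphic
      (gsvUnitalFlat (transvectionSubgroup q m₀.1) (diagonalSubgroup F q) (secantFamily F q)) := by
  refine isomorphic_of_attached m₀ norm_conj_conj _ (fun _ _ => Iff.rfl) (fun _ => id)
    (fun _ => trivial) ?_ fun m _ u _ hu0 hu1 => exists_rightTranslate_iff m hu0 hu1
  rintro m _ u _ hu ⟨g, hg⟩
  have h := ncard_levelSet_zero hu
  replace hg : levelSet q u 0 = rightTranslate (transvectionSubgroup q m.1 : Set (SU2 F q)) g := hg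
  rw [hg, (ncard_translate m g).2] at h
  omega

end SpecialUnitary

theorem mainTheorem4 (q : ℕ) (F : Type*) [Field F] [Finite F] (hF : Nat.card F = q ^ 2) :
    (hermitianUnital F q).IsSteiner (q ^ 3 + 1) (q + 1) ∧
    (hermitianUnital F q).AntiPasch ∧
    (¬ ∃ D' R Q, (hermitianUnital F q).IsSwitching D' (q ^ 3 + 1) (q + 1) R Q) ∧
    ∃ b χ, (hermitianUnital F q).IsProperColoring b χ ∧
      ¬ (hermitianUnital F q).EquivColoring b χ ((hermitianUnital F q).trivialColoring b) ∧
      (2 < q →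
        ¬ ((hermitianUnital F q).paramodification b χ).Isomorphic (hermitianUnital F q)) ∧
      ((hermitianUnital F q).paramodification b χ).Isomorphic (grueningUnital F q) ∧
      ∃ (T S : Subgroup (SU2 F q)) (𝒟 : Set (Set (SU2 F q))), IsGSVSystem q T S 𝒟 ∧
        (gsvUnital T S 𝒟).Isomorphic (hermitianUnital F q) ∧
        (gsvUnitalFlat T S 𝒟).Isomorphic ((hermitianUnital F q).paramodification b χ) := by
  have : Fact (Nat.card F = q ^ 2) := ⟨hF⟩
  have hS := isSteiner_hermitianUnital (F := F) (q := q)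
  have hA := antiPasch_hermitianUnital (F := F) (q := q)
  obtain ⟨b, χ, h1, h2, h3⟩ := exists_paramodification_hermitianUnital (F := F) (q := q)
  obtain ⟨m, hm⟩ := exists_mul_conj_eq (F := F) (q := q) (a := -1) (by simp)
  refine ⟨hS, hA, ?_, b, χ, h1, h2, ?_, h3.trans isomorphic_grueningUnital,
    transvectionSubgroup q m, diagonalSubgroup F q, secantFamily F q, isGSVSystem ⟨m, hm⟩,
    (isomorphic_gsvUnital ⟨m, hm⟩).symm.trans isomorphic_hermitianUnital,
    (isomorphic_gsvUnitalFlat ⟨m, hm⟩).symm.trans h3.symm⟩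
  · rintro ⟨D', R, Q, h⟩
    exact hS.not_isSwitching (one_lt_of_card_eq_sq F q) hA D' R Q h
  · intro hq hiso
    exact not_antiPasch_unitalModel_conj (F := F) hq (hA.of_isomorphic (h3.symm.trans hiso))
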